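/- **Notation.** Words are over $\{0,1,2\}$. $R$ is reversal; for $i\in\{0,1,2\}$, $E_i$ is the involutory antimorphism fixing the letter $i$ and exchanging the other two. A word $v$ is a $\vartheta$-palindrome if $\vartheta(v)=v$, and a pseudopalindrome if it is a $\vartheta$-palindrome for some $\vartheta\in\{R,E_0,E_1,E_2\}$; $u^{\vartheta}$ is the shortest $\vartheta$-palindrome with prefix $u$. A directive bi-sequence $(\Delta,\Theta)=(\delta_1\delta_2\ldots,\vartheta_1\vartheta_2\ldots)$, with letters $\delta_m$ and $\vartheta_m\in\{R,E_0,E_1,E_2\}$, defines $w_0=\varepsilon$, $w_{m+1}=(w_m\delta_{m+1})^{\vartheta_{m+1}}$. Its prefix of length $n$ is *normalized* if every pseudopalindromic prefix of $w_n$ is one of $w_0,\dots,w_n$. A pseudopalindromic prefix of $w_{n+1}$ is *missed* between $w_n$ and $w_{n+1}$ if its length lies strictly between $|w_n|$ and $|w_{n+1}|$. Its *initial block* consists of the positions $m$ with $w_m=i^m$ for a letter $i$; there the choice between $\vartheta_m=R$ and $\vartheta_m=E_i$ has no influence on the generated words, and a *representative* of $(\Delta,\Theta)$ is any $(\Delta,\Theta')$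 obtained by changing such choices in the initial block. Throughout, $i,j,k$ denote pairwise different letters. **Prefix patterns.** For $l\ge 1$: $(i^l,E_i^{l-1}E_k)$; $(i(ji)^{l-1}j,\,E_i(E_kR)^{l-1}E_i)$ for $l\ge2$; $((ij)^li,\,E_iE_k(RE_k)^{l-1}E_j)$; $(ijj,E_iE_kE_i)$; $(ijj,E_iE_kE_k)$; $(ijk(jj)^{l-1}j,\,E_iE_kE_j(RE_j)^{l-1}E_k)$; $(ijkj(jj)^{l-1}j,\,E_iE_kE_jR(E_jR)^{l-1}E_i)$; $(ij,E_iR)$; $(ij,E_iE_j)$; $(ij(ij)^{l-1}i,\,E_iE_k(RE_k)^{l-1}E_i)$; $(i(ji)^lj,\,E_i(E_kR)^lE_j)$; $((ijk)^{l-1}ijk,\,(E_iE_kE_j)^{l-1}E_iE_kR)$; $((ijk)^lij,\,(E_iE_kE_j)^lE_iR)$; $((ijk)^li,\,(E_iE_kE_j)^lR)$; $((ijk)^ljk,\,(E_iE_kE_j)^lRR)$; $((ijk)^likk,\,(E_iE_kE_j)^lE_iRR)$; $((ijk)^{l-1}ijik,\,(E_iE_kE_j)^{l-1}E_iE_kRR)$;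 $(i(ji)^{l-1}jkj,\,E_i(E_kR)^{l-1}E_kE_jE_j)$; $(ij(ij)^{l-1}ikk,\,E_iE_k(RE_k)^{l-1}RE_iE_k)$; $(i^ljj,\,E_i^lE_kE_k)$; $(ij(ij)^lkk,\,E_iE_k(RE_k)^lE_iE_i)$; $(i^ljj,\,E_i^lE_kE_i)$; $(ij(ij)^{l-1}ikj,\,E_iE_k(RE_k)^{l-1}RE_jE_k)$; $(ijk(jj)^{l-1}ik,\,E_iE_kE_j(RE_j)^{l-1}E_iE_i)$; $(ijk(jj)^{l-1}jki,\,E_iE_kE_j(RE_j)^{l-1}RE_kE_j)$. **Theorem.** Let $(\Delta,\Theta)$ be a directive bi-sequence whose prefix of length $n$ is normalized, and suppose that the prefix of length $n+1$ of no representative of $(\Delta,\Theta)$ is one of the above patterns. Then exactly one pseudopalindromic prefix is missed between $w_n$ and $w_{n+1}$ if and only if $n\ge 2$ and, for some representative $(\Delta,\Theta')$, the triple $(\delta_{n-1}\delta_n\delta_{n+1},\vartheta'_{n-1}\vartheta'_n\vartheta'_{n+1})$ has one of the forms - $(ab_1b_2,RE_iE_i)$ with $b_1=E_i(b_2)$,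 except $(iii,RE_iE_i)$ with $w_{n-1}=i^{n-1}$; - $(ab_1b_2,E_iRR)$ with $b_1=E_i(b_2)$, except $(iii,E_iRR)$ with $w_{n-1}=i^{n-1}$; - $(ab_1b_2,E_iE_jE_i)$ with $E_i(b_1)=E_j(b_2)$. Moreover, whenever a representative has one of these forms, rewrite its triple at positions $n-1,n,n+1$ by the respective rule 1. $(ab_1b_2,RE_iE_i)\to(ab_1b_2b_1,RE_iRE_i)$, 2. $(ab_1b_2,E_iRR)\to(ab_1b_2b_1,E_iRE_iR)$, 3. $(ab_1b_2,E_iE_jE_i)\to(ab_1b_2\,E_iE_j(b_1),E_iE_jE_kE_i)$, where $E_iE_j(b_1)=E_i(E_j(b_1))$. Then the new bi-sequence has a normalized prefix of length $n+2$, and its words $w'_m$ satisfy $w'_{m+1}=w_m$ for all $m\ge n+1$ (so it generates the same infinite word). If moreover the representative has $\vartheta'_m=E_i$ at every position $m\le n$ of its initial block with $w_m=i^m$, then the new bi-sequence has the same property at all positions $m\le n+2$. -/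

import Mathlib

namespace Pseudostandard

/-- The ternary alphabet `{0, 1, 2}`. -/
abbrev Letter := Fin 3

/-- Finite ternary words. -/
abbrev Word := List Letter

/-- The four involutory antimorphisms over the ternary alphabet: the reversal map `R` and
`E 0`, `E 1`, `E 2`. -/
inductive Anti where
  | R : Anti
  | E : Letter → Anti
  deriving DecidableEq

open Anti

/-- Image of a letter: `R` fixes every letter, `E i` fixes `i` and exchanges the other two. -/
def Anti.letter : Anti → Letter → Letter
  | R, a => a
  | E i, a => Equiv.swap (i + 1) (i + 2) a

/-- Image of a word under an involutory antimorphism. -/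
def Anti.image (t : Anti) (w : Word) : Word := (w.map t.letter).reverse

/-- `w` is a `t`-palindrome. -/
def IsPal (t : Anti) (w : Word) : Prop := t.image w = w

instance (t : Anti) (w : Word) : Decidable (IsPal t w) :=
  inferInstanceAs (Decidable (t.image w = w))

/-- `w` is a pseudopalindrome. -/
def IsPseudopal (w : Word) : Prop := ∃ t, IsPal t w

theorem exists_pal_suffix (t : Anti) (u : Word) : ∃ s, IsPal t (u.drop s) :=
  ⟨u.length, by simp [IsPal, Anti.image]⟩

/-- The `t`-palindromic closure of `u`: writing `u = v p` with `p` the longest `t`-palindromic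
suffix of `u`, it is `v p t(v)`. By `closure_spec` below it is the shortest `t`-palindrome with
prefix `u`. -/
def closure (t : Anti) (u : Word) : Word :=
  u ++ t.image (u.take (Nat.find (exists_pal_suffix t u)))

theorem Anti.letter_letter (t : Anti) (a : Letter) : t.letter (t.letter a) = a := by
  cases t <;> simp [Anti.letter]

theorem Anti.image_image (t : Anti) (w : Word) : t.image (t.image w) = w := by
  simp [Anti.image, Function.comp_def, Anti.letter_letter]

theorem Anti.image_append (t : Anti) (u v : Word) :
    t.image (u ++ v) = t.image v ++ t.image u := by
  simp [Anti.image]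

theorem Anti.length_image (t : Anti) (w : Word) : (t.image w).length = w.length := by
  simp [Anti.image]

/-- `closure t u` is a `t`-palindrome with prefix `u`, and every other such word is strictly
longer. -/
theorem closure_spec (t : Anti) (u : Word) :
    IsPal t (closure t u) ∧ u <+: closure t u ∧
      ∀ v, IsPal t v → u <+: v → v ≠ closure t u → (closure t u).length < v.length := by
  have hs := Nat.find_spec (exists_pal_suffix t u)
  have hmin := fun s => Nat.find_min (exists_pal_suffix t u) (m := s)
  unfold closure
  generalize Nat.find (exists_pal_suffix t u) = s at hs hmin
  refine ⟨?_, List.prefix_append _ _, ?_⟩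
  · have h : u = u.take s ++ u.drop s := (List.take_append_drop s u).symm
    have h2 : u ++ t.image (u.take s) = u.take s ++ (u.drop s ++ t.image (u.take s)) := by
      rw [← List.append_assoc, ← h]
    unfold IsPal at hs ⊢
    rw [h2, Anti.image_append, Anti.image_append, Anti.image_image, hs, List.append_assoc]
  · rintro v hv ⟨x, rfl⟩ hne
    by_contra hlt
    simp only [List.length_append, Anti.length_image, List.length_take] at hlt
    have hx : x.length ≤ min s u.length := by omega
    have hxu : x.length ≤ u.length := by omega
    have hpal : t.image x ++ t.image u = u ++ x := by
      rw [← Anti.image_append]; exact hv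
    have hdec : u = t.image x ++ u.drop x.length := by
      have h1 := congrArg (List.take x.length) hpal
      rw [List.take_append_of_le_length hxu, List.take_append_of_le_length
        (by rw [Anti.length_image]), List.take_of_length_le (by rw [Anti.length_image])] at h1
      rw [h1, List.take_append_drop]
    have hdrop : IsPal t (u.drop x.length) := by
      have h1 := hpal
      rw [hdec, Anti.image_append, Anti.image_image, List.append_assoc] at h1
      have h2 := List.append_cancel_left h1
      have h3 := List.append_cancel_right h2
      exact h3
    have hsx : s ≤ x.length := by
      by_contra hc
      exact hmin x.length (by omega) hdrop
    have hs' : s = x.length := by omega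
    apply hne
    have h1 : u.take s = t.image x := by
      rw [hs', hdec, List.take_append_of_le_length (by rw [Anti.length_image]),
        List.take_of_length_le (by rw [Anti.length_image])]
    rw [h1, Anti.image_image]

/-- The words `w_n` of the directive bi-sequence `(δ₁δ₂…, ϑ₁ϑ₂…)`, where `δ_{m+1} = Δ m` and
`ϑ_{m+1} = Θ m`. -/
def w (Δ : ℕ → Letter) (Θ : ℕ → Anti) : ℕ → Word
  | 0 => []
  | n + 1 => closure (Θ n) (w Δ Θ n ++ [Δ n])

/-- The prefix of length `n` of the bi-sequence is normalized: every pseudopalindromic prefix of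
`w_n` is one of `w_0, …, w_n`. -/
def NormalizedPrefix (Δ : ℕ → Letter) (Θ : ℕ → Anti) (n : ℕ) : Prop :=
  ∀ p : Word, p <+: w Δ Θ n → IsPseudopal p → ∃ k ≤ n, w Δ Θ k = p

/-- The pseudopalindromic prefixes missed between `w_n` and `w_{n+1}`. -/
def missed (Δ : ℕ → Letter) (Θ : ℕ → Anti) (n : ℕ) : Set Word :=
  {p | p <+: w Δ Θ (n + 1) ∧ IsPseudopal p ∧
    (w Δ Θ n).length < p.length ∧ p.length < (w Δ Θ (n + 1)).length}

/-- `Θ'` arises from `Θ` by choosing freely between `R` and `E i` (which generate the same words)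
at the positions of the initial block where `w_m = i^m`. -/
def BlockEquiv (Δ : ℕ → Letter) (Θ Θ' : ℕ → Anti) : Prop :=
  ∀ m, Θ' m = Θ m ∨
    ∃ i, w Δ Θ (m + 1) = List.replicate (m + 1) i ∧ (Θ' m = R ∨ Θ' m = E i)

/-- `Θ` carries `E i` at every position `m ≤ n` of the initial block where `w_m = i^m`. -/
def Preprocessed (Δ : ℕ → Letter) (Θ : ℕ → Anti) (n : ℕ) : Prop :=
  ∀ m < n, ∀ i, w Δ Θ (m + 1) = List.replicate (m + 1) i → Θ m = E i

/-- The power `x^l`. -/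
def pow {α : Type} (x : List α) (l : ℕ) : List α := (List.replicate l x).flatten

/-- The left sides of the prefix substitution rules for one missed pseudopalindromic prefix, for
pairwise different letters `i, j, k` and `l = m + 1` (so that `l - 1 = m`). In the second entry the
exponent `l - 1` is required to be at least one, hence is replaced by `m + 1`. -/
def prefixRuleLeftSides (i j k : Letter) (m : ℕ) : List (Word × List Anti) :=
  [ (pow [i] (m + 1), pow [E i] m ++ [E k]),
    ([i] ++ pow [j, i] (m + 1) ++ [j], [E i] ++ pow [E k, R] (m + 1) ++ [E i]),
    (pow [i, j] (m + 1) ++ [i], [E i, E k] ++ pow [R, E k] m ++ [E j]),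
    ([i, j, j], [E i, E k, E i]),
    ([i, j, j], [E i, E k, E k]),
    ([i, j, k] ++ pow [j, j] m ++ [j], [E i, E k, E j] ++ pow [R, E j] m ++ [E k]),
    ([i, j, k, j] ++ pow [j, j] m ++ [j], [E i, E k, E j, R] ++ pow [E j, R] m ++ [E i]),
    ([i, j], [E i, R]),
    ([i, j], [E i, E j]),
    ([i, j] ++ pow [i, j] m ++ [i], [E i, E k] ++ pow [R, E k] m ++ [E i]),
    ([i] ++ pow [j, i] (m + 1) ++ [j], [E i] ++ pow [E k, R] (m + 1) ++ [E j]),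
    (pow [i, j, k] m ++ [i, j, k], pow [E i, E k, E j] m ++ [E i, E k, R]),
    (pow [i, j, k] (m + 1) ++ [i, j], pow [E i, E k, E j] (m + 1) ++ [E i, R]),
    (pow [i, j, k] (m + 1) ++ [i], pow [E i, E k, E j] (m + 1) ++ [R]),
    (pow [i, j, k] (m + 1) ++ [j, k], pow [E i, E k, E j] (m + 1) ++ [R, R]),
    (pow [i, j, k] (m + 1) ++ [i, k, k], pow [E i, E k, E j] (m + 1) ++ [E i, R, R]),
    (pow [i, j, k] m ++ [i, j, i, k], pow [E i, E k, E j] m ++ [E i, E k, R, R]),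
    ([i] ++ pow [j, i] m ++ [j, k, j], [E i] ++ pow [E k, R] m ++ [E k, E j, E j]),
    ([i, j] ++ pow [i, j] m ++ [i, k, k], [E i, E k] ++ pow [R, E k] m ++ [R, E i, E k]),
    (pow [i] (m + 1) ++ [j, j], pow [E i] (m + 1) ++ [E k, E k]),
    ([i, j] ++ pow [i, j] (m + 1) ++ [k, k],
      [E i, E k] ++ pow [R, E k] (m + 1) ++ [E i, E i]),
    (pow [i] (m + 1) ++ [j, j], pow [E i] (m + 1) ++ [E k, E i]),
    ([i, j] ++ pow [i, j] m ++ [i, k, j], [E i, E k] ++ pow [R, E k] m ++ [R, E j, E k]),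
    ([i, j, k] ++ pow [j, j] m ++ [i, k], [E i, E k, E j] ++ pow [R, E j] m ++ [E i, E i]),
    ([i, j, k] ++ pow [j, j] m ++ [j, k, i],
      [E i, E k, E j] ++ pow [R, E j] m ++ [R, E k, E j]) ]

/-- The finite bi-sequence `(D, T)` is the left side of one of the prefix rules. -/
def IsPrefixRuleLeftSide (D : Word) (T : List Anti) : Prop :=
  ∃ i j k : Letter, i ≠ j ∧ j ≠ k ∧ i ≠ k ∧ ∃ m, (D, T) ∈ prefixRuleLeftSides i j k m

/-- The prefix of length `n` of a sequence. -/
def pre {α : Type} (f : ℕ → α) (n : ℕ) : List α := (List.range n).map f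

/-- The three forms of `(δ_{n-1}δ_nδ_{n+1}, ϑ_{n-1}ϑ_nϑ_{n+1}) = (a b₁ b₂, t₁ t₂ t₃)`, with the
exceptions; `u` stands for `w_{n-1}` and `r` for `n - 1`. -/
def MissForm (u : Word) (r : ℕ) (a b₁ b₂ : Letter) (t₁ t₂ t₃ : Anti) : Prop :=
  (∃ i, t₁ = R ∧ t₂ = E i ∧ t₃ = E i ∧ b₁ = (E i).letter b₂ ∧
    ¬ (a = i ∧ b₁ = i ∧ b₂ = i ∧ u = List.replicate r i)) ∨
  (∃ i, t₁ = E i ∧ t₂ = R ∧ t₃ = R ∧ b₁ = (E i).letter b₂ ∧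
    ¬ (a = i ∧ b₁ = i ∧ b₂ = i ∧ u = List.replicate r i)) ∨
  (∃ i j, i ≠ j ∧ t₁ = E i ∧ t₂ = E j ∧ t₃ = E i ∧ (E i).letter b₁ = (E j).letter b₂)

/-- The factor substitution rules `(D, T) → (D', T')`. -/
inductive FactorRule : Word → List Anti → Word → List Anti → Prop
  | rule₁ (a b₁ b₂ i : Letter) (h : b₁ = (E i).letter b₂) :
      FactorRule [a, b₁, b₂] [R, E i, E i] [a, b₁, b₂, b₁] [R, E i, R, E i]
  | rule₂ (a b₁ b₂ i : Letter) (h : b₁ = (E i).letter b₂) :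
      FactorRule [a, b₁, b₂] [E i, R, R] [a, b₁, b₂, b₁] [E i, R, E i, R]
  | rule₃ (a b₁ b₂ i j k : Letter) (hij : i ≠ j) (hjk : j ≠ k) (hik : i ≠ k)
      (h : (E i).letter b₁ = (E j).letter b₂) :
      FactorRule [a, b₁, b₂] [E i, E j, E i]
        [a, b₁, b₂, (E i).letter ((E j).letter b₁)] [E i, E j, E k, E i]

/-- Replace the factor of length three of `f` at the positions `m, m + 1, m + 2` by `x`. -/
def replaceFactor {α : Type} (f : ℕ → α) (m : ℕ) (x : List α) : ℕ → α :=
  fun p => if p < m then f p else (x[p - m]?).getD (f (p - x.length + 3))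

end Pseudostandard

namespace Pseudostandard

open Anti

/-! ### Palindromic prefixes and twisted periods. -/

section

/-! On letters, `R` acts as the identity and `E i` as the transposition fixing `i`: these are the
elements of S₃ of order at most two. If the prefixes of lengths l and l + d are palindromes of types
s and t, then composing the two reflections shows that translation by d acts on the first l letters
as the permutation t∘s (`PalAt.twist`). Such a twisted period carries pseudopalindromic prefixes to
longer or shorter ones (`PalAt.shift_up`, `PseudopalAt.shift_down`), as long as the product of the
three types involved is again an involution. Otherwise it is a 3-cycle, and then the prefix is at
most as long as the period (`PalAt.le_of_cycle`).

Suppose that exactly one prefix is missed, of length L and type v, and let s and t be the types of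
w_n and w_{n+1}. Put c = |w_{n+1}| - L. The twist t∘v carries w_n to a pseudopalindromic prefix of
length |w_n| + c, which by uniqueness is the missed one. So w_n, the missed prefix and w_{n+1} are
equally spaced. Reflecting in w_n gives a further prefix in the progression, of length |w_n| - c and
type r = svs. Both t∘v and v∘s now describe translation by c, and comparing them leaves three
possibilities for (r, s, v, t), collected in `ConsecutiveTypes`. If no pseudopalindromic prefix lies
strictly between lengths |w_n| - c and |w_n|, the prefix of type r is w_{n-1} (or n = 1), and this
is one of the three forms.

Each step can fail, but only if |w_{n+1}| is 2|w_n| + 1 or 2|w_n| + 2. Then two pseudopalindromic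
prefixes differ in length by one or two. This short period makes w_n or w_{n-1} constant,
alternating, cyclic or a zigzag ijkjijkj…, all directive letters and types can be read off, and the
result is one of the excluded patterns (the lemmas `Generates.pattern_of_…`; everything is combined
in `Generates.pattern_or_form`).

Conversely, in one of the forms let c = |w_n| - |w_{n-1}|. Minimality of the closures and
normalization force |w_{n+1}| = |w_n| + 2c, the prefix halfway is a v-palindrome, and any other
missed prefix could be shifted down by c into the gap between w_{n-1} and w_n
(`Generates.missed_of_form`). The rewriting rules insert exactly this v-palindrome as a new word of
the sequence. -/

instance : Fintype Anti where
  elems := {R, E 0, E 1, E 2}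
  complete := by
    rintro (_ | i)
    · decide
    · fin_cases i <;> decide

/-- The prefix of length `l` of `W` is a `t`-palindrome. -/
def PalAt (W : ℕ → Letter) (t : Anti) (l : ℕ) : Prop :=
  ∀ x y, x + y + 1 = l → W x = t.letter (W y)

/-- The prefix of length `l` of `W` is a pseudopalindrome. -/
def PseudopalAt (W : ℕ → Letter) (l : ℕ) : Prop := ∃ t, PalAt W t l

/-- The factor of `W` at the positions `a, …, N` is a `t`-palindrome. -/
def SuffixPal (W : ℕ → Letter) (t : Anti) (a N : ℕ) : Prop :=
  ∀ x y, a ≤ x → a ≤ y → x + y = a + N → W x = t.letter (W y)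

theorem Anti.letter_injective (t : Anti) : Function.Injective t.letter :=
  fun a b h => by rw [← t.letter_letter a, h, t.letter_letter]

/-- A conjugate of an involution is an involution. It is the type obtained when a `t`-palindromic
factor is reflected inside an `s`-palindrome. -/
theorem Anti.exists_conj (s t : Anti) :
    ∃ r : Anti, ∀ a, r.letter a = s.letter (t.letter (s.letter a)) := by
  revert s t; decide

/-- A product of three antimorphisms acts on letters as an antimorphism or as a 3-cycle. -/
theorem Anti.exists_or_cycle (r s t : Anti) :
    (∃ u : Anti, ∀ a, u.letter a = r.letter (s.letter (t.letter a))) ∨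
      ∀ a, r.letter (s.letter (t.letter (r.letter (s.letter (t.letter a))))) ≠ a := by
  revert r s t; decide

theorem exists_third {i j : Letter} (h : i ≠ j) : ∃ k, j ≠ k ∧ i ≠ k := by
  revert i j; decide

variable {W : ℕ → Letter} {c l N : ℕ} {r s t : Anti}

/-- Reflecting in the shorter prefix and then in the longer one is a translation by the difference
of the lengths, and the letter maps compose. -/
theorem PalAt.twist {m : ℕ} (hs : PalAt W s l) (ht : PalAt W t m) {d : ℕ} (hd : l + d = m) :
    ∀ x < l, W (x + d) = t.letter (s.letter (W x)) := by
  intro x hx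
  rw [ht (x + d) (l - 1 - x) (by omega), hs (l - 1 - x) x (by omega)]

/-- A position `y ≥ c` is a translate, so the reflection in the prefix of length `l` determines its
letter. For `c ≤ l` every mirrored pair contains such a position; for `c = l + 1` only the central
letter `W l` is left over, whence the extra condition. -/
theorem PalAt.shift_up (hW : ∀ x < N, W (x + c) = r.letter (s.letter (W x))) (ht : PalAt W t l)
    (hl : l ≤ N) {u : Anti} (hu : ∀ a, u.letter a = r.letter (s.letter (t.letter a)))
    (hc : c ≤ l ∨ c = l + 1 ∧ u.letter (W l) = W l) : PalAt W u (l + c) := by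
  have key : ∀ x y, x + y + 1 = l + c → c ≤ y → W y = u.letter (W x) := by
    intro x y h hy
    obtain ⟨z, rfl⟩ := Nat.exists_eq_add_of_le' hy
    rw [hW z (by omega), ht z x (by omega), hu]
  intro x y h
  by_cases hx : c ≤ x
  · exact key y x (by omega) hx
  by_cases hy : c ≤ y
  · rw [key x y h hy, letter_letter]
  rcases hc with hc | ⟨hc, hf⟩
  · omega
  · obtain rfl : x = l := by omega
    obtain rfl : y = x := by omega
    exact hf.symm

/-- If `c < l`, the positions `c` and `l - 1` are mirror images in length `l + c`, and the square of
the product fixes `W (l - 1)`. The square of a 3-cycle has no fixed point. -/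
theorem PalAt.le_of_cycle (hW : ∀ x < N, W (x + c) = r.letter (s.letter (W x))) (ht : PalAt W t l)
    (hl : l ≤ N)
    (hn : ∀ a, r.letter (s.letter (t.letter (r.letter (s.letter (t.letter a))))) ≠ a) : l ≤ c := by
  by_contra! hc
  have h1 := hW (l - 1 - c) (by omega)
  have h2 := hW 0 (by omega)
  rw [show l - 1 - c + c = l - 1 by omega, ht (l - 1 - c) c (by omega)] at h1
  rw [Nat.zero_add, ht 0 (l - 1) (by omega)] at h2
  rw [h2] at h1
  exact (hn _ h1.symm).elim

theorem PseudopalAt.shift_up (hW : ∀ x < N, W (x + c) = r.letter (s.letter (W x)))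
    (h : PseudopalAt W l) (hl : l ≤ N) (hc : c < l) : PseudopalAt W (l + c) := by
  obtain ⟨t, ht⟩ := h
  rcases Anti.exists_or_cycle r s t with ⟨u, hu⟩ | hn
  · exact ⟨u, ht.shift_up hW hl hu (Or.inl hc.le)⟩
  · have := ht.le_of_cycle hW hl hn
    omega

/-- Unlike the shift upwards, this needs no comparison of `c` with `l`: the first and last letters
of the short prefix already exclude a 3-cycle. -/
theorem PseudopalAt.shift_down (hW : ∀ x < N, W (x + c) = r.letter (s.letter (W x)))
    (h : PseudopalAt W (l + c)) (hl : l ≤ N) (h0 : 0 < l) : PseudopalAt W l := by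
  obtain ⟨t, ht⟩ := h
  have key : ∀ x y, x + y + 1 = l → W x = s.letter (r.letter (t.letter (W y))) := by
    intro x y h
    have h1 := hW x (by omega)
    rw [ht (x + c) y (by omega)] at h1
    rw [h1, letter_letter, letter_letter]
  rcases Anti.exists_or_cycle s r t with ⟨u, hu⟩ | hn
  · exact ⟨u, fun x y h => by rw [hu, key x y h]⟩
  · have h1 := key 0 (l - 1) (by omega)
    rw [key (l - 1) 0 (by omega)] at h1
    exact (hn _ h1.symm).elim

/-- Both types must agree on every letter that occurs, and two different antimorphisms agree on at
most one letter. -/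
theorem PalAt.eq_or_const (hs : PalAt W s l) (ht : PalAt W t l) (hl : 0 < l) :
    s = t ∨ ∃ i, (∀ x < l, W x = i) ∧ (s = R ∨ s = E i) ∧ (t = R ∨ t = E i) := by
  have key : ∀ s t : Anti, s = t ∨ ∃ i, (∀ a, s.letter a = t.letter a → a = i) ∧
      (s = R ∨ s = E i) ∧ (t = R ∨ t = E i) ∨ ∀ a, s.letter a ≠ t.letter a := by decide
  obtain h | ⟨i, ⟨h1, h2⟩ | h⟩ := key s t
  · exact Or.inl h
  · refine Or.inr ⟨i, fun x hx => h1 _ ?_, h2⟩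
    rw [← hs (l - 1 - x) x (by omega), ht (l - 1 - x) x (by omega)]
  · refine (h (W 0) ?_).elim
    rw [← hs (l - 1) 0 (by omega), ht (l - 1) 0 (by omega)]

/-- Position `N` is the letter appended to the prefix of length `N`. Removing both ends of the
palindromic suffix leaves a suffix of the `s`-palindrome, whose mirror image is a prefix of
conjugated type. -/
theorem PalAt.conj_of_suffix (hs : PalAt W s N) {a : ℕ} (ht : SuffixPal W t a N) (ha : l + a + 1 = N)
    (hr : ∀ a, r.letter a = s.letter (t.letter (s.letter a))) : PalAt W r l := by
  intro x y h
  rw [hs x (y + a + 1) (by omega), ht (y + a + 1) (x + a + 1) (by omega) (by omega) (by omega),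
    hs (x + a + 1) y (by omega), hr]

theorem PalAt.suffix {m a : ℕ} (ht : PalAt W t m) (h : m = N + 1 + a) : SuffixPal W t a N :=
  fun x y _ _ hxy => ht x y (by omega)

theorem pseudopalAt_zero : PseudopalAt W 0 := ⟨R, fun _ _ h => by omega⟩

theorem pseudopalAt_one : PseudopalAt W 1 :=
  ⟨R, fun x y h => by
    obtain rfl : x = 0 := by omega
    obtain rfl : y = 0 := by omega
    rfl⟩

theorem pseudopalAt_two : PseudopalAt W 2 := by
  have key : ∀ a b : Letter, ∃ t : Anti, t.letter a = b ∧ t.letter b = a := by decide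
  obtain ⟨t, h1, h2⟩ := key (W 0) (W 1)
  refine ⟨t, fun x y h => ?_⟩
  obtain ⟨rfl, rfl⟩ | ⟨rfl, rfl⟩ : x = 0 ∧ y = 1 ∨ x = 1 ∧ y = 0 := by omega
  · exact h2.symm
  · exact h1.symm

end

/-! ### Generated words as one letter sequence; words of simple shape. -/

section

/-- `W` runs through the letters of the words generated by `(Δ, T)`, the word of index `k` being its
prefix of length `len k`, and the prefix of length `n` of `(Δ, T)` is normalized. -/
structure Generates (W Δ : ℕ → Letter) (T : ℕ → Anti) (len : ℕ → ℕ) (n : ℕ) : Prop where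
  zero : len 0 = 0
  lt : ∀ k ≤ n, len k < len (k + 1)
  pal : ∀ k ≤ n, PalAt W (T k) (len (k + 1))
  letter : ∀ k ≤ n, W (len k) = Δ k
  norm : ∀ l ≤ len n, PseudopalAt W l → ∃ k ≤ n, len k = l
  min : ∀ k ≤ n, ∀ a, SuffixPal W (T k) a (len k) → len (k + 1) ≤ len k + 1 + a

variable {W Δ : ℕ → Letter} {T : ℕ → Anti} {len : ℕ → ℕ} {n : ℕ}

theorem Generates.mono (h : Generates W Δ T len n) {a b : ℕ} (hab : a < b) (hb : b ≤ n + 1) :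
    len a < len b := by
  induction b, hab using Nat.le_induction with
  | base => exact h.lt a (by omega)
  | succ b hab ih => exact (ih (by omega)).trans (h.lt b (by omega))

theorem Generates.inj (h : Generates W Δ T len n) {a b : ℕ} (hab : len a = len b) (ha : a ≤ n + 1)
    (hb : b ≤ n + 1) : a = b := by
  rcases lt_trichotomy a b with h1 | h1 | h1
  · exact absurd hab (h.mono h1 hb).ne
  · exact h1
  · exact absurd hab (h.mono h1 ha).ne'

theorem Generates.pseudopalAt (h : Generates W Δ T len n) {k : ℕ} (hk : k ≤ n + 1) :
    PseudopalAt W (len k) := by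
  rcases k with _ | k
  · rw [h.zero]; exact pseudopalAt_zero
  · exact ⟨_, h.pal k (by omega)⟩

/-- Normalization makes consecutive pseudopalindromic prefixes consecutive words of the sequence;
this is how lengths of the words are computed below. -/
theorem Generates.next (h : Generates W Δ T len n) {k b : ℕ} (hk : k ≤ n) (hb : len k < b)
    (hn : b ≤ len n) (hp : PseudopalAt W b) (hno : ∀ l, len k < l → l < b → ¬ PseudopalAt W l) :
    k + 1 ≤ n ∧ len (k + 1) = b := by
  obtain ⟨k', hk', rfl⟩ := h.norm b hn hp
  have h1 : k < k' := by
    by_contra hc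
    rcases (not_lt.mp hc).eq_or_lt with h2 | h2
    · subst h2; omega
    · have := h.mono h2 (by omega); omega
  refine ⟨by omega, ?_⟩
  by_contra hne
  have h2 : len (k + 1) < len k' := h.mono (lt_of_le_of_ne h1 fun e => hne (by rw [← e])) (by omega)
  exact hno _ (h.lt k hk) h2 (h.pseudopalAt (by omega))

theorem Generates.len_eq (h : Generates W Δ T len n) {p : ℕ} (hp : p ≤ len n)
    (hpp : ∀ l ≤ p, PseudopalAt W l) : p ≤ n ∧ ∀ k ≤ p, len k = k := by
  induction p with
  | zero => exact ⟨by omega, fun k hk => by obtain rfl : k = 0 := by omega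
                                            exact h.zero⟩
  | succ p ih =>
    obtain ⟨h1, h2⟩ := ih (by omega) fun l hl => hpp l (by omega)
    have h3 := h2 p le_rfl
    obtain ⟨h4, h5⟩ := h.next (b := p + 1) h1 (by omega) hp (hpp _ le_rfl) (by omega)
    refine ⟨h4, fun k hk => ?_⟩
    rcases hk.eq_or_lt with rfl | hk
    · exact h5
    · exact h2 k (by omega)

/-- `T` carries `E i` wherever the generated word is a power of the letter `i`. -/
def Canonical (W : ℕ → Letter) (T : ℕ → Anti) (len : ℕ → ℕ) (n : ℕ) : Prop :=
  ∀ k < n, len (k + 1) = k + 1 → (∀ x ≤ k, W x = W 0) → T k = E (W 0)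

/-- This and the next two shapes are those in which translation by one acts as a permutation of the
letters. -/
def ConstOn (W : ℕ → Letter) (i : Letter) (p : ℕ) : Prop := ∀ x < p, W x = i

structure AltOn (W : ℕ → Letter) (i j : Letter) (p : ℕ) : Prop where
  even : ∀ x < p, x % 2 = 0 → W x = i
  odd : ∀ x < p, x % 2 = 1 → W x = j

structure CycleOn (W : ℕ → Letter) (i j k : Letter) (p : ℕ) : Prop where
  zero : ∀ x < p, x % 3 = 0 → W x = i
  one : ∀ x < p, x % 3 = 1 → W x = j
  two : ∀ x < p, x % 3 = 2 → W x = k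

/-- The prefix of length `p` of `W` is a prefix of `ijkjijkj…`. -/
structure ZigzagOn (W : ℕ → Letter) (i j k : Letter) (p : ℕ) : Prop where
  zero : ∀ x < p, x % 4 = 0 → W x = i
  odd : ∀ x < p, x % 2 = 1 → W x = j
  two : ∀ x < p, x % 4 = 2 → W x = k

variable {i j k : Letter} {p l : ℕ} {s t : Anti}

theorem Anti.letter_R (a : Letter) : R.letter a = a := rfl

theorem Anti.letter_E_self (a : Letter) : (E a).letter a = a := by revert a; decide

theorem Anti.letter_E (hij : i ≠ j) (hjk : j ≠ k) (hik : i ≠ k) :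
    (E k).letter i = j ∧ (E k).letter j = i := by
  revert i j k; decide

theorem Anti.eq_R (hij : i ≠ j) (h1 : t.letter i = i) (h2 : t.letter j = j) : t = R := by
  revert i j t; decide

theorem Anti.eq_E (hij : i ≠ j) (hjk : j ≠ k) (hik : i ≠ k) (h : t.letter i = j) : t = E k := by
  revert i j k t; decide

theorem ConstOn.palAt (h : ConstOn W i p) (ht : t.letter i = i) (hl : l ≤ p) : PalAt W t l :=
  fun x y hxy => by rw [h x (by omega), h y (by omega), ht]

theorem AltOn.palAt_odd (h : AltOn W i j p) (hl : l ≤ p) (h2 : l % 2 = 1) : PalAt W R l := by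
  intro x y hxy
  rcases Nat.mod_two_eq_zero_or_one x with hx | hx
  · rw [h.even x (by omega) hx, h.even y (by omega) (by omega)]; rfl
  · rw [h.odd x (by omega) hx, h.odd y (by omega) (by omega)]; rfl

theorem AltOn.palAt_even (h : AltOn W i j p) (hij : i ≠ j) (hjk : j ≠ k) (hik : i ≠ k) (hl : l ≤ p)
    (h2 : l % 2 = 0) : PalAt W (E k) l := by
  obtain ⟨e1, e2⟩ := letter_E hij hjk hik
  intro x y hxy
  rcases Nat.mod_two_eq_zero_or_one x with hx | hx
  · rw [h.even x (by omega) hx, h.odd y (by omega) (by omega), e2]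
  · rw [h.odd x (by omega) hx, h.even y (by omega) (by omega), e1]

theorem AltOn.pseudopalAt (h : AltOn W i j p) (hij : i ≠ j) (hl : l ≤ p) : PseudopalAt W l := by
  obtain ⟨k, hjk, hik⟩ := exists_third hij
  rcases Nat.mod_two_eq_zero_or_one l with h2 | h2
  · exact ⟨_, h.palAt_even hij hjk hik hl h2⟩
  · exact ⟨_, h.palAt_odd hl h2⟩

theorem AltOn.eq_R (h : AltOn W i j p) (hij : i ≠ j) (hl : l ≤ p) (h2 : l % 2 = 1) (h3 : 2 ≤ l)
    (ht : PalAt W t l) : t = R := by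
  refine Anti.eq_R hij (t := t) ?_ ?_
  · have := ht 0 (l - 1) (by omega)
    rwa [h.even 0 (by omega) rfl, h.even (l - 1) (by omega) (by omega), eq_comm] at this
  · have := ht 1 (l - 2) (by omega)
    rwa [h.odd 1 (by omega) rfl, h.odd (l - 2) (by omega) (by omega), eq_comm] at this

theorem AltOn.eq_E (h : AltOn W i j p) (hij : i ≠ j) (hjk : j ≠ k) (hik : i ≠ k) (hl : l ≤ p)
    (h2 : l % 2 = 0) (h3 : 2 ≤ l) (ht : PalAt W t l) : t = E k := by
  refine Anti.eq_E hij.symm hik hjk (t := t) ?_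
  have := ht 0 (l - 1) (by omega)
  rwa [h.even 0 (by omega) rfl, h.odd (l - 1) (by omega) (by omega), eq_comm] at this

theorem CycleOn.palAt_zero (h : CycleOn W i j k p) (hij : i ≠ j) (hjk : j ≠ k) (hik : i ≠ k)
    (hl : l ≤ p) (h3 : l % 3 = 0) : PalAt W (E j) l := by
  obtain ⟨e1, e2⟩ := letter_E hik hjk.symm hij
  intro x y hxy
  obtain hx | hx | hx : x % 3 = 0 ∨ x % 3 = 1 ∨ x % 3 = 2 := by omega
  · rw [h.zero x (by omega) hx, h.two y (by omega) (by omega), e2]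
  · rw [h.one x (by omega) hx, h.one y (by omega) (by omega), letter_E_self]
  · rw [h.two x (by omega) hx, h.zero y (by omega) (by omega), e1]

theorem CycleOn.palAt_one (h : CycleOn W i j k p) (hij : i ≠ j) (hjk : j ≠ k) (hik : i ≠ k)
    (hl : l ≤ p) (h3 : l % 3 = 1) : PalAt W (E i) l := by
  obtain ⟨e1, e2⟩ := letter_E hjk hik.symm hij.symm
  intro x y hxy
  obtain hx | hx | hx : x % 3 = 0 ∨ x % 3 = 1 ∨ x % 3 = 2 := by omega
  · rw [h.zero x (by omega) hx, h.zero y (by omega) (by omega), letter_E_self]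
  · rw [h.one x (by omega) hx, h.two y (by omega) (by omega), e2]
  · rw [h.two x (by omega) hx, h.one y (by omega) (by omega), e1]

theorem CycleOn.palAt_two (h : CycleOn W i j k p) (hij : i ≠ j) (hjk : j ≠ k) (hik : i ≠ k)
    (hl : l ≤ p) (h3 : l % 3 = 2) : PalAt W (E k) l := by
  obtain ⟨e1, e2⟩ := letter_E hij hjk hik
  intro x y hxy
  obtain hx | hx | hx : x % 3 = 0 ∨ x % 3 = 1 ∨ x % 3 = 2 := by omega
  · rw [h.zero x (by omega) hx, h.one y (by omega) (by omega), e2]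
  · rw [h.one x (by omega) hx, h.zero y (by omega) (by omega), e1]
  · rw [h.two x (by omega) hx, h.two y (by omega) (by omega), letter_E_self]

theorem CycleOn.pseudopalAt (h : CycleOn W i j k p) (hij : i ≠ j) (hjk : j ≠ k) (hik : i ≠ k)
    (hl : l ≤ p) : PseudopalAt W l := by
  obtain h3 | h3 | h3 : l % 3 = 0 ∨ l % 3 = 1 ∨ l % 3 = 2 := by omega
  · exact ⟨_, h.palAt_zero hij hjk hik hl h3⟩
  · exact ⟨_, h.palAt_one hij hjk hik hl h3⟩
  · exact ⟨_, h.palAt_two hij hjk hik hl h3⟩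

theorem Anti.eq_of_letter_ne (hij : i ≠ j) (h1 : s.letter i = t.letter i)
    (h2 : s.letter j = t.letter j) : s = t := by
  revert i j s t; decide

theorem PalAt.eq_of_ne (hs : PalAt W s l) (ht : PalAt W t l) {x y : ℕ} (hx : x < l) (hy : y < l)
    (hxy : W x ≠ W y) : s = t :=
  Anti.eq_of_letter_ne hxy
    (by rw [← hs (l - 1 - x) x (by omega), ← ht (l - 1 - x) x (by omega)])
    (by rw [← hs (l - 1 - y) y (by omega), ← ht (l - 1 - y) y (by omega)])

theorem CycleOn.ne (h : CycleOn W i j k p) (hij : i ≠ j) (hp : 2 ≤ p) : W 0 ≠ W 1 := by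
  rwa [h.zero 0 (by omega) rfl, h.one 1 (by omega) rfl]

theorem CycleOn.eq_E_zero (h : CycleOn W i j k p) (hij : i ≠ j) (hjk : j ≠ k) (hik : i ≠ k)
    (hl : l ≤ p) (h3 : l % 3 = 0) (h2 : 2 ≤ l) (ht : PalAt W t l) : t = E j :=
  ht.eq_of_ne (h.palAt_zero hij hjk hik hl h3) (by omega) (by omega) (h.ne hij (by omega))

theorem CycleOn.eq_E_one (h : CycleOn W i j k p) (hij : i ≠ j) (hjk : j ≠ k) (hik : i ≠ k)
    (hl : l ≤ p) (h3 : l % 3 = 1) (h2 : 2 ≤ l) (ht : PalAt W t l) : t = E i :=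
  ht.eq_of_ne (h.palAt_one hij hjk hik hl h3) (by omega) (by omega) (h.ne hij (by omega))

theorem CycleOn.eq_E_two (h : CycleOn W i j k p) (hij : i ≠ j) (hjk : j ≠ k) (hik : i ≠ k)
    (hl : l ≤ p) (h3 : l % 3 = 2) (ht : PalAt W t l) : t = E k :=
  ht.eq_of_ne (h.palAt_two hij hjk hik hl h3) (by omega) (by omega) (h.ne hij (by omega))

theorem ZigzagOn.palAt_three (h : ZigzagOn W i j k p) (hij : i ≠ j) (hjk : j ≠ k) (hik : i ≠ k)
    (hl : l ≤ p) (h3 : l % 4 = 3) : PalAt W (E j) l := by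
  obtain ⟨e1, e2⟩ := letter_E hik hjk.symm hij
  intro x y hxy
  obtain hx | hx | hx : x % 4 = 0 ∨ x % 2 = 1 ∨ x % 4 = 2 := by omega
  · rw [h.zero x (by omega) hx, h.two y (by omega) (by omega), e2]
  · rw [h.odd x (by omega) hx, h.odd y (by omega) (by omega), letter_E_self]
  · rw [h.two x (by omega) hx, h.zero y (by omega) (by omega), e1]

theorem ZigzagOn.palAt_one (h : ZigzagOn W i j k p) (hl : l ≤ p) (h1 : l % 4 = 1) :
    PalAt W R l := by
  intro x y hxy
  obtain hx | hx | hx : x % 4 = 0 ∨ x % 2 = 1 ∨ x % 4 = 2 := by omega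
  · rw [h.zero x (by omega) hx, h.zero y (by omega) (by omega), letter_R]
  · rw [h.odd x (by omega) hx, h.odd y (by omega) (by omega), letter_R]
  · rw [h.two x (by omega) hx, h.two y (by omega) (by omega), letter_R]

/-- In even length the positions 0 and 2 carry different letters, but both are mirrored to a `j`. -/
theorem ZigzagOn.not_pseudopalAt (h : ZigzagOn W i j k p) (hik : i ≠ k) (hl : l ≤ p)
    (h2 : l % 2 = 0) (h4 : 4 ≤ l) : ¬ PseudopalAt W l := by
  rintro ⟨t, ht⟩
  have h1 := ht 0 (l - 1) (by omega)
  have h3 := ht 2 (l - 3) (by omega)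
  rw [h.zero 0 (by omega) rfl, h.odd (l - 1) (by omega) (by omega)] at h1
  rw [h.two 2 (by omega) rfl, h.odd (l - 3) (by omega) (by omega)] at h3
  exact hik (h1.trans h3.symm)

/-- This and the next two lemmas read the bi-sequence off a prefix of simple shape. All its prefixes
are pseudopalindromes, so normalization gives `len k = k`. Types are determined once two letters
occur, and `Canonical` fixes them before that. -/
theorem Generates.const_head (h : Generates W Δ T len n) (hc : Canonical W T len n)
    (hW : ConstOn W i p) (hp : p ≤ len n) :
    p ≤ n ∧ len p = p ∧ (∀ k < p, Δ k = i) ∧ ∀ k < p, T k = E i := by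
  obtain ⟨h1, h2⟩ := h.len_eq hp fun l hl => ⟨R, hW.palAt rfl hl⟩
  refine ⟨h1, h2 p le_rfl, fun k hk => ?_, fun k hk => ?_⟩
  · rw [← h.letter k (by omega), h2 k hk.le, hW k hk]
  · rw [hc k (by omega) (h2 _ hk) fun x hx => by rw [hW x (by omega), hW 0 (by omega)],
      hW 0 (by omega)]

theorem Generates.alt_head (h : Generates W Δ T len n) (hc : Canonical W T len n)
    (hW : AltOn W i j p) (hij : i ≠ j) (hjk : j ≠ k) (hik : i ≠ k) (hp : p ≤ len n) (h0 : 0 < p) :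
    p ≤ n ∧ len p = p ∧ AltOn Δ i j p ∧ T 0 = E i ∧ (∀ q < p, q % 2 = 1 → T q = E k) ∧
      ∀ q < p, 0 < q → q % 2 = 0 → T q = R := by
  obtain ⟨h1, h2⟩ := h.len_eq hp fun l hl => hW.pseudopalAt hij hl
  have hD : ∀ q < p, Δ q = W q := fun q hq => by rw [← h.letter q (by omega), h2 q hq.le]
  refine ⟨h1, h2 p le_rfl, ⟨fun q hq he => ?_, fun q hq he => ?_⟩, ?_, fun q hq he => ?_,
    fun q hq h0 he => ?_⟩
  · rw [hD q hq, hW.even q hq he]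
  · rw [hD q hq, hW.odd q hq he]
  · rw [hc 0 (by omega) (h2 1 h0) fun x hx => by rw [Nat.le_zero.mp hx], hW.even 0 h0 rfl]
  · have := h.pal q (by omega)
    rw [h2 (q + 1) hq] at this
    exact hW.eq_E hij hjk hik hq (by omega) (by omega) this
  · have := h.pal q (by omega)
    rw [h2 (q + 1) hq] at this
    exact hW.eq_R hij hq (by omega) (by omega) this

theorem Generates.cycle_head (h : Generates W Δ T len n) (hc : Canonical W T len n)
    (hW : CycleOn W i j k p) (hij : i ≠ j) (hjk : j ≠ k) (hik : i ≠ k) (hp : p ≤ len n) (h0 : 0 < p) :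
    p ≤ n ∧ len p = p ∧ CycleOn Δ i j k p ∧ (∀ q < p, q % 3 = 0 → T q = E i) ∧
      (∀ q < p, q % 3 = 1 → T q = E k) ∧ ∀ q < p, q % 3 = 2 → T q = E j := by
  obtain ⟨h1, h2⟩ := h.len_eq hp fun l hl => hW.pseudopalAt hij hjk hik hl
  have hD : ∀ q < p, Δ q = W q := fun q hq => by rw [← h.letter q (by omega), h2 q hq.le]
  have hT : ∀ q < p, PalAt W (T q) (q + 1) := fun q hq => by
    have := h.pal q (by omega)
    rwa [h2 (q + 1) hq] at this
  refine ⟨h1, h2 p le_rfl, ⟨fun q hq he => ?_, fun q hq he => ?_, fun q hq he => ?_⟩,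
    fun q hq he => ?_, fun q hq he => ?_, fun q hq he => ?_⟩
  · rw [hD q hq, hW.zero q hq he]
  · rw [hD q hq, hW.one q hq he]
  · rw [hD q hq, hW.two q hq he]
  · rcases Nat.eq_zero_or_pos q with rfl | h0
    · rw [hc 0 (by omega) (h2 1 hq) fun x hx => by rw [Nat.le_zero.mp hx], hW.zero 0 hq rfl]
    · exact hW.eq_E_one hij hjk hik (Nat.succ_le_of_lt hq) (by omega) (by omega) (hT q hq)
  · exact hW.eq_E_two hij hjk hik (Nat.succ_le_of_lt hq) (by omega) (hT q hq)
  · exact hW.eq_E_zero hij hjk hik (Nat.succ_le_of_lt hq) (by omega) (by omega) (hT q hq)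

/-- After the first three letters only odd lengths are pseudopalindromic, so every further step adds
two letters. -/
theorem Generates.zigzag_head (h : Generates W Δ T len n) (hc : Canonical W T len n) {q : ℕ}
    (hW : ZigzagOn W i j k (3 + 2 * q)) (hij : i ≠ j) (hjk : j ≠ k) (hik : i ≠ k)
    (hp : 3 + 2 * q ≤ len n) :
    3 + q ≤ n ∧ len (3 + q) = 3 + 2 * q ∧ (Δ 0 = i ∧ Δ 1 = j ∧ Δ 2 = k ∧ ∀ x < q, Δ (3 + x) = j) ∧
      T 0 = E i ∧ T 1 = E k ∧ T 2 = E j ∧ (∀ x < q, x % 2 = 0 → T (3 + x) = R) ∧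
      ∀ x < q, x % 2 = 1 → T (3 + x) = E j := by
  have hcyc : CycleOn W i j k 3 :=
    ⟨fun x hx hm => hW.zero x (by omega) (by omega), fun x hx hm => hW.odd x (by omega) (by omega),
      fun x hx hm => hW.two x (by omega) (by omega)⟩
  obtain ⟨h3, h4, hD, hT0, hT1, hT2⟩ := h.cycle_head hc hcyc hij hjk hik (by omega) (by omega)
  have hpal : ∀ l ≤ 3 + 2 * q, l % 2 = 1 → PseudopalAt W l := by
    intro l hl ho
    obtain h1 | h1 : l % 4 = 1 ∨ l % 4 = 3 := by omega
    · exact ⟨_, hW.palAt_one hl h1⟩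
    · exact ⟨_, hW.palAt_three hij hjk hik hl h1⟩
  have hlen : ∀ x ≤ q, 3 + x ≤ n ∧ len (3 + x) = 3 + 2 * x := by
    intro x
    induction x with
    | zero => exact fun _ => ⟨h3, h4⟩
    | succ x ih =>
      intro hx
      obtain ⟨h5, h6⟩ := ih (by omega)
      have := h.next (k := 3 + x) (b := 3 + 2 * (x + 1)) h5 (by omega) (by omega)
        (hpal _ (by omega) (by omega)) fun l hl hl' => hW.not_pseudopalAt hik (by omega) (by omega)
          (by omega)
      exact this
  have hne : W 0 ≠ W 1 := by rwa [hW.zero 0 (by omega) rfl, hW.odd 1 (by omega) rfl]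
  have hTp : ∀ x < q, PalAt W (T (3 + x)) (5 + 2 * x) := fun x hx => by
    have := h.pal (3 + x) (hlen x hx.le).1
    rwa [show 3 + x + 1 = 3 + (x + 1) by ring, (hlen (x + 1) hx).2,
      show 3 + 2 * (x + 1) = 5 + 2 * x by ring] at this
  refine ⟨(hlen q le_rfl).1, (hlen q le_rfl).2, ⟨hD.zero 0 (by omega) rfl, hD.one 1 (by omega) rfl,
    hD.two 2 (by omega) rfl, fun x hx => ?_⟩, hT0 0 (by omega) rfl, hT1 1 (by omega) rfl,
    hT2 2 (by omega) rfl, fun x hx he => ?_, fun x hx ho => ?_⟩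
  · rw [← h.letter _ (hlen x hx.le).1, (hlen x hx.le).2, hW.odd _ (by omega) (by omega)]
  · exact (hTp x hx).eq_of_ne (hW.palAt_one (by omega) (by omega)) (by omega) (by omega) hne
  · exact (hTp x hx).eq_of_ne (hW.palAt_three hij hjk hik (by omega) (by omega)) (by omega)
      (by omega) hne

/-! Reading off the prefixes of `Δ` and `T`. -/

theorem pre_add {α : Type} (f : ℕ → α) (a b : ℕ) :
    pre f (a + b) = pre f a ++ pre (fun x => f (a + x)) b := by
  simp [pre, List.range_add, Function.comp_def]

theorem pow_succ' {α : Type} (x : List α) (m : ℕ) : pow x (m + 1) = pow x m ++ x := by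
  simp [pow, List.replicate_succ']

theorem pre_pow_one {α : Type} {f : ℕ → α} {a : α} {m : ℕ} (h : ∀ x < m, f x = a) :
    pre f m = pow [a] m := by
  induction m with
  | zero => rfl
  | succ m ih =>
    rw [pre_add, ih fun x hx => h x (by omega), pow_succ']
    simp [pre, h m]

theorem pre_pow_two {α : Type} {f : ℕ → α} {a b : α} {m : ℕ}
    (h0 : ∀ x < 2 * m, x % 2 = 0 → f x = a) (h1 : ∀ x < 2 * m, x % 2 = 1 → f x = b) :
    pre f (2 * m) = pow [a, b] m := by
  induction m with
  | zero => rfl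
  | succ m ih =>
    rw [mul_add, pre_add, ih (fun x hx => h0 x (by omega)) (fun x hx => h1 x (by omega)), pow_succ']
    simp [pre, List.range_succ, h0 (2 * m) (by omega) (by omega),
      h1 (2 * m + 1) (by omega) (by omega)]

theorem pre_pow_three {α : Type} {f : ℕ → α} {a b c : α} {m : ℕ}
    (h0 : ∀ x < 3 * m, x % 3 = 0 → f x = a) (h1 : ∀ x < 3 * m, x % 3 = 1 → f x = b)
    (h2 : ∀ x < 3 * m, x % 3 = 2 → f x = c) :
    pre f (3 * m) = pow [a, b, c] m := by
  induction m with
  | zero => rfl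
  | succ m ih =>
    rw [mul_add, pre_add, ih (fun x hx => h0 x (by omega)) (fun x hx => h1 x (by omega))
      (fun x hx => h2 x (by omega)), pow_succ']
    simp [pre, List.range_succ, h0 (3 * m) (by omega) (by omega),
      h1 (3 * m + 1) (by omega) (by omega), h2 (3 * m + 2) (by omega) (by omega)]

end

/-! ### Twisted period one: reading off patterns. -/

section

variable {W Δ : ℕ → Letter} {T : ℕ → Anti} {len : ℕ → ℕ} {n : ℕ}
variable {i j k : Letter} {p l : ℕ} {s t : Anti}

/-- The word follows the orbit of its first letter under the permutation `s ∘ t`, and an orbit on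
three letters has size one, two or three. -/
theorem twist_one (hW : ∀ x, x + 1 < p → W (x + 1) = s.letter (t.letter (W x))) :
    ConstOn W (W 0) p ∨ (∃ i j, i ≠ j ∧ 2 ≤ p ∧ AltOn W i j p) ∨
      ∃ i j k, i ≠ j ∧ j ≠ k ∧ i ≠ k ∧ 3 ≤ p ∧ CycleOn W i j k p := by
  set g : Letter → Letter := fun a => s.letter (t.letter a) with hg
  have hinj : ∀ a b, g a = g b → a = b := fun a b h => t.letter_injective (s.letter_injective h)
  by_cases h1 : g (W 0) = W 0
  · left
    intro x
    induction x with
    | zero => exact fun _ => rfl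
    | succ x ih =>
      intro hx
      rw [hW x hx, ih (by omega)]; exact h1
  have key : ∀ i : Letter, ∀ j, i ≠ j → ∀ k, (k = i ∨ k = j) ∨ (i ≠ j ∧ j ≠ k ∧ i ≠ k ∧
      ∀ l, l = i ∨ l = j ∨ l = k) := by decide
  rcases Nat.lt_or_ge p 2 with hp | hp
  · left
    intro x hx
    obtain rfl : x = 0 := by omega
    rfl
  right
  have e1 : W 1 = g (W 0) := hW 0 hp
  rcases Nat.lt_or_ge p 3 with hp3 | hp3
  · refine Or.inl ⟨W 0, W 1, fun e => h1 (e1.symm.trans e.symm), hp, fun x hx hm => ?_,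
      fun x hx hm => ?_⟩
    · rw [show x = 0 by omega]
    · rw [show x = 1 by omega]
  have e2 : W 2 = g (W 1) := hW 1 hp3
  rcases key (W 0) (W 1) (fun e => h1 (e1.symm.trans e.symm)) (W 2) with h2 | ⟨h2, h3, h4, h5⟩
  · have e3 : g (W 1) = W 0 := by
      rcases h2 with h2 | h2
      · rw [← e2, h2]
      · exact (h1 (hinj _ _ (by rw [← e1, ← e2, h2]))).elim
    refine Or.inl ⟨W 0, W 1, fun e => h1 (e1.symm.trans e.symm), hp, ?_⟩
    have : ∀ x < p, (x % 2 = 0 → W x = W 0) ∧ (x % 2 = 1 → W x = W 1) := by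
      intro x
      induction x with
      | zero => exact fun _ => ⟨fun _ => rfl, by simp⟩
      | succ x ih =>
        intro hx
        obtain ⟨i1, i2⟩ := ih (by omega)
        refine ⟨fun hm => ?_, fun hm => ?_⟩
        · rw [hW x hx, i2 (by omega)]; exact e3
        · rw [hW x hx, i1 (by omega)]; exact e1.symm
    exact ⟨fun x hx => (this x hx).1, fun x hx => (this x hx).2⟩
  · have e3 : g (W 2) = W 0 := by
      rcases h5 (g (W 2)) with h | h | h
      · exact h
      · exact (h4 (hinj _ _ (by rw [h, e1]))).elim
      · exact (h3 (hinj _ _ (by rw [h, e2]))).elim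
    refine Or.inr ⟨W 0, W 1, W 2, h2, h3, h4, hp3, ?_⟩
    have : ∀ x < p, (x % 3 = 0 → W x = W 0) ∧ (x % 3 = 1 → W x = W 1) ∧
        (x % 3 = 2 → W x = W 2) := by
      intro x
      induction x with
      | zero => exact fun _ => ⟨fun _ => rfl, by simp, by simp⟩
      | succ x ih =>
        intro hx
        obtain ⟨i1, i2, i3⟩ := ih (by omega)
        refine ⟨fun hm => ?_, fun hm => ?_, fun hm => ?_⟩
        · rw [hW x hx, i3 (by omega)]; exact e3
        · rw [hW x hx, i1 (by omega)]; exact e1.symm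
        · rw [hW x hx, i2 (by omega)]; exact e2.symm
    exact ⟨fun x hx => (this x hx).1, fun x hx => (this x hx).2.1, fun x hx => (this x hx).2.2⟩

theorem PalAt.twist_one (hs : PalAt W s l) (ht : PalAt W t (l + 1)) :
    ConstOn W (W 0) (l + 1) ∨ (∃ i j, i ≠ j ∧ 2 ≤ l + 1 ∧ AltOn W i j (l + 1)) ∨
      ∃ i j k, i ≠ j ∧ j ≠ k ∧ i ≠ k ∧ 3 ≤ l + 1 ∧ CycleOn W i j k (l + 1) :=
  Pseudostandard.twist_one fun x hx => hs.twist ht rfl x (by omega)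

theorem pre_two {α : Type} {f : ℕ → α} {a b : α} (h0 : f 0 = a) (h1 : f 1 = b) :
    pre f 2 = [a, b] := by subst h0 h1; rfl

theorem pre_one {α : Type} {f : ℕ → α} {a : α} (h0 : f 0 = a) : pre f 1 = [a] := by subst h0; rfl

theorem pre_three {α : Type} {f : ℕ → α} {a b c : α} (h0 : f 0 = a) (h1 : f 1 = b) (h2 : f 2 = c) :
    pre f 3 = [a, b, c] := by subst h0 h1 h2; rfl

theorem pre_four {α : Type} {f : ℕ → α} {a b c d : α} (h0 : f 0 = a) (h1 : f 1 = b) (h2 : f 2 = c)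
    (h3 : f 3 = d) : pre f 4 = [a, b, c, d] := by subst h0 h1 h2 h3; rfl

theorem pre_split_one {α : Type} {f : ℕ → α} {u : α} {Z : List α} {m c N : ℕ} (hN : N = m + c)
    (hu : ∀ x < m, f x = u) (hZ : pre (fun x => f (m + x)) c = Z) :
    pre f N = pow [u] m ++ Z := by
  rw [hN, pre_add, hZ, pre_pow_one hu]

theorem pre_split_two {α : Type} {f : ℕ → α} {u v : α} {X Z : List α} {a m c N : ℕ}
    (hN : N = a + 2 * m + c) (hX : pre f a = X)
    (hu : ∀ x < 2 * m, x % 2 = 0 → f (a + x) = u) (hv : ∀ x < 2 * m, x % 2 = 1 → f (a + x) = v)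
    (hZ : pre (fun x => f (a + 2 * m + x)) c = Z) :
    pre f N = X ++ pow [u, v] m ++ Z := by
  rw [hN, pre_add, pre_add, hX, hZ, pre_pow_two hu hv]

theorem pre_split_three {α : Type} {f : ℕ → α} {u v w : α} {Z : List α} {m c N : ℕ}
    (hN : N = 3 * m + c) (hu : ∀ x < 3 * m, x % 3 = 0 → f x = u)
    (hv : ∀ x < 3 * m, x % 3 = 1 → f x = v) (hw : ∀ x < 3 * m, x % 3 = 2 → f x = w)
    (hZ : pre (fun x => f (3 * m + x)) c = Z) :
    pre f N = pow [u, v, w] m ++ Z := by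
  rw [hN, pre_add, hZ, pre_pow_three hu hv hw]

/-- The number `q` is the position of the pattern in the list, counted from zero. Entries 3 and 4
are the cases `m = 0` of entries 21 and 19 and need no separate treatment. -/
theorem isPrefixRuleLeftSide_of {D D' : Word} {U U' : List Anti} (hD : D = D') (hU : U = U')
    (hij : i ≠ j) (hjk : j ≠ k) (hik : i ≠ k) (m q : ℕ)
    (h : (prefixRuleLeftSides i j k m)[q]? = some (D', U')) : IsPrefixRuleLeftSide D U :=
  ⟨i, j, k, hij, hjk, hik, m, List.mem_of_getElem? (by rw [hD, hU]; exact h)⟩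

theorem Anti.eq_E_of_ne (h1 : t.letter i ≠ i) : ∃ k, i ≠ k ∧ t = E k := by
  revert i t; decide

theorem Anti.eq_R_or_E (h1 : t.letter i = i) : t = R ∨ t = E i := by
  revert i t; decide

theorem AltOn.mono (h : AltOn W i j p) (hl : l ≤ p) : AltOn W i j l :=
  ⟨fun x hx => h.even x (by omega), fun x hx => h.odd x (by omega)⟩

theorem CycleOn.mono (h : CycleOn W i j k p) (hl : l ≤ p) : CycleOn W i j k l :=
  ⟨fun x hx => h.zero x (by omega), fun x hx => h.one x (by omega), fun x hx => h.two x (by omega)⟩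

theorem Generates.eq_of_len (h : Generates W Δ T len n) {q : ℕ} (hq : q ≤ n) (hl : len q = len n) :
    n = q := h.inj hl.symm (by omega) (by omega)

/-- The word `w_n` is followed by a letter making a pseudopalindrome, and `w_{n+1}` has the maximal
possible length. -/
theorem Generates.pattern_of_long (h : Generates W Δ T len n) (hc : Canonical W T len n)
    (h0 : 0 < n) (hlen : len (n + 1) = 2 * len n + 2)
    (hpp : PseudopalAt W (len n + 1))
    (hu : ∀ l, len n < l → l < len (n + 1) → PseudopalAt W l → l = len n + 1) :
    IsPrefixRuleLeftSide (pre Δ (n + 1)) (pre T (n + 1)) := by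
  have hpos : 0 < len n := by have := h.mono h0 (by omega); omega
  obtain ⟨s, hs⟩ := h.pseudopalAt (k := n) (by omega)
  obtain ⟨t, ht⟩ := hpp
  -- At maximal length no nonempty suffix of `w_n` with its new letter is palindromic; this is
  -- exploited for suffixes of length one, two and three.
  have hmin : ∀ a ≤ len n, ¬ SuffixPal W (T n) a (len n) := fun a ha hS => by
    have := h.min n le_rfl a hS; omega
  have hθ : (T n).letter (W (len n)) ≠ W (len n) := fun e => hmin (len n) le_rfl fun x y hx hy hxy => by
    rw [show x = len n by omega, show y = len n by omega, e]
  have hpair : (T n).letter (W (len n)) ≠ W (len n - 1) := fun e =>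
    hmin (len n - 1) (by omega) fun x y hx hy hxy => by
      obtain ⟨rfl, rfl⟩ | ⟨rfl, rfl⟩ : x = len n ∧ y = len n - 1 ∨ x = len n - 1 ∧ y = len n := by
        omega
      · rw [← e, letter_letter]
      · rw [e]
  have hpal := h.pal n le_rfl
  rcases hs.twist_one ht with hW | ⟨i, j, hij, -, hW⟩ | ⟨i, j, k, hij, hjk, hik, h3, hW⟩
  · obtain ⟨h1, h2, h3, h4⟩ := h.const_head hc (p := len n) (fun x hx => hW x (by omega)) le_rfl
    have hn := h.eq_of_len h1 h2
    rw [hW _ (by omega)] at hθ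
    obtain ⟨k, hk, hT⟩ := eq_E_of_ne hθ
    obtain ⟨j, hkj, hij⟩ := exists_third hk
    refine isPrefixRuleLeftSide_of (i := W 0) (j := j) (k := k)
      (D' := pow [W 0] (n + 1)) (U' := pow [E (W 0)] n ++ [E k]) (pre_pow_one fun x hx => ?_)
      (pre_split_one rfl (fun x hx => h4 x (by omega)) (pre_one hT)) hij hkj.symm hk n 0 rfl
    rcases Nat.lt_succ_iff_lt_or_eq.mp hx with hx | rfl
    · exact h3 x (by omega)
    · rw [← h.letter _ le_rfl, hW _ (by omega)]
  · obtain ⟨k, hjk, hik⟩ := exists_third hij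
    obtain ⟨h1, h2, h3, h4, h5, h6⟩ := h.alt_head hc (p := len n) (hW.mono (by omega)) hij hjk hik
      le_rfl hpos
    have hn := h.eq_of_len h1 h2
    have hD : AltOn Δ i j (n + 1) := by
      refine ⟨fun x hx hm => ?_, fun x hx hm => ?_⟩ <;>
        rcases Nat.lt_succ_iff_lt_or_eq.mp hx with hx | rfl
      · exact h3.even x (by omega) hm
      · rw [← h.letter _ le_rfl, hW.even _ (by omega) (by omega)]
      · exact h3.odd x (by omega) hm
      · rw [← h.letter _ le_rfl, hW.odd _ (by omega) (by omega)]
    rw [← hn] at hθ hpair h5 h6 hu hW hlen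
    have key : ∀ a b c : Letter, a ≠ b → b ≠ c → a ≠ c → ∀ t : Anti, t.letter a ≠ a → t.letter a ≠ b →
      t = E b := by decide
    rcases Nat.even_or_odd' n with ⟨m, hm | hm⟩
    · rw [hW.even n (by omega) (by omega)] at hθ hpair
      rw [hW.odd (n - 1) (by omega) (by omega)] at hpair
      have hT : T n = E j := key i j k hij hjk hik _ hθ hpair
      obtain ⟨m, rfl⟩ : ∃ q, m = q + 1 := ⟨m - 1, by omega⟩
      refine isPrefixRuleLeftSide_of (D' := [] ++ pow [i, j] (m + 1) ++ [i])
        (U' := [E i, E k] ++ pow [R, E k] m ++ [E j])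
        (pre_split_two (a := 0) (c := 1) (by omega) rfl (fun x hx hx2 => hD.even _ (by omega) (by omega))
          (fun x hx hx2 => hD.odd _ (by omega) (by omega)) (pre_one (hD.even _ (by omega) (by omega))))
        (pre_split_two (a := 2) (c := 1) (by omega) (pre_two h4 (h5 1 (by omega) rfl))
          (fun x hx hx2 => h6 _ (by omega) (by omega) (by omega))
          (fun x hx hx2 => h5 _ (by omega) (by omega)) (pre_one ?_)) hij hjk hik m 2 rfl
      rw [← hT]; congr 1; omega
    · rw [hW.odd n (by omega) (by omega)] at hθ hpair
      rw [hW.even (n - 1) (by omega) (by omega)] at hpair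
      have hT : T n = E i := key j i k hij.symm hik hjk _ hθ hpair
      rcases Nat.eq_zero_or_pos m with rfl | hm0
      -- For `n = 1` the word `w_2` begins with `ijk`, a second missed pseudopalindrome.
      · have h7 : W 2 = k := by
          rw [hpal 2 1 (by omega), hW.odd 1 (by omega) rfl, hT]
          exact (letter_E hjk hik.symm hij.symm).1
        have h8 : PalAt W (E j) 3 := CycleOn.palAt_zero (i := i) (j := j) (k := k) (p := 3)
          ⟨fun x hx hx3 => by rw [show x = 0 by omega, hW.even 0 (by omega) rfl],
            fun x hx hx3 => by rw [show x = 1 by omega, hW.odd 1 (by omega) rfl],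
            fun x hx hx3 => by rw [show x = 2 by omega, h7]⟩ hij hjk hik le_rfl rfl
        have := hu 3 (by omega) (by omega) ⟨_, h8⟩
        omega
      · obtain ⟨m, rfl⟩ : ∃ q, m = q + 1 := ⟨m - 1, by omega⟩
        refine isPrefixRuleLeftSide_of (D' := [i] ++ pow [j, i] (m + 1) ++ [j])
          (U' := [E i] ++ pow [E k, R] (m + 1) ++ [E i])
          (pre_split_two (a := 1) (c := 1) (by omega) (pre_one (hD.even 0 (by omega) rfl))
            (fun x hx hx2 => hD.odd _ (by omega) (by omega))
            (fun x hx hx2 => hD.even _ (by omega) (by omega))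
            (pre_one (hD.odd _ (by omega) (by omega))))
          (pre_split_two (a := 1) (c := 1) (by omega) (pre_one h4)
            (fun x hx hx2 => h5 _ (by omega) (by omega))
            (fun x hx hx2 => h6 _ (by omega) (by omega) (by omega)) (pre_one ?_)) hij hjk hik m 1 rfl
        rw [← hT]; congr 1; omega
  · exfalso
    -- In a cyclic word, every antimorphism has a palindromic suffix of length one, two or three, so
    -- a closure of maximal length is impossible.
    have htri : (T n).letter (W (len n)) ≠ W (len n - 2) ∨
        (T n).letter (W (len n - 1)) ≠ W (len n - 1) := by
      by_contra! hne
      refine hmin (len n - 2) (by omega) fun x y hx hy hxy => ?_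
      obtain ⟨rfl, rfl⟩ | ⟨rfl, rfl⟩ | ⟨rfl, rfl⟩ : x = len n ∧ y = len n - 2 ∨
        x = len n - 2 ∧ y = len n ∨ x = len n - 1 ∧ y = len n - 1 := by omega
      · rw [← hne.1, letter_letter]
      · rw [hne.1]
      · rw [hne.2]
    have key : ∀ a b c : Letter, a ≠ b → b ≠ c → a ≠ c → ∀ t : Anti, t.letter a ≠ a → t.letter a ≠ b →
      ¬ (t.letter a ≠ c ∨ t.letter b ≠ b) := by decide
    obtain hm | hm | hm : len n % 3 = 0 ∨ len n % 3 = 1 ∨ len n % 3 = 2 := by omega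
    · rw [hW.zero _ (by omega) hm] at hθ hpair htri
      rw [hW.two (len n - 1) (by omega) (by omega)] at hpair htri
      rw [hW.one (len n - 2) (by omega) (by omega)] at htri
      exact key i k j hik hjk.symm hij _ hθ hpair htri
    · rw [hW.one _ (by omega) hm] at hθ hpair htri
      rw [hW.zero (len n - 1) (by omega) (by omega)] at hpair htri
      rw [hW.two (len n - 2) (by omega) (by omega)] at htri
      exact key j i k hij.symm hik hjk _ hθ hpair htri
    · rw [hW.two _ (by omega) hm] at hθ hpair htri
      rw [hW.one (len n - 1) (by omega) (by omega)] at hpair htri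
      rw [hW.zero (len n - 2) (by omega) (by omega)] at htri
      exact key k j i hjk.symm hij.symm hik.symm _ hθ hpair htri

end

/-! ### Closures of length 2|w_n| + 1; twisted period two. -/

section

variable {W Δ : ℕ → Letter} {T : ℕ → Anti} {len : ℕ → ℕ} {n : ℕ}
variable {i j k : Letter} {p l : ℕ} {s t : Anti}

/-- The word `w_n` is followed by a letter making a pseudopalindrome, and `w_{n+1}` is one letter
shorter than possible. -/
theorem Generates.pattern_of_fixed (h : Generates W Δ T len n) (hc : Canonical W T len n)
    (h0 : 0 < n) (hlen : len (n + 1) = 2 * len n + 1)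
    (hpp : PseudopalAt W (len n + 1))
    (hu : ∀ l, len n < l → l < len (n + 1) → PseudopalAt W l → l = len n + 1) :
    IsPrefixRuleLeftSide (pre Δ (n + 1)) (pre T (n + 1)) := by
  have hpos : 0 < len n := by have := h.mono h0 (by omega); omega
  obtain ⟨s, hs⟩ := h.pseudopalAt (k := n) (by omega)
  obtain ⟨t, ht⟩ := hpp
  have hmin : ∀ a < len n, ¬ SuffixPal W (T n) a (len n) := fun a ha hS => by
    have := h.min n le_rfl a hS; omega
  have hpal := h.pal n le_rfl
  have hθ : (T n).letter (W (len n)) = W (len n) := (hpal _ _ (by omega)).symm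
  rcases hs.twist_one ht with hW | ⟨i, j, hij, -, hW⟩ | ⟨i, j, k, hij, hjk, hik, h3, hW⟩
  · refine absurd ?_ (hmin 0 hpos)
    rw [hW _ (by omega)] at hθ
    exact (ConstOn.palAt hW hθ le_rfl).suffix rfl
  · obtain ⟨k, hjk, hik⟩ := exists_third hij
    obtain ⟨h1, h2, h3, h4, h5, h6⟩ := h.alt_head hc (p := len n) (hW.mono (by omega)) hij hjk hik
      le_rfl hpos
    have hn := h.eq_of_len h1 h2
    have hD : AltOn Δ i j (n + 1) := by
      refine ⟨fun x hx hm => ?_, fun x hx hm => ?_⟩ <;>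
        rcases Nat.lt_succ_iff_lt_or_eq.mp hx with hx | rfl
      · exact h3.even x (by omega) hm
      · rw [← h.letter _ le_rfl, hW.even _ (by omega) (by omega)]
      · exact h3.odd x (by omega) hm
      · rw [← h.letter _ le_rfl, hW.odd _ (by omega) (by omega)]
    -- An alternating word ends in an `R`-palindrome of length three, which would shorten the
    -- closure.
    have hR : 2 ≤ n → T n ≠ R := by
      intro h2 e
      refine hmin (len n - 2) (by omega) fun x y hx hy hxy => ?_
      rw [e, letter_R]
      obtain hm | hm := Nat.mod_two_eq_zero_or_one x
      · rw [hW.even _ (by omega) hm, hW.even _ (by omega) (by omega)]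
      · rw [hW.odd _ (by omega) hm, hW.odd _ (by omega) (by omega)]
    rw [← hn] at hθ h5 h6 hW
    rcases Nat.even_or_odd' n with ⟨m, hm | hm⟩
    · rw [hW.even n (by omega) (by omega)] at hθ
      have hT : T n = E i := (eq_R_or_E hθ).resolve_left (hR (by omega))
      obtain ⟨m, rfl⟩ : ∃ q, m = q + 1 := ⟨m - 1, by omega⟩
      refine isPrefixRuleLeftSide_of (D' := [i, j] ++ pow [i, j] m ++ [i])
        (U' := [E i, E k] ++ pow [R, E k] m ++ [E i])
        (pre_split_two (a := 2) (c := 1) (by omega)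
          (pre_two (hD.even 0 (by omega) rfl) (hD.odd 1 (by omega) rfl))
          (fun x hx hx2 => hD.even _ (by omega) (by omega))
          (fun x hx hx2 => hD.odd _ (by omega) (by omega)) (pre_one (hD.even _ (by omega) (by omega))))
        (pre_split_two (a := 2) (c := 1) (by omega) (pre_two h4 (h5 1 (by omega) rfl))
          (fun x hx hx2 => h6 _ (by omega) (by omega) (by omega))
          (fun x hx hx2 => h5 _ (by omega) (by omega)) (pre_one ?_)) hij hjk hik m 9 rfl
      rw [← hT]; congr 1; omega
    · rw [hW.odd n (by omega) (by omega)] at hθ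
      rcases Nat.eq_zero_or_pos m with rfl | hm0
      · obtain rfl : n = 1 := by omega
        have hD2 : pre Δ 2 = [i, j] := pre_two (hD.even 0 (by omega) rfl) (hD.odd 1 (by omega) rfl)
        rcases eq_R_or_E hθ with hT | hT
        · exact isPrefixRuleLeftSide_of hD2 (pre_two h4 hT) hij hjk hik 0 7 rfl
        · exact isPrefixRuleLeftSide_of hD2 (pre_two h4 hT) hij hjk hik 0 8 rfl
      · have hT : T n = E j := (eq_R_or_E hθ).resolve_left (hR (by omega))
        obtain ⟨m, rfl⟩ : ∃ q, m = q + 1 := ⟨m - 1, by omega⟩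
        refine isPrefixRuleLeftSide_of (D' := [i] ++ pow [j, i] (m + 1) ++ [j])
          (U' := [E i] ++ pow [E k, R] (m + 1) ++ [E j])
          (pre_split_two (a := 1) (c := 1) (by omega) (pre_one (hD.even 0 (by omega) rfl))
            (fun x hx hx2 => hD.odd _ (by omega) (by omega))
            (fun x hx hx2 => hD.even _ (by omega) (by omega))
            (pre_one (hD.odd _ (by omega) (by omega))))
          (pre_split_two (a := 1) (c := 1) (by omega) (pre_one h4)
            (fun x hx hx2 => h5 _ (by omega) (by omega))
            (fun x hx hx2 => h6 _ (by omega) (by omega) (by omega)) (pre_one ?_)) hij hjk hik m 10 rfl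
        rw [← hT]; congr 1; omega
  · obtain ⟨h1, h2, h3, h4, h5, h6⟩ := h.cycle_head hc (p := len n) (hW.mono (by omega)) hij hjk hik
      le_rfl hpos
    have hn := h.eq_of_len h1 h2
    have hD : CycleOn Δ i j k (n + 1) := by
      refine ⟨fun x hx hm => ?_, fun x hx hm => ?_, fun x hx hm => ?_⟩ <;>
        rcases Nat.lt_succ_iff_lt_or_eq.mp hx with hx | rfl
      · exact h3.zero x (by omega) hm
      · rw [← h.letter _ le_rfl, hW.zero _ (by omega) (by omega)]
      · exact h3.one x (by omega) hm
      · rw [← h.letter _ le_rfl, hW.one _ (by omega) (by omega)]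
      · exact h3.two x (by omega) hm
      · rw [← h.letter _ le_rfl, hW.two _ (by omega) (by omega)]
    rcases eq_R_or_E hθ with hT | hT
    · rw [← hn] at h4 h5 h6 hW
      obtain ⟨m, hm⟩ : ∃ m, n = 3 * m + 2 ∨ n = 3 * m + 3 ∨ n = 3 * m + 4 := ⟨(n - 2) / 3, by omega⟩
      obtain hm | hm | hm := hm
      · refine isPrefixRuleLeftSide_of (D' := pow [i, j, k] m ++ [i, j, k])
          (U' := pow [E i, E k, E j] m ++ [E i, E k, R])
          (pre_split_three (c := 3) (by omega) (fun x hx => hD.zero x (by omega))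
            (fun x hx => hD.one x (by omega)) (fun x hx => hD.two x (by omega))
            (pre_three (hD.zero _ (by omega) (by omega)) (hD.one _ (by omega) (by omega))
              (hD.two _ (by omega) (by omega))))
          (pre_split_three (c := 3) (by omega) (fun x hx => h4 x (by omega))
            (fun x hx => h5 x (by omega)) (fun x hx => h6 x (by omega))
            (pre_three (h4 _ (by omega) (by omega)) (h5 _ (by omega) (by omega)) ?_))
          hij hjk hik m 11 rfl
        rw [← hT]; congr 1; omega
      · refine isPrefixRuleLeftSide_of (D' := pow [i, j, k] (m + 1) ++ [i])
          (U' := pow [E i, E k, E j] (m + 1) ++ [R])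
          (pre_split_three (c := 1) (by omega) (fun x hx => hD.zero x (by omega))
            (fun x hx => hD.one x (by omega)) (fun x hx => hD.two x (by omega))
            (pre_one (hD.zero _ (by omega) (by omega))))
          (pre_split_three (c := 1) (by omega) (fun x hx => h4 x (by omega))
            (fun x hx => h5 x (by omega)) (fun x hx => h6 x (by omega)) (pre_one ?_))
          hij hjk hik m 13 rfl
        rw [← hT]; congr 1; omega
      · refine isPrefixRuleLeftSide_of (D' := pow [i, j, k] (m + 1) ++ [i, j])
          (U' := pow [E i, E k, E j] (m + 1) ++ [E i, R])
          (pre_split_three (c := 2) (by omega) (fun x hx => hD.zero x (by omega))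
            (fun x hx => hD.one x (by omega)) (fun x hx => hD.two x (by omega))
            (pre_two (hD.zero _ (by omega) (by omega)) (hD.one _ (by omega) (by omega))))
          (pre_split_three (c := 2) (by omega) (fun x hx => h4 x (by omega))
            (fun x hx => h5 x (by omega)) (fun x hx => h6 x (by omega))
            (pre_two (h4 _ (by omega) (by omega)) ?_))
          hij hjk hik m 12 rfl
        rw [← hT]; congr 1; omega
    · exfalso
      -- If `T n` is `E` of the last letter, then for `n = 2` the word continues as `ijki`, a second
      -- missed prefix, and for `n ≥ 3` the last four letters form a palindromic suffix.
      rcases Nat.lt_or_ge n 3 with hn3 | hn3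
      · obtain rfl : n = 2 := by omega
        have h7 : W 3 = i := by
          rw [hpal 3 1 (by omega), hW.one 1 (by omega) rfl, hT, hW.two (len 2) (by omega) (by omega)]
          exact (letter_E hij hjk hik).2
        have hW' : CycleOn W i j k 4 := by
          refine ⟨fun x hx hm => ?_, fun x hx hm => hW.one x (by omega) hm,
            fun x hx hm => hW.two x (by omega) hm⟩
          rcases Nat.lt_succ_iff_lt_or_eq.mp hx with hx | rfl
          · exact hW.zero x (by omega) hm
          · exact h7
        have := hu 4 (by omega) (by omega) ⟨_, hW'.palAt_one hij hjk hik le_rfl rfl⟩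
        omega
      · have key : ∀ x y, x + y = 3 → W (len n - 3 + x) =
            (T n).letter (W (len n - 3 + y)) := by
          intro x y hxy
          have e1 := hW.zero
          have e2 := hW.one
          have e3 := hW.two
          obtain ⟨a1, a2⟩ := letter_E hij hjk hik
          obtain ⟨b1, b2⟩ := letter_E hik hjk.symm hij
          obtain ⟨c1, c2⟩ := letter_E hjk hik.symm hij.symm
          obtain hm | hm | hm : len n % 3 = 0 ∨ len n % 3 = 1 ∨ len n % 3 = 2 := by omega
          · rw [e1 _ (by omega) hm] at hT
            obtain hx | hx | hx : x % 3 = 0 ∨ x % 3 = 1 ∨ x % 3 = 2 := by omega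
            · rw [e1 _ (by omega) (by omega), e1 _ (by omega) (by omega), hT, letter_E_self]
            · rw [e2 _ (by omega) (by omega), e3 _ (by omega) (by omega), hT, c2]
            · rw [e3 _ (by omega) (by omega), e2 _ (by omega) (by omega), hT, c1]
          · rw [e2 _ (by omega) hm] at hT
            obtain hx | hx | hx : x % 3 = 0 ∨ x % 3 = 1 ∨ x % 3 = 2 := by omega
            · rw [e2 _ (by omega) (by omega), e2 _ (by omega) (by omega), hT, letter_E_self]
            · rw [e3 _ (by omega) (by omega), e1 _ (by omega) (by omega), hT, b1]
            · rw [e1 _ (by omega) (by omega), e3 _ (by omega) (by omega), hT, b2]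
          · rw [e3 _ (by omega) hm] at hT
            obtain hx | hx | hx : x % 3 = 0 ∨ x % 3 = 1 ∨ x % 3 = 2 := by omega
            · rw [e3 _ (by omega) (by omega), e3 _ (by omega) (by omega), hT, letter_E_self]
            · rw [e1 _ (by omega) (by omega), e2 _ (by omega) (by omega), hT, a2]
            · rw [e2 _ (by omega) (by omega), e1 _ (by omega) (by omega), hT, a1]
        refine hmin (len n - 3) (by omega) fun x y hx hy hxy => ?_
        obtain ⟨x, rfl⟩ := Nat.exists_eq_add_of_le hx
        obtain ⟨y, rfl⟩ := Nat.exists_eq_add_of_le hy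
        exact key x y (by omega)

/-- Words with `W (x + 2) = E f (W x)` whose prefix of length `p - 1` is not a pseudopalindrome. -/
theorem twist_two {f : Letter} (h4 : 4 ≤ p) (hW : ∀ x, x + 2 < p → W (x + 2) = (E f).letter (W x))
    (hp : ¬ PseudopalAt W (p - 1)) :
    (p % 2 = 0 ∧ ∃ i j, i ≠ j ∧ j ≠ f ∧ i ≠ f ∧ (∀ x < p, x % 4 = 0 → W x = i) ∧
        (∀ x < p, x % 4 = 2 → W x = j) ∧
        ((∀ x < p, x % 4 = 1 → W x = i) ∧ (∀ x < p, x % 4 = 3 → W x = j) ∨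
          (∀ x < p, x % 4 = 1 → W x = j) ∧ (∀ x < p, x % 4 = 3 → W x = i))) ∨
      (p % 2 = 1 ∧ ∃ i k, i ≠ f ∧ f ≠ k ∧ i ≠ k ∧ ((∀ x < p, x % 2 = 0 → W x = f) ∧
          (∀ x < p, x % 4 = 1 → W x = i) ∧ (∀ x < p, x % 4 = 3 → W x = k) ∨
        ZigzagOn W i f k p)) := by
  -- The first two letters determine the word, which has period four. Every choice not listed in the
  -- conclusion makes the prefix of length `p - 1` a pseudopalindrome.
  have hval : ∀ x < p, (x % 4 = 0 → W x = W 0) ∧ (x % 4 = 1 → W x = W 1) ∧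
      (x % 4 = 2 → W x = (E f).letter (W 0)) ∧ (x % 4 = 3 → W x = (E f).letter (W 1)) := by
    intro x
    induction x using Nat.strong_induction_on with
    | _ x ih =>
      intro hx
      rcases Nat.lt_or_ge x 2 with h | h
      · obtain rfl | rfl : x = 0 ∨ x = 1 := by omega
        · simp
        · simp
      · obtain ⟨x, rfl⟩ := Nat.exists_eq_add_of_le' h
        obtain ⟨i0, i1, i2, i3⟩ := ih x (by omega) (by omega)
        refine ⟨fun hm => ?_, fun hm => ?_, fun hm => ?_, fun hm => ?_⟩
        · rw [hW x hx, i2 (by omega), letter_letter]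
        · rw [hW x hx, i3 (by omega), letter_letter]
        · rw [hW x hx, i0 (by omega)]
        · rw [hW x hx, i1 (by omega)]
  generalize W 0 = a at hval
  generalize W 1 = b at hval
  have v0 := fun x hx => (hval x hx).1
  have v1 := fun x hx => (hval x hx).2.1
  have v2 := fun x hx => (hval x hx).2.2.1
  have v3 := fun x hx => (hval x hx).2.2.2
  have hpal : ∀ t : Anti, (∀ x y, x + y + 1 = p - 1 → (x % 4 = 0 → W x = t.letter (W y)) ∧
      (x % 4 = 1 → W x = t.letter (W y)) ∧ (x % 4 = 2 → W x = t.letter (W y)) ∧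
      (x % 4 = 3 → W x = t.letter (W y))) → False := by
    intro t ht
    refine hp ⟨t, fun x y hxy => ?_⟩
    obtain ⟨h0, h1, h2, h3⟩ := ht x y hxy
    obtain hm | hm | hm | hm : x % 4 = 0 ∨ x % 4 = 1 ∨ x % 4 = 2 ∨ x % 4 = 3 := by omega
    exacts [h0 hm, h1 hm, h2 hm, h3 hm]
  have key1 : ∀ a f : Letter, a ≠ f → a ≠ (E f).letter a ∧ (E f).letter a ≠ f ∧
      ∀ b, b ≠ f → b = a ∨ b = (E f).letter a := by decide
  obtain hm | hm := Nat.mod_two_eq_zero_or_one p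
  · left
    by_cases haf : a = f
    · exfalso
      subst haf
      rw [letter_E_self] at v2
      obtain h3 | h3 : (p - 1) % 4 = 1 ∨ (p - 1) % 4 = 3 := by omega
      · refine hpal (E a) fun x y hxy => ⟨fun hx => ?_, fun hx => ?_, fun hx => ?_, fun hx => ?_⟩
        · rw [v0 x (by omega) hx, v0 y (by omega) (by omega), letter_E_self]
        · rw [v1 x (by omega) hx, v3 y (by omega) (by omega), letter_letter]
        · rw [v2 x (by omega) hx, v2 y (by omega) (by omega), letter_E_self]
        · rw [v3 x (by omega) hx, v1 y (by omega) (by omega)]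
      · refine hpal R fun x y hxy => ⟨fun hx => ?_, fun hx => ?_, fun hx => ?_, fun hx => ?_⟩
        · rw [v0 x (by omega) hx, v2 y (by omega) (by omega), letter_R]
        · rw [v1 x (by omega) hx, v1 y (by omega) (by omega), letter_R]
        · rw [v2 x (by omega) hx, v0 y (by omega) (by omega), letter_R]
        · rw [v3 x (by omega) hx, v3 y (by omega) (by omega), letter_R]
    by_cases hbf : b = f
    · exfalso
      subst hbf
      rw [letter_E_self] at v3
      obtain h3 | h3 : (p - 1) % 4 = 1 ∨ (p - 1) % 4 = 3 := by omega
      · refine hpal R fun x y hxy => ⟨fun hx => ?_, fun hx => ?_, fun hx => ?_, fun hx => ?_⟩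
        · rw [v0 x (by omega) hx, v0 y (by omega) (by omega), letter_R]
        · rw [v1 x (by omega) hx, v3 y (by omega) (by omega), letter_R]
        · rw [v2 x (by omega) hx, v2 y (by omega) (by omega), letter_R]
        · rw [v3 x (by omega) hx, v1 y (by omega) (by omega), letter_R]
      · refine hpal (E b) fun x y hxy => ⟨fun hx => ?_, fun hx => ?_, fun hx => ?_, fun hx => ?_⟩
        · rw [v0 x (by omega) hx, v2 y (by omega) (by omega), letter_letter]
        · rw [v1 x (by omega) hx, v1 y (by omega) (by omega), letter_E_self]
        · rw [v2 x (by omega) hx, v0 y (by omega) (by omega)]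
        · rw [v3 x (by omega) hx, v3 y (by omega) (by omega), letter_E_self]
    obtain ⟨h1, h2, h3⟩ := key1 a f haf
    refine ⟨hm, a, (E f).letter a, h1, h2, haf, v0, v2, ?_⟩
    rcases h3 b hbf with rfl | rfl
    · exact Or.inl ⟨v1, v3⟩
    · rw [letter_letter] at v3
      exact Or.inr ⟨v1, v3⟩
  · right
    refine ⟨hm, ?_⟩
    by_cases haf : a = f
    · subst haf
      rw [letter_E_self] at v2
      by_cases hbf : b = a
      · exfalso
        subst hbf
        rw [letter_E_self] at v3
        refine hpal R fun x y hxy => ?_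
        have hy : W y = b := by
          obtain h | h | h | h : y % 4 = 0 ∨ y % 4 = 1 ∨ y % 4 = 2 ∨ y % 4 = 3 := by omega
          exacts [v0 y (by omega) h, v1 y (by omega) h, v2 y (by omega) h, v3 y (by omega) h]
        rw [hy, letter_R]
        exact ⟨v0 x (by omega), v1 x (by omega), v2 x (by omega), v3 x (by omega)⟩
      · obtain ⟨h1, h2, -⟩ := key1 b a hbf
        refine ⟨b, (E a).letter b, hbf, h2.symm, h1, Or.inl ⟨fun x hx h2 => ?_, v1, v3⟩⟩
        obtain h | h : x % 4 = 0 ∨ x % 4 = 2 := by omega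
        exacts [v0 x hx h, v2 x hx h]
    · obtain ⟨h1, h2, h3⟩ := key1 a f haf
      by_cases hbf : b = f
      · subst hbf
        rw [letter_E_self] at v3
        refine ⟨a, (E b).letter a, haf, h2.symm, h1, Or.inr ⟨v0, fun x hx h2 => ?_, v2⟩⟩
        obtain h | h : x % 4 = 1 ∨ x % 4 = 3 := by omega
        exacts [v1 x hx h, v3 x hx h]
      · exfalso
        rcases h3 b hbf with rfl | rfl
        · obtain h5 | h5 : (p - 1) % 4 = 0 ∨ (p - 1) % 4 = 2 := by omega
          · refine hpal (E f) fun x y hxy => ⟨fun hx => ?_, fun hx => ?_, fun hx => ?_, fun hx => ?_⟩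
            · rw [v0 x (by omega) hx, v3 y (by omega) (by omega), letter_letter]
            · rw [v1 x (by omega) hx, v2 y (by omega) (by omega), letter_letter]
            · rw [v2 x (by omega) hx, v1 y (by omega) (by omega)]
            · rw [v3 x (by omega) hx, v0 y (by omega) (by omega)]
          · refine hpal R fun x y hxy => ⟨fun hx => ?_, fun hx => ?_, fun hx => ?_, fun hx => ?_⟩
            · rw [v0 x (by omega) hx, v1 y (by omega) (by omega), letter_R]
            · rw [v1 x (by omega) hx, v0 y (by omega) (by omega), letter_R]
            · rw [v2 x (by omega) hx, v3 y (by omega) (by omega), letter_R]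
            · rw [v3 x (by omega) hx, v2 y (by omega) (by omega), letter_R]
        · rw [letter_letter] at v3
          obtain h5 | h5 : (p - 1) % 4 = 0 ∨ (p - 1) % 4 = 2 := by omega
          · refine hpal R fun x y hxy => ⟨fun hx => ?_, fun hx => ?_, fun hx => ?_, fun hx => ?_⟩
            · rw [v0 x (by omega) hx, v3 y (by omega) (by omega), letter_R]
            · rw [v1 x (by omega) hx, v2 y (by omega) (by omega), letter_R]
            · rw [v2 x (by omega) hx, v1 y (by omega) (by omega), letter_R]
            · rw [v3 x (by omega) hx, v0 y (by omega) (by omega), letter_R]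
          · refine hpal (E f) fun x y hxy => ⟨fun hx => ?_, fun hx => ?_, fun hx => ?_, fun hx => ?_⟩
            · rw [v0 x (by omega) hx, v1 y (by omega) (by omega), letter_letter]
            · rw [v1 x (by omega) hx, v0 y (by omega) (by omega)]
            · rw [v2 x (by omega) hx, v3 y (by omega) (by omega)]
            · rw [v3 x (by omega) hx, v2 y (by omega) (by omega), letter_letter]

/-- The word `w_n` is followed by two letters making a pseudopalindrome, and `w_{n+1}` has the
maximal possible length. -/
theorem Generates.pattern_of_two (h : Generates W Δ T len n) (hc : Canonical W T len n)
    (h0 : 0 < n) (hlen : len (n + 1) = 2 * len n + 2) {s t : Anti} (hs : PalAt W s (len n))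
    (ht : PalAt W t (len n + 2))
    (hn : ∀ u : Anti, ∃ a, u.letter a ≠ (T n).letter (t.letter (s.letter a)))
    (hu : ∀ l, len n < l → l < len (n + 1) → PseudopalAt W l → l = len n + 2) :
    IsPrefixRuleLeftSide (pre Δ (n + 1)) (pre T (n + 1)) := by
  have hpos : 0 < len n := by have := h.mono h0 (by omega); omega
  have hmin : ∀ a ≤ len n, ¬ SuffixPal W (T n) a (len n) := fun a ha hS => by
    have := h.min n le_rfl a hS; omega
  have hpal := h.pal n le_rfl
  have hθ : (T n).letter (W (len n)) ≠ W (len n) := fun e => hmin (len n) le_rfl fun x y hx hy hxy => by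
    rw [show x = len n by omega, show y = len n by omega, e]
  have hpair : (T n).letter (W (len n)) ≠ W (len n - 1) := fun e =>
    hmin (len n - 1) (by omega) fun x y hx hy hxy => by
      obtain ⟨rfl, rfl⟩ | ⟨rfl, rfl⟩ : x = len n ∧ y = len n - 1 ∨ x = len n - 1 ∧ y = len n := by
        omega
      · rw [← e, letter_letter]
      · rw [e]
  have hnext : W (len n + 1) = (T n).letter (W (len n)) := hpal _ _ (by omega)
  have h1 : ¬ PseudopalAt W (len n + 1) := fun hp => by
    have := hu _ (by omega) (by omega) hp; omega
  have hge : 2 ≤ len n := by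
    by_contra hlt
    obtain h2 : len n = 1 := by omega
    exact h1 (by rw [h2]; exact pseudopalAt_two)
  -- Parity in S₃: `T n` moves a letter, so it is odd. An even `t ∘ s` would make the triple product
  -- odd, hence a transposition, against `hn`.
  have hf : ∃ f : Letter, ∀ a, t.letter (s.letter a) = (E f).letter a := by
    have key : ∀ r : Anti, (∃ i, r ≠ R ∧ r.letter i ≠ i) → ∀ s t : Anti,
        (∀ u : Anti, ∃ a, u.letter a ≠ r.letter (t.letter (s.letter a))) →
        ∃ f : Letter, ∀ a, t.letter (s.letter a) = (E f).letter a := by decide +kernel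
    exact key (T n) ⟨_, fun e => hθ (by rw [e]; rfl), hθ⟩ s t hn
  obtain ⟨f, hf⟩ := hf
  rcases twist_two (p := len n + 2) (f := f) (by omega)
      (fun x hx => by rw [hs.twist ht rfl x (by omega), hf]) h1 with
    ⟨hm, i, j, hij, hjf, hif, v0, v2, ⟨v1, v3⟩ | ⟨v1, v3⟩⟩ | ⟨hm, i, k, hif, hfk, hik, ⟨v0, v1, v3⟩ | hW⟩
  · exfalso
    obtain h4 | h4 : len n % 4 = 0 ∨ len n % 4 = 2 := by omega
    · rw [v1 _ (by omega) (by omega), v0 _ (by omega) h4] at hnext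
      rw [v0 _ (by omega) h4, ← hnext] at hθ
      exact hθ rfl
    · rw [v3 _ (by omega) (by omega), v2 _ (by omega) h4] at hnext
      rw [v2 _ (by omega) h4, ← hnext] at hθ
      exact hθ rfl
  · exfalso
    -- In the shape `ijji…` only two letters occur, so all three types lie in `{R, E f}`. Their
    -- product is then an antimorphism, against `hn`.
    have htwo : ∀ x < len n + 2, W x = i ∨ W x = j := by
      intro x hx
      obtain h4 | h4 | h4 | h4 : x % 4 = 0 ∨ x % 4 = 1 ∨ x % 4 = 2 ∨ x % 4 = 3 := by omega
      exacts [Or.inl (v0 x hx h4), Or.inr (v1 x hx h4), Or.inr (v2 x hx h4), Or.inl (v3 x hx h4)]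
    have hTf : T n = E f := by
      refine Anti.eq_E (i := W (len n)) (j := W (len n + 1)) ?_ ?_ ?_ hnext.symm
      · rw [hnext]; exact hθ.symm
      · rcases htwo (len n + 1) (by omega) with e | e <;> rw [e] <;> assumption
      · rcases htwo (len n) (by omega) with e | e <;> rw [e] <;> assumption
    have htype : ∀ t, ∀ l ≤ len n + 2, l % 2 = 0 → 0 < l → PalAt W t l → t = R ∨ t = E f := by
      intro t l hl h2 h0 ht
      have key : ∀ i j f : Letter, i ≠ j → j ≠ f → i ≠ f → ∀ t : Anti,
          (t.letter i = i ∨ t.letter i = j) → (t.letter j = i ∨ t.letter j = j) →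
          t = R ∨ t = E f := by decide
      have e1 := ht 0 (l - 1) (by omega)
      have e2 := ht 1 (l - 2) (by omega)
      have d1 := htwo 0 (by omega)
      have d2 := htwo 1 (by omega)
      rw [e1] at d1
      rw [e2] at d2
      obtain h4 | h4 : l % 4 = 0 ∨ l % 4 = 2 := by omega
      · rw [v3 (l - 1) (by omega) (by omega)] at d1
        rw [v2 (l - 2) (by omega) (by omega)] at d2
        exact key i j f hij hjf hif t d1 d2
      · rw [v1 (l - 1) (by omega) (by omega)] at d1
        rw [v0 (l - 2) (by omega) (by omega)] at d2
        exact key i j f hij hjf hif t d2 d1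
    have hs' := htype s _ (by omega) (by omega) (by omega) hs
    have ht' := htype t _ le_rfl (by omega) (by omega) ht
    have key2 : ∀ f : Letter, ∀ s t : Anti, (s = R ∨ s = E f) → (t = R ∨ t = E f) →
        ∃ u : Anti, ∀ a, u.letter a = (E f).letter (t.letter (s.letter a)) := by decide
    obtain ⟨u, hu'⟩ := key2 f s t hs' ht'
    obtain ⟨a, ha⟩ := hn u
    rw [hTf] at ha
    exact ha (hu' a)
  · rw [v0 _ (by omega) (by omega)] at hnext
    rw [v0 (len n - 1) (by omega) (by omega)] at hpair
    exact (hpair hnext.symm).elim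
  · rw [hW.odd (len n) (by omega) (by omega)] at hnext
    obtain ⟨q, hq⟩ : ∃ q, len n = 3 + 2 * q := ⟨(len n - 3) / 2, by omega⟩
    obtain ⟨h2, h3, ⟨hD0, hD1, hD2, hD3⟩, hT0, hT1, hT2, hTR, hTE⟩ := h.zigzag_head hc (q := q)
      (i := i) (j := f) (k := k) ⟨fun x hx => hW.zero x (by omega), fun x hx => hW.odd x (by omega),
        fun x hx => hW.two x (by omega)⟩ hif hfk hik hq.ge
    have hnq := h.eq_of_len h2 (h3.trans hq.symm)
    have hDn : Δ n = f := by rw [← h.letter n le_rfl, hW.odd _ (by omega) (by omega)]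
    have hD4 : ∀ x ≤ q, Δ (3 + x) = f := fun x hx => by
      rcases hx.eq_or_lt with rfl | hx
      · rw [← hnq, hDn]
      · exact hD3 x hx
    rcases Nat.even_or_odd' q with ⟨m, hm | hm⟩
    · rw [hW.zero (len n + 1) (by omega) (by omega)] at hnext
      have hT : T n = E k := Anti.eq_E hif.symm hik hfk hnext.symm
      refine isPrefixRuleLeftSide_of (D' := [i, f, k] ++ pow [f, f] m ++ [f])
        (U' := [E i, E k, E f] ++ pow [R, E f] m ++ [E k])
        (pre_split_two (a := 3) (c := 1) (by omega) (pre_three hD0 hD1 hD2)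
          (fun x hx _ => hD4 x (by omega)) (fun x hx _ => hD4 x (by omega))
          (pre_one (hD4 _ (by omega))))
        (pre_split_two (a := 3) (c := 1) (by omega) (pre_three hT0 hT1 hT2)
          (fun x hx hx2 => hTR x (by omega) hx2) (fun x hx hx2 => hTE x (by omega) hx2)
          (pre_one ?_)) hif hfk hik m 5 rfl
      rw [← hT]; congr 1; omega
    · rw [hW.two (len n + 1) (by omega) (by omega)] at hnext
      have hT : T n = E i := Anti.eq_E hfk hik.symm hif.symm hnext.symm
      refine isPrefixRuleLeftSide_of (D' := [i, f, k, f] ++ pow [f, f] m ++ [f])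
        (U' := [E i, E k, E f, R] ++ pow [E f, R] m ++ [E i])
        (pre_split_two (a := 4) (c := 1) (by omega) (pre_four hD0 hD1 hD2 (hD4 0 (by omega)))
          (fun x hx _ => ?_) (fun x hx _ => ?_) (pre_one ?_))
        (pre_split_two (a := 4) (c := 1) (by omega) (pre_four hT0 hT1 hT2 (hTR 0 (by omega) rfl))
          (fun x hx hx2 => ?_) (fun x hx hx2 => ?_)
          (pre_one ?_)) hif hfk hik m 6 rfl
      · rw [show 4 + x = 3 + (1 + x) by ring, hD4 _ (by omega)]
      · rw [show 4 + x = 3 + (1 + x) by ring, hD4 _ (by omega)]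
      · show Δ (4 + 2 * m + 0) = f
        rw [show 4 + 2 * m + 0 = 3 + (1 + 2 * m) by ring, hD4 _ (by omega)]
      · rw [show 4 + x = 3 + (1 + x) by ring, hTE _ (by omega) (by omega)]
      · rw [show 4 + x = 3 + (1 + x) by ring, hTR _ (by omega) (by omega)]
      · rw [← hT]; congr 1; omega

end

/-! ### Equally spaced pseudopalindromes with a short central prefix, |w_n| odd. -/

section

variable {W Δ : ℕ → Letter} {T : ℕ → Anti} {len : ℕ → ℕ} {q : ℕ}
variable {i j k : Letter} {p l : ℕ} {s t r v : Anti}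

/-- The types of four consecutive pseudopalindromes `w_{n-1}`, `w_n`, the missed one and `w_{n+1}`
in the forms with one missed pseudopalindrome. -/
def ConsecutiveTypes (r s v t : Anti) : Prop :=
  (∃ i, r = R ∧ s = E i ∧ v = R ∧ t = E i) ∨ (∃ i, r = E i ∧ s = R ∧ v = E i ∧ t = R) ∨
    ∃ i j k, i ≠ j ∧ j ≠ k ∧ i ≠ k ∧ r = E j ∧ s = E k ∧ v = E i ∧ t = E j

theorem Anti.letter_E_E (hij : i ≠ j) (hjk : j ≠ k) (hik : i ≠ k) :
    (E j).letter ((E i).letter i) = k ∧ (E j).letter ((E i).letter j) = i ∧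
      (E j).letter ((E i).letter k) = j := by
  revert i j k; decide

theorem CycleOn.not_palAt_R (h : CycleOn W i j k p) (hij : i ≠ j) (hjk : j ≠ k) (hik : i ≠ k)
    (hl : l ≤ p) (h2 : 2 ≤ l) : ¬ PalAt W R l := by
  intro ht
  obtain h3 | h3 | h3 : l % 3 = 0 ∨ l % 3 = 1 ∨ l % 3 = 2 := by omega
  · exact absurd (h.eq_E_zero hij hjk hik hl h3 h2 ht) (by simp)
  · exact absurd (h.eq_E_one hij hjk hik hl h3 h2 ht) (by simp)
  · exact absurd (h.eq_E_two hij hjk hik hl h3 ht) (by simp)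

theorem Generates.index_eq (h : Generates W Δ T len (q + 1)) {m : ℕ} (hm : m ≤ q + 1)
    (h1 : len q = len m) : q = m := h.inj h1 (by omega) (by omega)

/-- If no antimorphism makes `W` a pseudopalindrome at `l + c`, the twist does not combine with the
type of the prefix of length `l`. -/
theorem PalAt.not_exists_of_not_shift {c N : ℕ}
    (hσ : ∀ x < N, W (x + c) = r.letter (s.letter (W x))) (ht : PalAt W t l) (hl : l ≤ N)
    (hc : c ≤ l) (hn : ¬ PseudopalAt W (l + c)) (u : Anti) :
    ¬ ∀ a, u.letter a = r.letter (s.letter (t.letter a)) :=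
  fun hu => hn ⟨u, ht.shift_up hσ hl hu (Or.inl hc)⟩

/-- Types that cannot be shifted by a twist of consecutive types. -/
theorem ConsecutiveTypes.of_not_shift (hf : ConsecutiveTypes r s v t) {u : Anti}
    (hn : ∀ y : Anti, ¬ ∀ a, y.letter a = t.letter (v.letter (u.letter a))) :
    (∃ i j, i ≠ j ∧ u = E j ∧ (r = R ∧ s = E i ∧ v = R ∧ t = E i)) ∨
    (∃ i j, i ≠ j ∧ u = E j ∧ (r = E i ∧ s = R ∧ v = E i ∧ t = R)) ∨
    (u = R ∧ ∃ i j k, i ≠ j ∧ j ≠ k ∧ i ≠ k ∧ r = E j ∧ s = E k ∧ v = E i ∧ t = E j) := by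
  rcases hf with ⟨i, rfl, rfl, rfl, rfl⟩ | ⟨i, rfl, rfl, rfl, rfl⟩ |
    ⟨i, j, k, hij, hjk, hik, rfl, rfl, rfl, rfl⟩
  · left
    rcases u with _ | j
    · exact (hn (E i) fun a => rfl).elim
    · refine ⟨i, j, ?_, rfl, rfl, rfl, rfl, rfl⟩
      rintro rfl
      exact hn R fun a => (letter_letter (E i) a).symm
  · right; left
    rcases u with _ | j
    · exact (hn (E i) fun a => rfl).elim
    · refine ⟨i, j, ?_, rfl, rfl, rfl, rfl, rfl⟩
      rintro rfl
      exact hn R fun a => (letter_letter (E i) a).symm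
  · right; right
    rcases u with _ | u
    · exact ⟨rfl, i, j, k, hij, hjk, hik, rfl, rfl, rfl, rfl⟩
    · exfalso
      have key : ∀ i j u : Letter, ∃ y : Anti,
        ∀ a, y.letter a = (E j).letter ((E i).letter ((E u).letter a)) := by decide
      obtain ⟨y, hy⟩ := key i j u
      exact hn y hy

/-- With `n = q + 1`, this is the case where the prefix of type `r` has length `d` and `w_{n-1}`
length `d + 1`, so that `w_{n-1}` has twisted period one. Shifting `w_{n-1}` by `d + 1` must not
give a second missed prefix; this restricts the types, and each shape that remains is a pattern. -/
theorem Generates.pattern_of_center (h : Generates W Δ T len (q + 1)) (hc : Canonical W T len (q + 1))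
    {d N : ℕ} (hf : ConsecutiveTypes r (T q) v (T (q + 1)))
    (hσ : ∀ x < N, W (x + (d + 1)) = (T (q + 1)).letter (v.letter (W x))) (hN : d + 1 ≤ N)
    (hr : PalAt W r d) (hd : 1 ≤ d) (hq : len q = d + 1) (hL : len (q + 1) = 2 * d + 1)
    (hn : ¬ PseudopalAt W (d + 1 + (d + 1))) (hlen : len (q + 1 + 1) = 2 * len (q + 1) + 1) :
    IsPrefixRuleLeftSide (pre Δ (q + 2)) (pre T (q + 2)) := by
  have hfix : (T (q + 1)).letter (W (2 * d + 1)) = W (2 * d + 1) :=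
    (h.pal (q + 1) le_rfl _ _ (by omega)).symm
  obtain ⟨u, hu⟩ := h.pseudopalAt (k := q) (by omega)
  rw [hq] at hu
  have hns := fun u hu => PalAt.not_exists_of_not_shift (t := u) hσ hu hN le_rfl hn
  have hW1 := hσ 0 (by omega)
  have hW2 := hσ d (by omega)
  rw [show d + (d + 1) = 2 * d + 1 by ring] at hW2
  rw [Nat.zero_add, ← hq, h.letter q (by omega)] at hW1
  have hW3 := h.letter (q + 1) le_rfl
  rw [hL] at hW3
  rw [hW3] at hW2 hfix
  rcases hr.twist_one hu with hW | ⟨x, y, hxy, -, hW⟩ | ⟨x, y, z, hxy, hyz, hxz, h3, hW⟩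
  · exfalso
    -- A constant `w_{n-1}` is a palindrome both for `R` and for `E (W 0)`, and no consecutive types
    -- are compatible with both.
    rcases hf.of_not_shift (hns R (ConstOn.palAt hW rfl le_rfl)) with
      ⟨_, _, _, e, _⟩ | ⟨_, _, _, e, _⟩ | ⟨_, _⟩
    · simp at e
    · simp at e
    · rcases hf.of_not_shift (hns _ (ConstOn.palAt hW (letter_E_self (W 0)) le_rfl)) with
        ⟨_, _, _, _, e, _⟩ | ⟨_, _, _, _, e, _⟩ | ⟨e, _⟩
      · simp_all
      · simp_all
      · simp at e
  · obtain ⟨z, hyz, hxz⟩ := exists_third hxy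
    obtain ⟨h1, h2, h3, h4, h5, h6⟩ := h.alt_head hc hW hxy hyz hxz (by omega) (by omega)
    have hqd := h.index_eq h1 (hq.trans h2.symm)
    rw [hW.even 0 (by omega) rfl] at hW1
    obtain hm | hm := Nat.mod_two_eq_zero_or_one d
    · have hR := hW.palAt_odd le_rfl (by omega)
      rcases hf.of_not_shift (hns R hR) with ⟨_, _, _, e, _⟩ | ⟨_, _, _, e, _⟩ |
        ⟨-, i, j, k, hij, hjk, hik, rfl, hs, rfl, ht⟩
      · simp at e
      · simp at e
      · have hj : j = z := by
          have := hW.eq_E hxy hyz hxz (by omega) hm (by omega) hr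
          simpa using this
        subst hj
        rw [ht] at hfix hW1 hW2
        rw [hW.even d (by omega) hm] at hW2
        have key : ∀ x y z i k : Letter, x ≠ y → y ≠ z → x ≠ z → i ≠ z → z ≠ k → i ≠ k →
          (E z).letter ((E z).letter ((E i).letter x)) = (E z).letter ((E i).letter x) →
          k = x ∧ (E z).letter ((E i).letter x) = z := by decide
        obtain ⟨rfl, e⟩ := key x y j i k hxy hyz hxz hij hjk hik (by rw [← hW2]; exact hfix)
        rw [e] at hW1 hW2
        obtain ⟨m, rfl⟩ : ∃ m, d = 2 * m + 2 := ⟨d / 2 - 1, by omega⟩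
        subst hqd
        exact isPrefixRuleLeftSide_of (D' := [k, y] ++ pow [k, y] m ++ [k, j, j])
          (U' := [E k, E j] ++ pow [R, E j] m ++ [R, E k, E j])
          (pre_split_two (a := 2) (c := 3) (by omega)
            (pre_two (h3.even 0 (by omega) rfl) (h3.odd 1 (by omega) rfl))
            (fun x hx hx2 => h3.even _ (by omega) (by omega))
            (fun x hx hx2 => h3.odd _ (by omega) (by omega))
            (pre_three (h3.even _ (by omega) (by omega)) (Eq.trans (by congr 1; omega) hW1)
              (Eq.trans (by congr 1; omega) hW2)))
          (pre_split_two (a := 2) (c := 3) (by omega) (pre_two h4 (h5 1 (by omega) rfl))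
            (fun x hx hx2 => h6 _ (by omega) (by omega) (by omega))
            (fun x hx hx2 => h5 _ (by omega) (by omega))
            (pre_three (h6 _ (by omega) (by omega) (by omega)) (Eq.trans (by congr 1; omega) hs)
              (Eq.trans (by congr 1; omega) ht)))
          hxy hyz hxz m 18 rfl
    · have hE := hW.palAt_even hxy hyz hxz le_rfl (by omega)
      rw [hW.odd d (by omega) hm] at hW2
      rcases hf.of_not_shift (hns _ hE) with
        ⟨i, j, hij, e, rfl, hs, rfl, ht⟩ | ⟨i, j, hij, e, rfl, hs, rfl, ht⟩ | ⟨e, _⟩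
      · obtain rfl : z = j := by simpa using e
        rw [ht] at hfix hW1 hW2
        have key : ∀ x y z i : Letter, x ≠ y → y ≠ z → x ≠ z → i ≠ z →
          (E i).letter ((E i).letter y) = (E i).letter y →
          i = y ∧ (E i).letter y = y ∧ (E i).letter x = z := by decide
        obtain ⟨rfl, e, e'⟩ := key x y z i hxy hyz hxz hij (by
          have := hW2 ▸ hfix; exact this)
        rw [letter_R] at hW1 hW2
        rw [e'] at hW1
        rw [e] at hW2
        obtain ⟨m, rfl⟩ : ∃ m, d = 2 * m + 1 := ⟨d / 2, by omega⟩
        subst hqd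
        exact isPrefixRuleLeftSide_of (D' := [x] ++ pow [i, x] m ++ [i, z, i])
          (U' := [E x] ++ pow [E z, R] m ++ [E z, E i, E i])
          (pre_split_two (a := 1) (c := 3) (by omega)
            (pre_one (h3.even 0 (by omega) rfl))
            (fun x hx hx2 => h3.odd _ (by omega) (by omega))
            (fun x hx hx2 => h3.even _ (by omega) (by omega))
            (pre_three (h3.odd _ (by omega) (by omega)) (Eq.trans (by congr 1; omega) hW1)
              (Eq.trans (by congr 1; omega) hW2)))
          (pre_split_two (a := 1) (c := 3) (by omega) (pre_one h4)
            (fun x hx hx2 => h5 _ (by omega) (by omega))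
            (fun x hx hx2 => h6 _ (by omega) (by omega) (by omega))
            (pre_three (h5 _ (by omega) (by omega)) (Eq.trans (by congr 1; omega) hs)
              (Eq.trans (by congr 1; omega) ht)))
          hxy hyz hxz m 17 rfl
      · obtain rfl : z = j := by simpa using e
        rw [ht, letter_R] at hW1 hW2
        rcases Nat.lt_or_ge d 2 with hd2 | hd2
        · obtain rfl : d = 1 := by omega
          have e1 := hr 0 0 rfl
          rw [hW.even 0 (by omega) rfl] at e1
          have key : ∀ x y z i : Letter, x ≠ y → y ≠ z → x ≠ z → i ≠ z →
            x = (E i).letter x → i = x ∧ (E i).letter y = z := by decide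
          obtain ⟨rfl, e2⟩ := key x y z i hxy hyz hxz hij e1
          rw [letter_E_self] at hW1
          rw [e2] at hW2
          subst hqd
          exact isPrefixRuleLeftSide_of (pre_four (h3.even 0 (by omega) rfl)
            (h3.odd 1 (by omega) rfl) hW1 hW2) (pre_four h4 (h5 1 (by omega) rfl) hs ht)
            hxy hyz hxz 0 16 rfl
        · have := hW.eq_R hxy (by omega) hm hd2 hr
          simp at this
      · simp at e
  · obtain ⟨h1, h2, h3, h4, h5, h6⟩ := h.cycle_head hc hW hxy hyz hxz (by omega) (by omega)
    have hqd := h.index_eq h1 (hq.trans h2.symm)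
    rw [hW.zero 0 (by omega) rfl] at hW1
    have hcase : ∀ w, PalAt W (E w) (d + 1) → ∃ i, i ≠ w ∧ r = E i ∧ T q = R ∧ v = E i ∧
        T (q + 1) = R := by
      intro w hw
      rcases hf.of_not_shift (hns _ hw) with
        ⟨i, j, hij, e, rfl, hs, rfl, ht⟩ | ⟨i, j, hij, e, rfl, hs, rfl, ht⟩ | ⟨e, _⟩
      · exact absurd hr (hW.not_palAt_R hxy hyz hxz (by omega) (by omega))
      · obtain rfl : w = j := by simpa using e
        exact ⟨i, hij, rfl, hs, rfl, ht⟩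
      · simp at e
    obtain ⟨a1, a2⟩ := letter_E hxy hyz hxz
    obtain ⟨b1, b2⟩ := letter_E hxz hyz.symm hxy
    obtain hm | hm | hm : d % 3 = 0 ∨ d % 3 = 1 ∨ d % 3 = 2 := by omega
    · obtain ⟨i, hi, rfl, hs, rfl, ht⟩ := hcase _ (hW.palAt_one hxy hyz hxz le_rfl (by omega))
      obtain rfl : i = y := by
        have := hW.eq_E_zero hxy hyz hxz (by omega) hm (by omega) hr
        simpa using this
      rw [ht, letter_R, b1] at hW1
      rw [ht, letter_R, hW.zero d (by omega) hm, b1] at hW2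
      obtain ⟨m, rfl⟩ : ∃ m, d = 3 * (m + 1) := ⟨d / 3 - 1, by omega⟩
      subst hqd
      exact isPrefixRuleLeftSide_of (D' := pow [x, i, z] (m + 1) ++ [x, z, z])
        (U' := pow [E x, E z, E i] (m + 1) ++ [E x, R, R])
        (pre_split_three (c := 3) (by omega) (fun x hx => h3.zero x (by omega))
          (fun x hx => h3.one x (by omega)) (fun x hx => h3.two x (by omega))
          (pre_three (h3.zero _ (by omega) (by omega)) hW1 hW2))
        (pre_split_three (c := 3) (by omega) (fun x hx => h4 x (by omega))
          (fun x hx => h5 x (by omega)) (fun x hx => h6 x (by omega))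
          (pre_three (h4 _ (by omega) (by omega)) hs ht))
        hxy hyz hxz m 15 rfl
    · obtain ⟨i, hi, rfl, hs, rfl, ht⟩ := hcase _ (hW.palAt_two hxy hyz hxz le_rfl (by omega))
      obtain rfl : i = x := by
        have := hW.eq_E_one hxy hyz hxz (by omega) hm (by omega) hr
        simpa using this
      rw [ht, letter_R, letter_E_self] at hW1
      rw [ht, letter_R, hW.one d (by omega) hm, (letter_E hyz hxz.symm hxy.symm).1] at hW2
      obtain ⟨m, rfl⟩ : ∃ m, d = 3 * m + 1 := ⟨d / 3, by omega⟩
      subst hqd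
      exact isPrefixRuleLeftSide_of (D' := pow [i, y, z] m ++ [i, y, i, z])
        (U' := pow [E i, E z, E y] m ++ [E i, E z, R, R])
        (pre_split_three (c := 4) (by omega) (fun x hx => h3.zero x (by omega))
          (fun x hx => h3.one x (by omega)) (fun x hx => h3.two x (by omega))
          (pre_four (h3.zero _ (by omega) (by omega)) (h3.one _ (by omega) (by omega)) hW1 hW2))
        (pre_split_three (c := 4) (by omega) (fun x hx => h4 x (by omega))
          (fun x hx => h5 x (by omega)) (fun x hx => h6 x (by omega))
          (pre_four (h4 _ (by omega) (by omega)) (h5 _ (by omega) (by omega)) hs ht))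
        hxy hyz hxz m 16 rfl
    · obtain ⟨i, hi, rfl, hs, rfl, ht⟩ := hcase _ (hW.palAt_zero hxy hyz hxz le_rfl (by omega))
      obtain rfl : i = z := by
        have := hW.eq_E_two hxy hyz hxz (by omega) hm hr
        simpa using this
      rw [ht, letter_R, a1] at hW1
      rw [ht, letter_R, hW.two d (by omega) hm, letter_E_self] at hW2
      obtain ⟨m, rfl⟩ : ∃ m, d = 3 * m + 2 := ⟨d / 3, by omega⟩
      subst hqd
      exact isPrefixRuleLeftSide_of (D' := pow [x, y, i] (m + 1) ++ [y, i])
        (U' := pow [E x, E i, E y] (m + 1) ++ [R, R])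
        (pre_split_three (c := 2) (by omega) (fun x hx => h3.zero x (by omega))
          (fun x hx => h3.one x (by omega)) (fun x hx => h3.two x (by omega))
          (pre_two hW1 hW2))
        (pre_split_three (c := 2) (by omega) (fun x hx => h4 x (by omega))
          (fun x hx => h5 x (by omega)) (fun x hx => h6 x (by omega))
          (pre_two hs ht))
        hxy hyz hxz m 14 rfl

end

/-! ### Equally spaced pseudopalindromes with a short central prefix, |w_n| even. -/

section

variable {W Δ : ℕ → Letter} {T : ℕ → Anti} {len : ℕ → ℕ} {q : ℕ}
variable {i j k : Letter} {p l : ℕ} {s t r v : Anti}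

/-- Used when the closure has maximal length: then the last type moves the new letter, so it is not
`R`. -/
theorem ConsecutiveTypes.of_not_fixed (hf : ConsecutiveTypes r s v t) {a : Letter}
    (ha : t.letter a ≠ a) :
    (∃ i, r = R ∧ s = E i ∧ v = R ∧ t = E i) ∨
      ∃ i j k, i ≠ j ∧ j ≠ k ∧ i ≠ k ∧ r = E j ∧ s = E k ∧ v = E i ∧ t = E j := by
  rcases hf with h | ⟨i, -, -, -, rfl⟩ | h
  · exact Or.inl h
  · exact (ha rfl).elim
  · exact Or.inr h

/-- The prefix of type `r` has length `e` and `w_{n-1}` length `e + 1`, again giving period one. The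
shift `e + 2` exceeds the length of `w_{n-1}` by one, so only the central letter prevents a second
missed prefix. -/
theorem Generates.pattern_of_short (h : Generates W Δ T len (q + 1)) (hc : Canonical W T len (q + 1))
    {e N : ℕ} (hf : ConsecutiveTypes r (T q) v (T (q + 1)))
    (hσ : ∀ x < N, W (x + (e + 2)) = (T (q + 1)).letter (v.letter (W x))) (hN : e + 2 ≤ N)
    (hr : PalAt W r e) (hq : len q = e + 1) (hL : len (q + 1) = 2 * e + 2)
    (hn : ¬ PseudopalAt W (e + 1 + (e + 2))) (hlen : len (q + 1 + 1) = 2 * len (q + 1) + 2) :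
    IsPrefixRuleLeftSide (pre Δ (q + 2)) (pre T (q + 2)) := by
  have hmin : ∀ a ≤ len (q + 1), ¬ SuffixPal W (T (q + 1)) a (len (q + 1)) := fun a ha hS => by
    have := h.min (q + 1) le_rfl a hS; omega
  have hD1 : Δ q = W (e + 1) := by rw [← hq, h.letter q (by omega)]
  have hD2 : Δ (q + 1) = (T (q + 1)).letter (v.letter (W e)) := by
    rw [← hσ e (by omega), ← h.letter (q + 1) le_rfl, hL]; congr 1; omega
  have hfix : (T (q + 1)).letter (Δ (q + 1)) ≠ Δ (q + 1) := fun e' =>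
    hmin _ le_rfl fun x y hx hy hxy => by
      rw [show x = len (q + 1) by omega, show y = len (q + 1) by omega, h.letter _ le_rfl, e']
  have hmid : W (e + 1) = (T q).letter (W e) := h.pal q (by omega) _ _ (by omega)
  have hpair : 1 ≤ e →
      (T (q + 1)).letter (Δ (q + 1)) ≠ (T (q + 1)).letter (v.letter (W (e - 1))) := by
    intro he e'
    rw [← hσ (e - 1) (by omega), ← h.letter _ le_rfl, hL,
      show e - 1 + (e + 2) = 2 * e + 1 by omega] at e'
    refine hmin (2 * e + 1) (by omega) fun x y hx hy hxy => ?_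
    obtain ⟨rfl, rfl⟩ | ⟨rfl, rfl⟩ : x = 2 * e + 2 ∧ y = 2 * e + 1 ∨
      x = 2 * e + 1 ∧ y = 2 * e + 2 := by omega
    · rw [← e', letter_letter]
    · rw [e']
  have hshift : ∀ t u : Anti, PalAt W t (e + 1) →
      (∀ a, u.letter a = (T (q + 1)).letter (v.letter (t.letter a))) →
      u.letter (W (e + 1)) ≠ W (e + 1) := fun t u ht hu e' =>
    hn ⟨u, ht.shift_up hσ (by omega) hu (Or.inr ⟨rfl, e'⟩)⟩
  -- The length `e + 2` lies strictly between those of `w_{n-1}` and `w_n`, where normalization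
  -- allows no pseudopalindrome.
  have hnext : 1 ≤ e → ¬ PseudopalAt W (e + 2) := by
    intro he hp
    obtain ⟨k, hk, hk'⟩ := h.norm (e + 2) (by omega) hp
    have h1 : q < k := by
      by_contra hc
      rcases (not_lt.mp hc).eq_or_lt with rfl | hc
      · omega
      · have := h.mono hc (by omega); omega
    have h2 : k < q + 1 := by
      by_contra hc
      rcases (not_lt.mp hc).eq_or_lt with rfl | hc
      · omega
      · have := h.mono hc (by omega); omega
    omega
  obtain ⟨u, hu⟩ := h.pseudopalAt (k := q) (by omega)
  rw [hq] at hu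
  have htypes := hf.of_not_fixed hfix
  rcases hr.twist_one hu with hW | ⟨x, y, hxy, h2, hW⟩ | ⟨x, y, z, hxy, hyz, hxz, h3, hW⟩
  · obtain ⟨h1, h2, h3, h4⟩ := h.const_head hc hW (by omega)
    have hqe := h.index_eq h1 (hq.trans h2.symm)
    generalize W 0 = x at hW h3 h4
    rw [hW e (by omega)] at hD2 hmid
    have fin : ∀ y z, x ≠ y → y ≠ z → x ≠ z → Δ q = y → Δ (q + 1) = y → T q = E z →
        (T (q + 1) = E z ∨ T (q + 1) = E x) →
        IsPrefixRuleLeftSide (pre Δ (q + 2)) (pre T (q + 2)) := by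
      intro y z hxy hyz hxz d1 d2 t1 t2
      subst hqe
      have hD : pre Δ (e + 1 + 2) = pow [x] (e + 1) ++ [y, y] :=
        pre_split_one rfl (fun x hx => h3 x hx) (pre_two d1 d2)
      rcases t2 with t2 | t2
      · exact isPrefixRuleLeftSide_of hD
          (pre_split_one rfl (fun x hx => h4 x hx) (pre_two t1 t2)) hxy hyz hxz e 19 rfl
      · exact isPrefixRuleLeftSide_of hD
          (pre_split_one rfl (fun x hx => h4 x hx) (pre_two t1 t2)) hxy hyz hxz e 21 rfl
    rcases htypes with ⟨i, rfl, hs, rfl, ht⟩ | ⟨i, j, k, hij, hjk, hik, rfl, hs, rfl, ht⟩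
    · rw [ht] at hD2 hfix
      rw [hD2, letter_R] at hfix
      have key : ∀ x i : Letter, (E i).letter ((E i).letter x) ≠ (E i).letter x →
        x ≠ (E i).letter x ∧ (E i).letter x ≠ i ∧ x ≠ i := by decide
      obtain ⟨k1, k2, k3⟩ := key x i hfix
      exact fin _ i k1 k2 k3 (by rw [hD1, hmid, hs]) hD2 hs (Or.inl ht)
    · obtain ⟨c1, c2, c3⟩ := letter_E_E hij hjk hik
      obtain ⟨a1, a2⟩ := letter_E hij hjk hik
      have key : ∀ i j k x : Letter, i ≠ j → j ≠ k → i ≠ k → x = i ∨ x = j ∨ x = k := by decide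
      rcases key i j k x hij hjk hik with rfl | rfl | rfl
      · exfalso
        rcases Nat.eq_zero_or_pos e with rfl | he
        · refine hshift (E x) (E j) (ConstOn.palAt hW (letter_E_self x) le_rfl) (fun a => ?_) ?_
          · rw [ht, letter_letter]
          · rw [hmid, hs, a1, letter_E_self]
        · have := hr 0 (e - 1) (by omega)
          rw [hW 0 (by omega), hW (e - 1) (by omega)] at this
          have key : ∀ i j : Letter, i ≠ j → i ≠ (E j).letter i := by decide
          exact key x j hij this
      · exact fin i k hij.symm hik hjk (by rw [hD1, hmid, hs, a2]) (by rw [hD2, ht, c2]) hs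
          (Or.inr ht)
      · rw [hD2, ht, c3, letter_E_self] at hfix
        exact (hfix rfl).elim
  · obtain ⟨z, hyz, hxz⟩ := exists_third hxy
    obtain ⟨h1, h2, h3, h4, h5, h6⟩ := h.alt_head hc hW hxy hyz hxz (by omega) (by omega)
    have hqe := h.index_eq h1 (hq.trans h2.symm)
    rcases htypes with ⟨i, rfl, hs, rfl, ht⟩ | ⟨i, j, k, hij, hjk, hik, rfl, hs, rfl, ht⟩
    · obtain hm | hm := Nat.mod_two_eq_zero_or_one e
      · have := hW.eq_E hxy hyz hxz (by omega) hm (by omega) hr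
        simp at this
      rw [hW.odd e (by omega) hm] at hD2 hmid
      rw [ht] at hD2 hfix
      rw [hD2, letter_R] at hfix
      have key : ∀ x y z i : Letter, x ≠ y → y ≠ z → x ≠ z →
        (E i).letter ((E i).letter y) ≠ (E i).letter y → (i = x ∧ (E i).letter y = z) ∨ i = z := by
          decide
      rcases key x y z i hxy hyz hxz hfix with ⟨rfl, e1⟩ | rfl
      · rw [hs, e1] at hmid
        rw [letter_R, e1] at hD2
        rcases Nat.lt_or_ge e 3 with he | he
        · obtain rfl : e = 1 := by omega
          refine (hnext le_rfl ⟨_, CycleOn.palAt_zero (i := i) (j := y) (k := z) (p := 3)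
            ⟨fun x hx hm => ?_, fun x hx hm => ?_, fun x hx hm => ?_⟩ hxy hyz hxz le_rfl rfl⟩).elim
          · exact hW.even _ (by omega) (by omega)
          · exact hW.odd _ (by omega) (by omega)
          · rw [show x = 2 by omega, hmid]
        · obtain ⟨m, rfl⟩ : ∃ m, e = 2 * m + 3 := ⟨e / 2 - 1, by omega⟩
          subst hqe
          exact isPrefixRuleLeftSide_of (D' := [i, y] ++ pow [i, y] (m + 1) ++ [z, z])
            (U' := [E i, E z] ++ pow [R, E z] (m + 1) ++ [E i, E i])
            (pre_split_two (a := 2) (c := 2) (by omega)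
              (pre_two (h3.even 0 (by omega) rfl) (h3.odd 1 (by omega) rfl))
              (fun x hx hx2 => h3.even _ (by omega) (by omega))
              (fun x hx hx2 => h3.odd _ (by omega) (by omega))
              (pre_two (Eq.trans (by congr 1; omega) (hD1.trans hmid))
                (Eq.trans (by congr 1; omega) hD2)))
            (pre_split_two (a := 2) (c := 2) (by omega) (pre_two h4 (h5 1 (by omega) rfl))
              (fun x hx hx2 => h6 _ (by omega) (by omega) (by omega))
              (fun x hx hx2 => h5 _ (by omega) (by omega))
              (pre_two (Eq.trans (by congr 1; omega) hs)
                (Eq.trans (by congr 1; omega) ht)))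
            hxy hyz hxz m 20 rfl
      · exfalso
        refine hshift (E i) R (hW.palAt_even hxy hyz hxz le_rfl (by omega)) (fun a => ?_) rfl
        rw [ht, letter_R, letter_R, letter_letter]
    · obtain ⟨c1, c2, c3⟩ := letter_E_E hij hjk hik
      obtain ⟨a1, a2⟩ := letter_E hij hjk hik
      have key : ∀ i j k x : Letter, i ≠ j → j ≠ k → i ≠ k → x = i ∨ x = j ∨ x = k := by decide
      obtain hm | hm := Nat.mod_two_eq_zero_or_one e
      · obtain rfl : j = z := by
          have := hW.eq_E hxy hyz hxz (by omega) hm (by omega) hr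
          simpa using this
        rw [hW.even e (by omega) hm] at hD2 hmid
        obtain ⟨rfl, rfl⟩ : x = i ∧ y = k := by
          rcases key i j k x hij hjk hik with rfl | rfl | rfl
          · refine ⟨rfl, ?_⟩
            rcases key x j k y hij hjk hik with rfl | rfl | rfl
            exacts [(hxy rfl).elim, (hyz rfl).elim, rfl]
          · exact (hxz rfl).elim
          · rw [hD2, ht, c3, letter_E_self] at hfix
            exact (hfix rfl).elim
        rw [hs, a1] at hmid
        rw [ht, c1] at hD2
        obtain ⟨m, rfl⟩ : ∃ m, e = 2 * m + 2 := ⟨e / 2 - 1, by omega⟩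
        subst hqe
        exact isPrefixRuleLeftSide_of (D' := [x, y] ++ pow [x, y] m ++ [x, j, y])
          (U' := [E x, E j] ++ pow [R, E j] m ++ [R, E y, E j])
          (pre_split_two (a := 2) (c := 3) (by omega)
            (pre_two (h3.even 0 (by omega) rfl) (h3.odd 1 (by omega) rfl))
            (fun x hx hx2 => h3.even _ (by omega) (by omega))
            (fun x hx hx2 => h3.odd _ (by omega) (by omega))
            (pre_three (h3.even _ (by omega) (by omega))
              (Eq.trans (by congr 1; omega) (hD1.trans hmid))
              (Eq.trans (by congr 1; omega) hD2)))
          (pre_split_two (a := 2) (c := 3) (by omega) (pre_two h4 (h5 1 (by omega) rfl))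
            (fun x hx hx2 => h6 _ (by omega) (by omega) (by omega))
            (fun x hx hx2 => h5 _ (by omega) (by omega))
            (pre_three (h6 _ (by omega) (by omega) (by omega))
              (Eq.trans (by congr 1; omega) hs) (Eq.trans (by congr 1; omega) ht)))
          hxy hyz hxz m 22 rfl
      · exfalso
        rcases Nat.lt_or_ge e 3 with he | he
        · obtain rfl : e = 1 := by omega
          have e1 := hr 0 0 rfl
          have hp := hpair le_rfl
          rw [hW.even 0 (by omega) rfl] at e1 hp
          rw [hW.odd 1 (by omega) rfl] at hD2
          rw [hD2] at hfix hp
          rw [ht] at hfix hp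
          have key : ∀ i j k x y : Letter, i ≠ j → j ≠ k → i ≠ k → x ≠ y → x = (E j).letter x →
            (E j).letter ((E j).letter ((E i).letter y)) ≠ (E j).letter ((E i).letter y) →
            (E j).letter ((E j).letter ((E i).letter y)) = (E j).letter ((E i).letter x) := by
              decide +kernel
          exact hp (key i j k x y hij hjk hik hxy e1 hfix)
        · have := hW.eq_R hxy (by omega) hm (by omega) hr
          simp at this
  · exfalso
    rcases htypes with ⟨i, rfl, hs, rfl, ht⟩ | ⟨i, j, k, hij, hjk, hik, rfl, hs, rfl, ht⟩
    · exact hW.not_palAt_R hxy hyz hxz (by omega) (by omega) hr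
    have hp := hpair (by omega)
    rw [hD2] at hfix hp
    rw [ht] at hfix hp hshift
    rw [hs] at hmid
    have key1 : ∀ x y z i j k : Letter, x ≠ y → y ≠ z → x ≠ z → i ≠ j → j ≠ k → i ≠ k → j = y →
        (E j).letter ((E j).letter ((E i).letter x)) ≠ (E j).letter ((E i).letter x) →
        (∀ a, (E j).letter a = (E j).letter ((E i).letter ((E x).letter a))) ∧
          (E j).letter ((E k).letter x) = (E k).letter x := by decide +kernel
    have key2 : ∀ x y z i j k : Letter, x ≠ y → y ≠ z → x ≠ z → i ≠ j → j ≠ k → i ≠ k → j = x →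
        (E j).letter ((E j).letter ((E i).letter y)) ≠ (E j).letter ((E i).letter y) →
        (E j).letter ((E j).letter ((E i).letter y)) = (E j).letter ((E i).letter x) := by
      decide +kernel
    have key3 : ∀ x y z i j k : Letter, x ≠ y → y ≠ z → x ≠ z → i ≠ j → j ≠ k → i ≠ k → j = z →
        ((∀ a, (E i).letter a = (E j).letter ((E i).letter ((E y).letter a))) ∧
          (E i).letter ((E k).letter z) = (E k).letter z) ∨
        (E j).letter ((E j).letter ((E i).letter z)) = (E j).letter ((E i).letter y) := by
      decide +kernel
    obtain hm | hm | hm : e % 3 = 0 ∨ e % 3 = 1 ∨ e % 3 = 2 := by omega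
    · have hj : j = y := by
        have := hW.eq_E_zero hxy hyz hxz (by omega) hm (by omega) hr
        simpa using this
      rw [hW.zero e (by omega) hm] at hfix hmid
      obtain ⟨k1, k2⟩ := key1 x y z i j k hxy hyz hxz hij hjk hik hj hfix
      exact hshift (E x) (E j) (hW.palAt_one hxy hyz hxz le_rfl (by omega)) k1 (by rw [hmid, k2])
    · have hj : j = x := by
        have := hW.eq_E_one hxy hyz hxz (by omega) hm (by omega) hr
        simpa using this
      rw [hW.one e (by omega) hm] at hfix hp
      rw [hW.zero (e - 1) (by omega) (by omega)] at hp
      exact hp (key2 x y z i j k hxy hyz hxz hij hjk hik hj hfix)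
    · have hj : j = z := by
        have := hW.eq_E_two hxy hyz hxz (by omega) hm hr
        simpa using this
      rw [hW.two e (by omega) hm] at hp hmid
      rw [hW.one (e - 1) (by omega) (by omega)] at hp
      rcases key3 x y z i j k hxy hyz hxz hij hjk hik hj with ⟨k1, k2⟩ | k1
      · exact hshift (E y) (E i) (hW.palAt_zero hxy hyz hxz le_rfl (by omega)) k1
          (by rw [hmid, k2])
      · exact hp k1

/-- The prefix of type `r` has length `e` and `w_{n-1}` has length `e + 2`, half of `w_n` and one
more. The resulting period is two, and the surviving words are zigzags. -/
theorem Generates.pattern_of_half (h : Generates W Δ T len (q + 1)) (hc : Canonical W T len (q + 1))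
    {e N : ℕ} (hf : ConsecutiveTypes r (T q) v (T (q + 1)))
    (hσ : ∀ x < N, W (x + (e + 2)) = (T (q + 1)).letter (v.letter (W x))) (hN : e + 2 ≤ N)
    (hr : PalAt W r e) (he : 1 ≤ e) (hq : len q = e + 2) (hL : len (q + 1) = 2 * e + 2)
    (hn : ¬ PseudopalAt W (e + 2 + (e + 2))) (hlen : len (q + 1 + 1) = 2 * len (q + 1) + 2) :
    IsPrefixRuleLeftSide (pre Δ (q + 2)) (pre T (q + 2)) := by
  have hmin : ∀ a ≤ len (q + 1), ¬ SuffixPal W (T (q + 1)) a (len (q + 1)) := fun a ha hS => by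
    have := h.min (q + 1) le_rfl a hS; omega
  have hD1 : Δ q = (T (q + 1)).letter (v.letter (W 0)) := by
    rw [← hσ 0 (by omega), ← h.letter q (by omega), hq]; congr 1; omega
  have hD2 : Δ (q + 1) = (T (q + 1)).letter (v.letter (W e)) := by
    rw [← hσ e (by omega), ← h.letter (q + 1) le_rfl, hL]; congr 1; omega
  have hfix : (T (q + 1)).letter (Δ (q + 1)) ≠ Δ (q + 1) := fun e' =>
    hmin _ le_rfl fun x y hx hy hxy => by
      rw [show x = len (q + 1) by omega, show y = len (q + 1) by omega, h.letter _ le_rfl, e']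
  have hmid : W (e + 1) = (T q).letter (W e) := h.pal q (by omega) _ _ (by omega)
  have hpair : (T (q + 1)).letter (Δ (q + 1)) ≠ (T (q + 1)).letter (v.letter (W (e - 1))) := by
    intro e'
    rw [← hσ (e - 1) (by omega), ← h.letter _ le_rfl, hL,
      show e - 1 + (e + 2) = 2 * e + 1 by omega] at e'
    refine hmin (2 * e + 1) (by omega) fun x y hx hy hxy => ?_
    obtain ⟨rfl, rfl⟩ | ⟨rfl, rfl⟩ : x = 2 * e + 2 ∧ y = 2 * e + 1 ∨
      x = 2 * e + 1 ∧ y = 2 * e + 2 := by omega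
    · rw [← e', letter_letter]
    · rw [e']
  obtain ⟨u, hu⟩ := h.pseudopalAt (k := q) (by omega)
  rw [hq] at hu
  have hns := fun u hu => PalAt.not_exists_of_not_shift (t := u) hσ hu hN le_rfl hn
  have htypes : ∀ u, PalAt W u (e + 2) →
      (∃ i w, i ≠ w ∧ u = E w ∧ r = R ∧ T q = E i ∧ v = R ∧ T (q + 1) = E i) ∨
      (u = R ∧ ∃ i j k, i ≠ j ∧ j ≠ k ∧ i ≠ k ∧ r = E j ∧ T q = E k ∧ v = E i ∧
        T (q + 1) = E j) := by
    intro u hu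
    rcases hf.of_not_shift (hns u hu) with h1 | ⟨_, _, -, -, -, -, -, h1⟩ | h1
    · exact Or.inl h1
    · rw [h1] at hfix; exact (hfix rfl).elim
    · exact Or.inr h1
  -- Shared by the genuine zigzags and by the cyclic word of length three, which is a zigzag with `e
  -- = 1`.
  have zigzag : ∀ x y z, x ≠ y → y ≠ z → x ≠ z → ZigzagOn W x y z (e + 2) → e % 4 = 1 →
      T q = E x → v = R → T (q + 1) = E x →
      IsPrefixRuleLeftSide (pre Δ (q + 2)) (pre T (q + 2)) := by
    intro x y z hxy hyz hxz hW hm hs hv ht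
    obtain ⟨m, rfl⟩ : ∃ m, e = 4 * m + 1 := ⟨e / 4, by omega⟩
    obtain ⟨h1, h2, ⟨d0, d1, d2, d3⟩, t0, t1, t2, t3, t4⟩ := h.zigzag_head hc (q := 2 * m)
      (i := x) (j := y) (k := z) ⟨fun x hx => hW.zero x (by omega), fun x hx => hW.odd x (by omega),
        fun x hx => hW.two x (by omega)⟩ hxy hyz hxz (by omega)
    have hqe := h.index_eq h1 (by omega)
    rw [hv, ht, letter_R, hW.zero 0 (by omega) rfl, letter_E_self] at hD1
    rw [hv, ht, letter_R, hW.odd _ (by omega) (by omega),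
      (letter_E hyz hxz.symm hxy.symm).1] at hD2
    subst hqe
    exact isPrefixRuleLeftSide_of (D' := [x, y, z] ++ pow [y, y] m ++ [x, z])
      (U' := [E x, E z, E y] ++ pow [R, E y] m ++ [E x, E x])
      (pre_split_two (a := 3) (c := 2) (by omega) (pre_three d0 d1 d2)
        (fun x hx _ => d3 x (by omega)) (fun x hx _ => d3 x (by omega))
        (pre_two hD1 hD2))
      (pre_split_two (a := 3) (c := 2) (by omega) (pre_three t0 t1 t2)
        (fun x hx hx2 => t3 x (by omega) hx2) (fun x hx hx2 => t4 x (by omega) hx2)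
        (pre_two hs ht)) hxy hyz hxz m 23 rfl
  -- A pseudopalindrome of length `e + 1` reduces the period to one; otherwise `twist_two`
  -- classifies the words of period two.
  by_cases hp1 : PseudopalAt W (e + 1)
  · obtain ⟨u', hu'⟩ := hp1
    rcases hu'.twist_one hu with hW | ⟨x, y, hxy, -, hW⟩ | ⟨x, y, z, hxy, hyz, hxz, h3, hW⟩
    · exfalso
      rcases htypes R (ConstOn.palAt hW rfl le_rfl) with ⟨_, _, _, e, _⟩ | ⟨-, _, _, _, _, _, _, h4, _⟩
      · simp at e
      rcases htypes _ (ConstOn.palAt hW (letter_E_self (W 0)) le_rfl) with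
        ⟨_, _, _, _, h5, _⟩ | ⟨e, _⟩
      · simp [h4] at h5
      · simp at e
    · exfalso
      obtain ⟨z, hyz, hxz⟩ := exists_third hxy
      obtain hm | hm := Nat.mod_two_eq_zero_or_one e
      · rcases htypes _ (hW.palAt_even hxy hyz hxz le_rfl (by omega)) with
          ⟨_, _, _, _, rfl, _⟩ | ⟨e, _⟩
        · have := hW.eq_E hxy hyz hxz (by omega) hm (by omega) hr
          simp at this
        · simp at e
      · rcases htypes R (hW.palAt_odd le_rfl (by omega)) with
          ⟨_, _, _, e, _⟩ | ⟨-, i, j, k, hij, hjk, hik, rfl, hs, rfl, ht⟩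
        · simp at e
        rcases Nat.lt_or_ge e 3 with he | he
        · obtain rfl : e = 1 := by omega
          have e1 := hr 0 0 rfl
          rw [hD2, hW.odd 1 (by omega) rfl, hW.even (1 - 1) (by omega) rfl, ht] at hpair
          rw [hW.even 0 (by omega) rfl] at e1
          rw [hW.even (1 + 1) (by omega) rfl, hW.odd 1 (by omega) rfl, hs] at hmid
          have key : ∀ i j k x y : Letter, i ≠ j → j ≠ k → i ≠ k → x ≠ y → x = (E j).letter x →
            x = (E k).letter y →
            (E j).letter ((E j).letter ((E i).letter y)) = (E j).letter ((E i).letter x) := by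
              decide +kernel
          exact hpair (key i j k x y hij hjk hik hxy e1 hmid)
        · have := hW.eq_R hxy (by omega) hm (by omega) hr
          simp at this
    · have hcase : ∀ w, PalAt W (E w) (e + 2) → ∃ i, i ≠ w ∧ r = R ∧ T q = E i ∧ v = R ∧
          T (q + 1) = E i := by
        intro w hw
        rcases htypes _ hw with ⟨i, w', hiw, e1, h4⟩ | ⟨e1, _⟩
        · obtain rfl : w = w' := by simpa using e1
          exact ⟨i, hiw, h4⟩
        · simp at e1
      have he1 : e = 1 := by
        by_contra hne
        have hR : r = R := by
          obtain hm | hm | hm : (e + 2) % 3 = 0 ∨ (e + 2) % 3 = 1 ∨ (e + 2) % 3 = 2 := by omega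
          · obtain ⟨_, _, hR, _⟩ := hcase _ (hW.palAt_zero hxy hyz hxz le_rfl hm)
            exact hR
          · obtain ⟨_, _, hR, _⟩ := hcase _ (hW.palAt_one hxy hyz hxz le_rfl hm)
            exact hR
          · obtain ⟨_, _, hR, _⟩ := hcase _ (hW.palAt_two hxy hyz hxz le_rfl hm)
            exact hR
        subst hR
        exact hW.not_palAt_R hxy hyz hxz (by omega) (by omega) hr
      subst he1
      obtain ⟨i, hiy, -, hs, hv, ht⟩ := hcase _ (hW.palAt_zero hxy hyz hxz le_rfl rfl)
      rw [hW.two (1 + 1) (by omega) rfl, hW.one 1 (by omega) rfl, hs] at hmid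
      have key : ∀ x y z i : Letter, x ≠ y → y ≠ z → x ≠ z → z = (E i).letter y → i = x := by
        decide
      obtain rfl := key x y z i hxy hyz hxz hmid
      exact zigzag i y z hxy hyz hxz ⟨fun x hx hm => hW.zero x hx (by omega),
        fun x hx hm => hW.one x hx (by omega), fun x hx hm => hW.two x hx (by omega)⟩ rfl hs hv ht
  · have he2 : 2 ≤ e := by
      by_contra hlt
      obtain rfl : e = 1 := by omega
      exact hp1 pseudopalAt_two
    rcases htypes u hu with ⟨i, f, hif, rfl, rfl, hs, rfl, ht⟩ |
      ⟨rfl, i, j, k, hij, hjk, hik, rfl, hs, rfl, ht⟩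
    · rw [hs] at hmid
      rw [hD2, letter_R, ht] at hfix hpair
      rw [letter_letter] at hfix hpair
      rcases twist_two (p := e + 2) (f := f) (by omega)
        (fun x hx => by rw [hr.twist hu rfl x (by omega), letter_R]) hp1 with
        ⟨hm, x, y, hxy, hyf, hxf, v0, v2, h13⟩ | ⟨hm, x, z, hxf, hfz, hxz, ⟨v0, v1, v3⟩ | hW⟩
      · exfalso
        have key : ∀ i f x y : Letter, i ≠ f → x ≠ y → y ≠ f → x ≠ f → ∀ a b : Letter,
          b = (E i).letter a → a ≠ (E i).letter a → (a = x ∨ a = y) → (b = x ∨ b = y) → False := by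
            decide +kernel
        refine key i f x y hif hxy hyf hxf _ _ hmid hfix ?_ ?_
        · obtain h4 | h4 : e % 4 = 0 ∨ e % 4 = 2 := by omega
          exacts [Or.inl (v0 _ (by omega) h4), Or.inr (v2 _ (by omega) h4)]
        · rcases h13 with ⟨v1, v3⟩ | ⟨v1, v3⟩ <;>
            obtain h4 | h4 : (e + 1) % 4 = 1 ∨ (e + 1) % 4 = 3 := by omega
          exacts [Or.inl (v1 _ (by omega) h4), Or.inr (v3 _ (by omega) h4),
            Or.inr (v1 _ (by omega) h4), Or.inl (v3 _ (by omega) h4)]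
      · exfalso
        rw [v0 (e + 1) (by omega) (by omega)] at hmid
        rw [v0 (e - 1) (by omega) (by omega), letter_R, hmid, letter_letter] at hpair
        exact hpair rfl
      · have hne : W 0 ≠ W 1 := by rwa [hW.zero 0 (by omega) rfl, hW.odd 1 (by omega) rfl]
        obtain h4 | h4 : e % 4 = 3 ∨ e % 4 = 1 := by omega
        · have := hu.eq_of_ne (hW.palAt_one le_rfl (by omega)) (by omega) (by omega) hne
          simp at this
        · rw [hW.two (e + 1) (by omega) (by omega), hW.odd e (by omega) (by omega)] at hmid
          have key : ∀ x y z i : Letter, x ≠ y → y ≠ z → x ≠ z → z = (E i).letter y → i = x := by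
            decide
          obtain rfl := key x f z i hxf hfz hxz hmid
          exact zigzag i f z hxf hfz hxz hW h4 hs rfl ht
    · rw [hs] at hmid
      obtain ⟨c1, c2, c3⟩ := letter_E_E hij hjk hik
      obtain ⟨a1, a2⟩ := letter_E hij hjk hik
      have cover : ∀ i j k x : Letter, i ≠ j → j ≠ k → i ≠ k → x = i ∨ x = j ∨ x = k := by decide
      rw [hD2, ht] at hfix hpair
      rw [ht] at hD1 hD2
      rcases twist_two (p := e + 2) (f := j) (by omega)
        (fun x hx => by rw [hr.twist hu rfl x (by omega), letter_R]) hp1 with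
        ⟨hm, x, y, hxy, hyf, hxf, v0, v2, h13⟩ | ⟨hm, x, z, hxf, hfz, hxz, ⟨v0, v1, v3⟩ | hW⟩
      · exfalso
        have hA : W e ≠ j := by
          obtain h4 | h4 : e % 4 = 0 ∨ e % 4 = 2 := by omega
          · rwa [v0 _ (by omega) h4]
          · rwa [v2 _ (by omega) h4]
        have hB : W (e + 1) ≠ j := by
          rcases h13 with ⟨v1, v3⟩ | ⟨v1, v3⟩ <;>
            obtain h4 | h4 : (e + 1) % 4 = 1 ∨ (e + 1) % 4 = 3 := by omega
          · rwa [v1 _ (by omega) h4]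
          · rwa [v3 _ (by omega) h4]
          · rwa [v1 _ (by omega) h4]
          · rwa [v3 _ (by omega) h4]
        rcases cover i j k (W e) hij hjk hik with h5 | h5 | h5
        · rw [hmid, h5, a1] at hB; exact hB rfl
        · exact hA h5
        · rw [h5, c3, letter_E_self] at hfix; exact hfix rfl
      · exfalso
        rw [v0 (e + 1) (by omega) (by omega)] at hmid
        have hA : W e = i := by rw [← a2, hmid, letter_letter]
        rw [v0 (e - 1) (by omega) (by omega), hA, c1, c2] at hpair
        exact hpair (letter_E hik.symm hij hjk.symm).1
      · have hne : W 0 ≠ W 1 := by rwa [hW.zero 0 (by omega) rfl, hW.odd 1 (by omega) rfl]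
        obtain h4 | h4 : e % 4 = 3 ∨ e % 4 = 1 := by omega
        · rw [hW.zero (e + 1) (by omega) (by omega), hW.odd e (by omega) (by omega), a2] at hmid
          subst hmid
          obtain rfl : z = k := by
            rcases cover x j k z hij hjk hik with h5 | h5 | h5
            exacts [(hxz h5.symm).elim, (hfz h5.symm).elim, h5]
          rw [hW.zero 0 (by omega) rfl, c1] at hD1
          rw [hW.odd e (by omega) (by omega), c2] at hD2
          obtain ⟨m, rfl⟩ : ∃ m, e = 4 * m + 3 := ⟨e / 4, by omega⟩
          obtain ⟨h1, h2, ⟨d0, d1, d2, d3⟩, t0, t1, t2, t3, t4⟩ := h.zigzag_head hc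
            (q := 2 * m + 1) (i := x) (j := j) (k := z) ⟨fun x hx => hW.zero x (by omega),
              fun x hx => hW.odd x (by omega), fun x hx => hW.two x (by omega)⟩ hxf hfz hxz
            (by omega)
          have hqe := h.index_eq h1 (by omega)
          subst hqe
          exact isPrefixRuleLeftSide_of (D' := [x, j, z] ++ pow [j, j] m ++ [j, z, x])
            (U' := [E x, E z, E j] ++ pow [R, E j] m ++ [R, E z, E j])
            (pre_split_two (a := 3) (c := 3) (by omega) (pre_three d0 d1 d2)
              (fun x hx _ => d3 x (by omega)) (fun x hx _ => d3 x (by omega))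
              (pre_three (d3 _ (by omega)) hD1 hD2))
            (pre_split_two (a := 3) (c := 3) (by omega) (pre_three t0 t1 t2)
              (fun x hx hx2 => t3 x (by omega) hx2) (fun x hx hx2 => t4 x (by omega) hx2)
              (pre_three (t3 _ (by omega) (by omega)) hs ht)) hxf hfz hxz m 24 rfl
        · have := hu.eq_of_ne (hW.palAt_three hxf hfz hxz le_rfl (by omega)) (by omega) (by omega)
            hne
          simp at this

end

/-! ### From one missed prefix to a pattern or a form. -/

section

variable {W Δ : ℕ → Letter} {T : ℕ → Anti} {len : ℕ → ℕ} {n : ℕ}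
variable {i j k : Letter} {r s v t : Anti}

-- The maps `t ∘ v` and `v ∘ s` both describe translation by the common distance. If they are equal,
-- the types are consecutive; if not, a finite check shows that they agree on at most one letter,
-- fixed by `t` and `v`, so the word is constant.
set_option synthInstance.maxSize 2000 in
set_option synthInstance.maxHeartbeats 200000 in
theorem consecutiveTypes_or_const (hr : ∀ a, r.letter a = s.letter (v.letter (s.letter a)))
    (hu : ∃ u : Anti, ∀ a, u.letter a = t.letter (v.letter (s.letter a))) (hvt : v ≠ t) :
    ConsecutiveTypes r s v t ∨ ∀ a b, t.letter (v.letter a) = v.letter (s.letter a) →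
      t.letter (v.letter b) = v.letter (s.letter b) → b = a ∧ t.letter a = a ∧ v.letter a = a := by
  have key : ∀ s v t : Anti, (∃ u : Anti, ∀ a, u.letter a = t.letter (v.letter (s.letter a))) →
      v ≠ t → ∀ r : Anti, (∀ a, r.letter a = s.letter (v.letter (s.letter a))) →
      ((∃ i, r = R ∧ s = E i ∧ v = R ∧ t = E i) ∨ (∃ i, r = E i ∧ s = R ∧ v = E i ∧ t = R) ∨
        ∃ i j k, i ≠ j ∧ j ≠ k ∧ i ≠ k ∧ r = E j ∧ s = E k ∧ v = E i ∧ t = E j) ∨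
      ∀ a b, t.letter (v.letter a) = v.letter (s.letter a) →
        t.letter (v.letter b) = v.letter (s.letter b) → b = a ∧ t.letter a = a ∧ v.letter a = a := by
    decide +kernel
  exact key s v t hu hvt r hr

theorem Generates.pattern_of_zero (h : Generates W Δ T len 0) (hlen : len 1 = 2) :
    IsPrefixRuleLeftSide (pre Δ 1) (pre T 1) := by
  have hpal := h.pal 0 le_rfl
  have hW := h.letter 0 le_rfl
  rw [h.zero] at hW
  have hT : (T 0).letter (Δ 0) ≠ Δ 0 := by
    intro e
    have := h.min 0 le_rfl 0 fun x y hx hy hxy => by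
      rw [h.zero] at hxy
      rw [show x = 0 by omega, show y = 0 by omega, hW, e]
    rw [h.zero, Nat.zero_add, hlen] at this
    omega
  obtain ⟨k, hk, hT⟩ := eq_E_of_ne hT
  obtain ⟨j, hkj, hij⟩ := exists_third hk
  exact isPrefixRuleLeftSide_of (D' := [Δ 0]) (U' := [E k]) rfl (pre_one hT) hij hkj.symm hk 0 0 rfl

/-- The missed prefix and its neighbours are forced into an arithmetic progression of lengths; each
obstruction to this, or to `w_{n-1}` being the preceding term, leads to a pattern. -/
theorem Generates.pattern_or_form (h : Generates W Δ T len n) (hc : Canonical W T len n) {L : ℕ}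
    (h1 : len n < L) (h2 : L < len (n + 1)) (hp : PseudopalAt W L)
    (hu : ∀ l, len n < l → l < len (n + 1) → PseudopalAt W l → l = L) :
    IsPrefixRuleLeftSide (pre Δ (n + 1)) (pre T (n + 1)) ∨
      ∃ m r v, n = m + 2 ∧ PalAt W r (len (m + 1)) ∧
        ConsecutiveTypes r (T (m + 1)) v (T (m + 2)) ∧
        (T (m + 1)).letter (v.letter (Δ (m + 2))) = Δ (m + 1) := by
  have hbound : len (n + 1) ≤ 2 * len n + 2 := by
    have := h.min n le_rfl (len n + 1) fun x y _ _ _ => by omega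
    omega
  rcases n with _ | q
  · rw [h.zero] at h1 hbound
    exact Or.inl (h.pattern_of_zero (show len (0 + 1) = 2 by omega))
  obtain ⟨c', hc'⟩ := Nat.exists_eq_add_of_lt h1
  obtain ⟨c, hcL⟩ := Nat.exists_eq_add_of_lt h2
  replace hc' : L = len (q + 1) + (c' + 1) := by omega
  replace hcL : len (q + 1 + 1) = L + (c + 1) := by omega
  generalize c + 1 = c at hcL
  generalize c' + 1 = c' at hc'
  have hpos : 0 < len (q + 1) := by have := h.lt q (by omega); omega
  obtain ⟨v, hv⟩ := hp
  have hpt := h.pal (q + 1) le_rfl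
  have hps := h.pal q (by omega)
  -- A missed prefix of type `T (q + 1)` would contradict the minimality of the closure.
  have hvt' : ¬ PalAt W (T (q + 1)) L := fun e => by
    have := h.min (q + 1) le_rfl _ (e.suffix (a := c' - 1) (by omega))
    omega
  have hvt : v ≠ T (q + 1) := by rintro rfl; exact hvt' hv
  have hσ := hv.twist hpt hcL.symm
  have hτ := hps.twist hv hc'.symm
  rcases Nat.lt_or_ge (len (q + 1)) c with hclt | hcle
  · left
    exact h.pattern_of_long hc (by omega) (by omega)
      (by rw [show len (q + 1) + 1 = L by omega]; exact ⟨v, hv⟩)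
      fun l hl hl' hpl => by have := hu l hl hl' hpl; omega
  rcases Anti.exists_or_cycle (T (q + 1)) v (T q) with ⟨u, hinv⟩ | hcyc
  swap
  · left
    -- A 3-cycle forces `len n ≤ c`, hence equality, and the length bound leaves one or two letters
    -- between `w_n` and the missed prefix.
    have h4 := hps.le_of_cycle hσ (by omega) hcyc
    obtain h5 | h5 : c' = 1 ∨ c' = 2 := by omega
    · exact h.pattern_of_fixed hc (by omega) (by omega)
        (by rw [show len (q + 1) + 1 = L by omega]; exact ⟨v, hv⟩)
        fun l hl hl' hpl => by have := hu l hl hl' hpl; omega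
    · refine h.pattern_of_two hc (by omega) (by omega) hps (t := v) ?_ (fun u => ?_)
        fun l hl hl' hpl => by have := hu l hl hl' hpl; omega
      · rwa [show len (q + 1) + 2 = L by omega]
      · by_contra! hne
        exact hcyc 0 (by rw [← hne, ← hne, letter_letter])
  -- Uniqueness: the shifted copy of `w_n` is itself a missed prefix.
  have hcc : len (q + 1) + c = L :=
    hu _ (by omega) (by omega) ⟨u, hps.shift_up hσ (by omega) hinv (Or.inl hcle)⟩
  obtain rfl : c = c' := by omega
  obtain ⟨r, hr⟩ := Anti.exists_conj (T q) v
  have hrp : PalAt W r (len (q + 1) - c) := by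
    intro x y hxy
    rw [hps x (y + c) (by omega), hτ y (by omega), hr]
  rcases consecutiveTypes_or_const hr ⟨u, hinv⟩ hvt with hf | hconst
  swap
  -- The two twists would agree on a single letter only, so the missed prefix would be constant and
  -- also of type `T (q + 1)`.
  · exfalso
    obtain ⟨-, e1, e2⟩ := hconst (W 0) (W 0) (by rw [← hσ 0 (by omega), ← hτ 0 (by omega)])
      (by rw [← hσ 0 (by omega), ← hτ 0 (by omega)])
    have e3 : ∀ x < len (q + 1), W x = W 0 := fun x hx =>
      (hconst (W 0) (W x) (by rw [← hσ 0 (by omega), ← hτ 0 (by omega)])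
        (by rw [← hσ x (by omega), ← hτ x (by omega)])).1
    refine hvt' (ConstOn.palAt (i := W 0) (p := L) (fun x hx => ?_) e1 le_rfl)
    rcases Nat.lt_or_ge x (len (q + 1)) with hx' | hx'
    · exact e3 x hx'
    · obtain ⟨x, rfl⟩ := Nat.exists_eq_add_of_le' (hcle.trans hx')
      rw [hσ x (by omega), e3 x (by omega), e2, e1]
  by_cases hno : ∀ l, len (q + 1) - c < l → l < len (q + 1) → ¬ PseudopalAt W l
  · obtain ⟨k, hk, hk'⟩ := h.norm (len (q + 1) - c) (by omega) ⟨r, hrp⟩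
    obtain ⟨h5, h6⟩ := h.next (k := k) (b := len (q + 1)) hk (by omega) le_rfl
      (h.pseudopalAt (by omega)) (fun l hl hl' => hno l (by omega) hl')
    obtain rfl : k = q := by have := h.inj h6 (by omega) (by omega); omega
    rcases k with _ | m
    · left
      rw [h.zero] at hk'
      have h7 : len (0 + 1) = 1 := by
        by_contra hne
        exact hno 1 (by omega) (by omega) pseudopalAt_one
      exact h.pattern_of_fixed hc (by omega) (by omega)
        (by rw [show len (0 + 1) + 1 = L by omega]; exact ⟨v, hv⟩)
        fun l hl hl' hpl => by have := hu l hl hl' hpl; omega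
    · right
      refine ⟨m, r, v, rfl, by rwa [hk'], hf, ?_⟩
      rw [← h.letter (m + 1 + 1) le_rfl, ← h.letter (m + 1) (by omega), hk',
        hv _ (c - 1) (by omega), letter_letter, hps (c - 1) (len (m + 1 + 1) - c) (by omega),
        letter_letter]
  · left
    push Not at hno
    obtain ⟨l, hl, hl', hpl⟩ := hno
    -- An intermediate prefix longer than `c` would shift up to a second missed prefix, beyond
    -- length `L`.
    have hle : ∀ l, l < len (q + 1) → len (q + 1) - c < l → PseudopalAt W l → l ≤ c := by
      intro l hl hl' hpl
      by_contra! hlt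
      have := hu _ (by omega) (by omega) (hpl.shift_up hσ (by omega) hlt)
      omega
    have hlc := hle l hl' hl hpl
    have hq : ∀ l', l' < len (q + 1) → PseudopalAt W l' →
        (∀ l, l' < l → l < len (q + 1) → ¬ PseudopalAt W l) → len q = l' := by
      intro l' h3 h4 h5
      obtain ⟨k, hk, hk'⟩ := h.norm l' h3.le h4
      subst hk'
      obtain ⟨h5, h6⟩ := h.next (k := k) (b := len (q + 1)) hk h3 le_rfl
        (h.pseudopalAt (by omega)) h5
      have := h.inj h6 (by omega) (by omega)
      congr 1; omega
    -- An intermediate length gives `len n < 2c`, while `len (n + 1) = len n + 2c ≤ 2 len n + 2`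
    -- gives `2c ≤ len n + 2`.
    obtain hL | hL : len (q + 1) + 1 = 2 * c ∨ len (q + 1) + 2 = 2 * c := by omega
    · obtain rfl : l = c := by omega
      obtain ⟨d, rfl⟩ : ∃ d, l = d + 1 := ⟨l - 1, by omega⟩
      refine h.pattern_of_center hc hf hσ (by omega)
        (by rwa [show len (q + 1) - (d + 1) = d by omega] at hrp) (by omega)
        (hq _ hl' hpl fun l hl hl' hpl => ?_) (by omega) (fun hp => ?_) (by omega)
      · have := hle l hl' (by omega) hpl; omega
      · have := hu _ (by omega) (by omega) hp; omega
    · obtain ⟨e, rfl⟩ : ∃ e, c = e + 2 := ⟨c - 2, by omega⟩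
      rw [show len (q + 1) - (e + 2) = e by omega] at hrp
      -- The condition `1 ≤ e` is needed because for `e = 0` the length `e + 2` is that of `w_n`
      -- itself.
      by_cases hpc : PseudopalAt W (e + 2) ∧ 1 ≤ e
      · refine h.pattern_of_half hc hf hσ (by omega) hrp hpc.2
          (hq _ (by omega) hpc.1 fun l hl hl' hpl => ?_) (by omega) (fun hp => ?_) (by omega)
        · have := hle l hl' (by omega) hpl; omega
        · have := hu _ (by omega) (by omega) hp; omega
      · have hle' : ∀ l, l < len (q + 1) → len (q + 1) - (e + 2) < l → PseudopalAt W l →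
            l = e + 1 := by
          intro l hl hl' hpl
          have := hle l hl hl' hpl
          by_contra hne
          obtain rfl : l = e + 2 := by omega
          exact hpc ⟨hpl, by omega⟩
        obtain rfl := hle' l hl' hl hpl
        refine h.pattern_of_short hc hf hσ (by omega) hrp
          (hq _ hl' hpl fun l hl hl' hpl => ?_) (by omega) (fun hp => ?_) (by omega)
        · have := hle' l hl' (by omega) hpl; omega
        · have := hu _ (by omega) (by omega) hp; omega

end

/-! ### From a form to exactly one missed prefix. -/

section

variable {W Δ : ℕ → Letter} {T : ℕ → Anti} {len : ℕ → ℕ} {n m : ℕ}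
variable {i j k : Letter} {r s v t : Anti}

theorem Generates.not_pseudopalAt_between (h : Generates W Δ T len n) {k l : ℕ} (hk : k + 1 ≤ n)
    (h1 : len k < l) (h2 : l < len (k + 1)) : ¬ PseudopalAt W l := by
  intro hp
  have h4 : len (k + 1) ≤ len n := by
    rcases hk.eq_or_lt with e | hk
    · rw [e]
    · exact (h.mono hk (by omega)).le
  obtain ⟨k', hk', rfl⟩ := h.norm l (by omega) hp
  rcases lt_trichotomy k k' with h3 | rfl | h3
  · rcases (Nat.succ_le_of_lt h3).eq_or_lt with e | h3
    · rw [Nat.succ_eq_add_one] at e; rw [e] at h2; omega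
    · have := h.mono h3 (by omega)
      rw [Nat.succ_eq_add_one] at this
      omega
  · omega
  · have := h.mono h3 (by omega); omega

/-- The first two relations eliminate `v`. The third serves the case that `w_{n-1}` has both the
type `r` and the type `sts`: all its letters are then equal. -/
theorem ConsecutiveTypes.relations (hf : ConsecutiveTypes r s v t) :
    (∀ a, v.letter a = t.letter (s.letter (r.letter a))) ∧
    (∀ a, v.letter a = s.letter (r.letter (s.letter a))) ∧
    ∀ a b, s.letter (t.letter (s.letter a)) = r.letter a →
      t.letter (s.letter b) = v.letter (s.letter b) → a = b ∧ t.letter (s.letter b) = b := by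
  rcases hf with ⟨i, rfl, rfl, rfl, rfl⟩ | ⟨i, rfl, rfl, rfl, rfl⟩ |
    ⟨i, j, k, hij, hjk, hik, rfl, rfl, rfl, rfl⟩
  · revert i; decide
  · revert i; decide
  · revert i j k; decide

/-- In the forms with one missed pseudopalindrome, `w_n` is followed by two pseudopalindromes at
equal distances, the first of which is missed. -/
theorem Generates.missed_of_form (h : Generates W Δ T len (m + 2))
    (hf : ConsecutiveTypes r (T (m + 1)) v (T (m + 2))) (hr : PalAt W r (len (m + 1)))
    (hl : (T (m + 1)).letter (v.letter (Δ (m + 2))) = Δ (m + 1))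
    (hex : ¬ (Δ (m + 2) = Δ (m + 1) ∧ ∀ x < len (m + 1), W x = Δ (m + 1))) :
    ∃ c, 0 < c ∧ len (m + 1) + c = len (m + 2) ∧ len (m + 2 + 1) = len (m + 2) + 2 * c ∧
      PalAt W v (len (m + 2) + c) ∧
      (∀ l, len (m + 2) < l → l < len (m + 2 + 1) → PseudopalAt W l → l = len (m + 2) + c) ∧
      W (len (m + 2) + c) = (T (m + 2)).letter ((T (m + 1)).letter (Δ (m + 1))) := by
  obtain ⟨hA, hB, hC⟩ := hf.relations
  have hpos : 0 < len (m + 1) := by have := h.lt m (by omega); omega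
  have hlt := h.lt (m + 1) (by omega)
  have hlt2 := h.lt (m + 2) le_rfl
  have hs := h.pal (m + 1) (by omega)
  have ht := h.pal (m + 2) le_rfl
  have hb1 := h.letter (m + 1) (by omega)
  have hb2 := h.letter (m + 2) le_rfl
  have hmin1 := h.min (m + 1) (by omega)
  have hmin2 := h.min (m + 2) le_rfl
  have hgap : ∀ l, len (m + 1) < l → l < len (m + 2) → ¬ PseudopalAt W l := fun l h1 h2 =>
    h.not_pseudopalAt_between (k := m + 1) (by omega) h1 h2
  generalize T (m + 1) = s at *
  generalize T (m + 2) = t at *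
  generalize Δ (m + 1) = b₁ at *
  generalize Δ (m + 2) = b₂ at *
  generalize len (m + 1) = l₁ at *
  generalize len (m + 2) = L at *
  generalize len (m + 2 + 1) = L₂ at *
  obtain ⟨c, rfl⟩ := Nat.exists_eq_add_of_le hlt.le
  have hc : 0 < c := by omega
  have hbound : c ≤ l₁ + 2 := by
    have := hmin1 (l₁ + 1) fun x y _ _ _ => by omega
    omega
  have hts : ∀ a, t.letter (s.letter a) = s.letter (r.letter (s.letter (r.letter a))) := fun a => by
    rw [← hB, hA, letter_letter]
  have htv : ∀ a, t.letter (v.letter a) = s.letter (r.letter a) := fun a => by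
    rw [hA, letter_letter]
  have hb' : b₂ = v.letter (s.letter b₁) := by rw [← hl, letter_letter, letter_letter]
  have hb : b₂ = s.letter (r.letter b₁) := by rw [hb', hB, letter_letter]
  have hτ := hr.twist hs rfl
  have hmidc : W (c - 1) = s.letter b₁ := by rw [hs (c - 1) l₁ (by omega), hb1]
  -- The suffix of `w_n` and its new letter starting at `2c - 1` is a `t`-palindrome.
  have hupper : L₂ ≤ l₁ + c + 2 * c := by
    have hend : ∀ x, x = 2 * c - 1 → x < l₁ + c → b₂ = t.letter (W x) := by
      intro x hx hxL
      rw [show x = c - 1 + c by omega, hτ (c - 1) (by omega), hmidc, ← hB, htv, hb]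
    have := hmin2 (2 * c - 1) fun x y hx hy hxy => by
      rcases Nat.lt_trichotomy x (l₁ + c) with hxL | hxL | hxL
      · rcases Nat.lt_trichotomy y (l₁ + c) with hyL | hyL | hyL
        · obtain ⟨x, rfl⟩ := Nat.exists_eq_add_of_le' (show c + c ≤ x by omega)
          obtain ⟨y, rfl⟩ := Nat.exists_eq_add_of_le' (show c + c ≤ y by omega)
          rw [hs (x + (c + c)) y (by omega), ← add_assoc, hτ (y + c) (by omega), hτ y (by omega),
            ← hts, letter_letter]
        · rw [hyL, hb2, hend x (by omega) hxL, letter_letter]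
        · omega
      · rcases Nat.lt_trichotomy y (l₁ + c) with hyL | hyL | hyL
        · rw [hxL, hb2, hend y (by omega) hyL]
        · have e : s.letter b₁ = b₁ := by rw [← hmidc, show c - 1 = l₁ by omega, hb1]
          rw [hxL, hyL, hb2]
          conv_rhs => rw [hb', htv]
          rw [hb, e]
        · omega
      · omega
    omega
  -- If `w_{n+1}` were shorter, its palindromic suffix would either consist of the new letter alone,
  -- or reflect in `w_n` to a pseudopalindromic prefix. If shorter than `w_{n-1}`, that prefix
  -- shortens the closure `w_n`; if equal, it makes `w_{n-1}` constant; if longer, it contradicts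
  -- normalization.
  have hlower : l₁ + c + 2 * c ≤ L₂ := by
    by_contra! hlow
    obtain ⟨d, rfl⟩ := Nat.exists_eq_add_of_le hlt2.le
    rcases Nat.lt_or_ge (l₁ + c) d with hd | hd
    · have e1 : b₂ = t.letter b₂ := by
        rw [← hb2]; exact ht _ _ (by omega)
      have e2 : s.letter b₁ = b₁ := by
        rw [hb', htv, hB, letter_letter] at e1
        exact (r.letter_injective (s.letter_injective e1)).symm
      have := hmin1 l₁ fun x y _ _ _ => by
        rw [show x = l₁ by omega, show y = l₁ by omega, hb1, e2]
      omega
    · obtain ⟨u, hu⟩ := Anti.exists_conj s t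
      have hp : PalAt W u (l₁ + c - d) :=
        hs.conj_of_suffix (ht.suffix (a := d - 1) (by omega)) (by omega) hu
      have hnext : b₂ = t.letter (s.letter (W (l₁ + c - d))) := by
        rw [← hb2, ht (l₁ + c) (d - 1) (by omega), hs (d - 1) (l₁ + c - d) (by omega)]
      rcases Nat.lt_trichotomy (l₁ + c - d) l₁ with h1 | h1 | h1
      · generalize hq : l₁ + c - d = q at *
        have hend : b₁ = s.letter (r.letter (W q)) := by
          rw [hb, hts] at hnext
          exact r.letter_injective (s.letter_injective hnext)
        have := hmin1 (l₁ - q - 1) fun x y hx hy hxy => by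
          rcases Nat.lt_trichotomy x l₁ with hxL | hxL | hxL
          · rcases Nat.lt_trichotomy y l₁ with hyL | hyL | hyL
            · rw [hr x (l₁ - 1 - x) (by omega), hp (l₁ - 1 - x) (l₁ - 1 - y) (by omega), hu,
                hr (l₁ - 1 - y) y (by omega), ← hA, hB, letter_letter, letter_letter]
            · rw [hyL, hb1, hr x q (by omega), hend, letter_letter]
            · omega
          · rw [hxL, hb1, hr y q (by omega), hend]
          · omega
        omega
      · rw [h1] at hp hnext
        rw [hb1] at hnext
        refine hex ⟨?_, fun x hx => ?_⟩
        · rw [hnext]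
          refine (hC (W 0) b₁ ?_ (by rw [← hnext, hb'])).2
          rw [← hu, ← hp (l₁ - 1) 0 (by omega), ← hr (l₁ - 1) 0 (by omega)]
        · refine (hC (W x) b₁ ?_ (by rw [← hnext, hb'])).1
          rw [← hu, ← hp (l₁ - 1 - x) x (by omega), ← hr (l₁ - 1 - x) x (by omega)]
      · exact hgap _ h1 (by omega) ⟨u, hp⟩
  obtain rfl : L₂ = l₁ + c + 2 * c := by omega
  have hψ := hs.twist ht rfl
  have hv : PalAt W v (l₁ + c + c) := by
    -- Translation by `2c` handles `x < l₁` and translation by `c` handles `x ≥ c`. Since `c ≤ l₁ +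
    -- 2`, at most two positions remain between them; they involve the new letters.
    have key : ∀ x y, x + y + 1 = l₁ + c + c → x ≤ y → W x = v.letter (W y) := by
      intro x y hxy hle
      rcases Nat.lt_or_ge x l₁ with hx | hx
      · obtain ⟨y, rfl⟩ := Nat.exists_eq_add_of_le' (show 2 * c ≤ y by omega)
        rw [hψ y (by omega), hr y x (by omega), ← hA, letter_letter]
      rcases Nat.lt_or_ge x c with hxc | hxc
      · obtain rfl | rfl : y = l₁ + c ∨ y = l₁ + c + 1 := by omega
        · rw [show x = c - 1 by omega, hmidc, hb2, hb', letter_letter]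
        · obtain rfl : x = l₁ := by omega
          have e1 : W (x + c + 1) = t.letter b₂ := by rw [← hb2]; exact ht _ _ (by omega)
          have e2 : t.letter b₂ = v.letter b₁ := by rw [hb', htv, ← hB]
          rw [e1, e2, hb1, letter_letter]
      · obtain ⟨y, rfl⟩ := Nat.exists_eq_add_of_le' (show c ≤ y by omega)
        rw [hτ y (by omega), hs x y (by omega), hB, letter_letter, letter_letter]
    intro x y hxy
    rcases le_total x y with hle | hle
    · exact key x y hxy hle
    · rw [key y x (by omega) hle, letter_letter]
  have hσ := hv.twist ht (d := c) (by omega)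
  refine ⟨c, hc, rfl, rfl, hv, fun l h1 h2 hp => ?_, ?_⟩
  -- Shifting down by `c` once, or twice above the middle, lands strictly between `w_{n-1}` and
  -- `w_n`.
  · have hlow : ∀ l, l₁ + c < l → l < l₁ + c + c → ¬ PseudopalAt W l := by
      intro l h1 h2 hp
      obtain ⟨l, rfl⟩ := Nat.exists_eq_add_of_le' (show c ≤ l by omega)
      exact hgap l (by omega) (by omega) (hp.shift_down hσ (by omega) (by omega))
    rcases Nat.lt_trichotomy l (l₁ + c + c) with h3 | h3 | h3
    · exact (hlow l h1 h3 hp).elim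
    · exact h3
    · obtain ⟨l, rfl⟩ := Nat.exists_eq_add_of_le' (show c ≤ l by omega)
      exact (hlow l (by omega) (by omega) (hp.shift_down hσ (by omega) (by omega))).elim
  · rw [ht (l₁ + c + c) (c - 1) (by omega), hmidc]

end

/-! ### Passage between words and letter sequences; representatives. -/

section

variable {Δ Δ' : ℕ → Letter} {Θ Θ' : ℕ → Anti} {n m : ℕ} {t : Anti}

/-- The letter of a word at a position. -/
def letterAt (u : Word) (x : ℕ) : Letter := u.getD x 0

theorem letterAt_of_prefix {u v : Word} (h : u <+: v) {x : ℕ} (hx : x < u.length) :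
    letterAt v x = letterAt u x := by
  obtain ⟨z, rfl⟩ := h
  exact List.getD_append _ _ _ _ hx

theorem ext_letterAt {u v : Word} (hl : u.length = v.length)
    (h : ∀ x < u.length, letterAt u x = letterAt v x) : u = v := by
  refine List.ext_getElem hl fun x h1 h2 => ?_
  have := h x h1
  simpa [letterAt, h1, h2] using this

theorem isPal_iff {u : Word} : IsPal t u ↔ PalAt (letterAt u) t u.length := by
  have himg : ∀ x y, x + y + 1 = u.length → letterAt (t.image u) x = t.letter (letterAt u y) := by
    intro x y hxy
    have h1 : x < (t.image u).length := by rw [length_image]; omega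
    have h2 : y < u.length := by omega
    simp only [letterAt, List.getD_eq_getElem _ _ h1, List.getD_eq_getElem _ _ h2]
    simp only [Anti.image, List.getElem_reverse, List.getElem_map, List.length_map]
    congr 2
    omega
  constructor
  · intro h x y hxy
    rw [← himg x y hxy, h]
  · intro h
    refine ext_letterAt (t.length_image u) fun x hx => ?_
    rw [length_image] at hx
    rw [himg x (u.length - 1 - x) (by omega), h x (u.length - 1 - x) (by omega)]

theorem isPal_iff_of_prefix {u v : Word} (h : u <+: v) :
    IsPal t u ↔ PalAt (letterAt v) t u.length := by
  rw [isPal_iff]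
  constructor <;> intro hp x y hxy <;> have := hp x y hxy
  · rwa [letterAt_of_prefix h (by omega), letterAt_of_prefix h (by omega)]
  · rwa [letterAt_of_prefix h (by omega), letterAt_of_prefix h (by omega)] at this

theorem isPal_take_iff {v : Word} {l : ℕ} (h : l ≤ v.length) :
    IsPal t (v.take l) ↔ PalAt (letterAt v) t l := by
  rw [isPal_iff_of_prefix (List.take_prefix l v), List.length_take, min_eq_left h]

theorem isPseudopal_take_iff {v : Word} {l : ℕ} (h : l ≤ v.length) :
    IsPseudopal (v.take l) ↔ PseudopalAt (letterAt v) l :=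
  exists_congr fun _ => isPal_take_iff h

/-- The closure adds the image of what precedes the longest palindromic suffix, so any palindromic
suffix starting at `a` bounds the addition by `a` letters. -/
theorem closure_length_le {u v : Word} {b : Letter} (h : u ++ [b] <+: v) {a : ℕ}
    (hs : SuffixPal (letterAt v) t a u.length) :
    (closure t (u ++ [b])).length ≤ u.length + 1 + a := by
  have hp : IsPal t ((u ++ [b]).drop a) := by
    rw [isPal_iff]
    have hdrop : ∀ x, letterAt ((u ++ [b]).drop a) x = letterAt (u ++ [b]) (a + x) := fun x => by
      simp [letterAt, List.getD]
    intro x y hxy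
    rw [List.length_drop, List.length_append, List.length_singleton] at hxy
    rw [hdrop, hdrop, ← letterAt_of_prefix h (by simp; omega),
      ← letterAt_of_prefix h (by simp; omega)]
    exact hs _ _ (by omega) (by omega) (by omega)
  have := Nat.find_min' (exists_pal_suffix t (u ++ [b])) hp
  simp only [closure, List.length_append, length_image, List.length_take, List.length_singleton]
  omega

theorem closure_eq {u q : Word} (hq : IsPal t q) (hu : u <+: q)
    (hmin : ∀ v, IsPal t v → u <+: v → q.length ≤ v.length) : closure t u = q := by
  obtain ⟨h1, h2, h3⟩ := closure_spec t u
  by_contra hne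
  have := h3 q hq hu (Ne.symm hne)
  have := hmin _ h1 h2
  omega

theorem closure_length_min {u q : Word} (hq : IsPal t q) (hu : u <+: q) :
    (closure t u).length ≤ q.length := by
  by_cases h : q = closure t u
  · rw [h]
  · exact ((closure_spec t u).2.2 q hq hu h).le

theorem w_append_prefix (k : ℕ) : w Δ Θ k ++ [Δ k] <+: w Δ Θ (k + 1) := (closure_spec _ _).2.1

theorem w_prefix {a b : ℕ} (h : a ≤ b) : w Δ Θ a <+: w Δ Θ b := by
  induction b, h using Nat.le_induction with
  | base => exact List.prefix_rfl
  | succ b _ ih => exact ih.trans ((List.prefix_append _ _).trans (w_append_prefix b))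

theorem w_length_add (a d : ℕ) : (w Δ Θ a).length + d ≤ (w Δ Θ (a + d)).length := by
  induction d with
  | zero => exact le_rfl
  | succ d ih =>
    have := (w_append_prefix (Δ := Δ) (Θ := Θ) (a + d)).length_le
    rw [List.length_append, List.length_singleton] at this
    rw [← add_assoc a d 1]
    omega

/-- All words up to `w_{n+1}` are prefixes of it, so its letters serve for all of them. -/
theorem generates (h : NormalizedPrefix Δ Θ n) :
    Generates (letterAt (w Δ Θ (n + 1))) Δ Θ (fun k => (w Δ Θ k).length) n where
  zero := rfl
  lt k _ := w_length_add k 1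
  pal k hk := (isPal_iff_of_prefix (w_prefix (by omega))).1 (closure_spec _ _).1
  letter k hk := by
    rw [letterAt_of_prefix ((w_append_prefix k).trans (w_prefix (by omega))) (by simp)]
    simp [letterAt]
  norm l hl hp := by
    have hpre := w_prefix (Δ := Δ) (Θ := Θ) (Nat.le_succ n)
    have htake : (w Δ Θ (n + 1)).take l = (w Δ Θ n).take l := by
      obtain ⟨z, hz⟩ := hpre
      rw [← hz, List.take_append_of_le_length hl]
    obtain ⟨k, hk, e⟩ := h _ (List.take_prefix l _)
      (by rw [← htake]; exact (isPseudopal_take_iff (hl.trans hpre.length_le)).2 hp)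
    refine ⟨k, hk, ?_⟩
    show (w Δ Θ k).length = l
    rw [e, List.length_take, min_eq_left hl]
  min k hk a ha := closure_length_le ((w_append_prefix k).trans (w_prefix (by omega))) ha

theorem w_congr {k : ℕ} (h : ∀ p < k, Δ p = Δ' p ∧ Θ p = Θ' p) : w Δ Θ k = w Δ' Θ' k := by
  induction k with
  | zero => rfl
  | succ k ih =>
    obtain ⟨h1, h2⟩ := h k (by omega)
    rw [w, w, ih fun p hp => h p (by omega), h1, h2]

theorem eq_replicate_of_prefix {u : Word} {k : ℕ} {i : Letter} (h : u <+: List.replicate k i) :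
    u = List.replicate u.length i :=
  List.eq_replicate_iff.2 ⟨rfl, fun _ hb => List.eq_of_mem_replicate (h.subset hb)⟩

theorem isPal_replicate {i : Letter} (h : t.letter i = i) (k : ℕ) :
    IsPal t (List.replicate k i) := by
  simp [IsPal, Anti.image, h]

/-- Both `R` and `E i` fix `i`, so a power of `i` is its own closure for either. -/
theorem BlockEquiv.w_eq (h : BlockEquiv Δ Θ Θ') (k : ℕ) : w Δ Θ' k = w Δ Θ k := by
  induction k with
  | zero => rfl
  | succ k ih =>
    rcases h k with e | ⟨i, hi, e⟩
    · rw [w, w, ih, e]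
    · have h1 : w Δ Θ k ++ [Δ k] = List.replicate (k + 1) i := by
        have hp := hi ▸ w_append_prefix (Δ := Δ) (Θ := Θ) k
        have hl := w_length_add (Δ := Δ) (Θ := Θ) 0 k
        have hl' := hp.length_le
        have e := eq_replicate_of_prefix hp
        rw [List.length_replicate] at hl'
        rw [Nat.zero_add] at hl
        rw [show (w Δ Θ k ++ [Δ k]).length = k + 1 by
          rw [List.length_append, List.length_singleton] at hl' ⊢; omega] at e
        exact e
      rw [w, ih, hi, h1]
      refine closure_eq (isPal_replicate ?_ _) List.prefix_rfl fun v _ hv => hv.length_le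
      rcases e with e | e <;> rw [e]
      · rfl
      · exact letter_E_self i

theorem BlockEquiv.normalizedPrefix (h : BlockEquiv Δ Θ Θ') (hn : NormalizedPrefix Δ Θ n) :
    NormalizedPrefix Δ Θ' n := by
  intro p hp hpp
  rw [h.w_eq] at hp
  obtain ⟨k, hk, e⟩ := hn p hp hpp
  exact ⟨k, hk, by rw [h.w_eq, e]⟩

open Classical in
/-- The representative carrying `E i` at all positions of the initial block. -/
noncomputable def canonical (Δ : ℕ → Letter) (Θ : ℕ → Anti) (m : ℕ) : Anti :=
  if h : ∃ i, w Δ Θ (m + 1) = List.replicate (m + 1) i then E h.choose else Θ m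

theorem blockEquiv_canonical : BlockEquiv Δ Θ (canonical Δ Θ) := by
  intro m
  by_cases h : ∃ i, w Δ Θ (m + 1) = List.replicate (m + 1) i
  · exact Or.inr ⟨h.choose, h.choose_spec, Or.inr (by rw [canonical, dif_pos h])⟩
  · exact Or.inl (by rw [canonical, dif_neg h])

theorem eq_replicate_of_const {u v : Word} (h : u <+: v) {i : Letter}
    (hc : ∀ x < u.length, letterAt v x = i) : u = List.replicate u.length i := by
  refine ext_letterAt (by simp) fun x hx => ?_
  rw [← letterAt_of_prefix h hx, hc x hx]
  simp [letterAt, hx]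

theorem canonical_spec :
    Canonical (letterAt (w Δ Θ (n + 1))) (canonical Δ Θ) (fun k => (w Δ Θ k).length) n := by
  intro k hk hl hc
  have h1 := eq_replicate_of_const (w_prefix (Δ := Δ) (Θ := Θ) (show k + 1 ≤ n + 1 by omega))
    (i := letterAt (w Δ Θ (n + 1)) 0) fun x hx => hc x (by simp only at hl; omega)
  simp only at hl
  rw [hl] at h1
  have h : ∃ i, w Δ Θ (k + 1) = List.replicate (k + 1) i := ⟨_, h1⟩
  rw [canonical, dif_pos h]
  have h2 := h1.symm.trans h.choose_spec
  rw [List.replicate_succ, List.replicate_succ] at h2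
  rw [(List.cons.inj h2).1]

end

/-! ### Forms, rewriting rules and the new bi-sequence. -/

section

variable {Δ Δ' : ℕ → Letter} {Θ Θ' : ℕ → Anti} {n m : ℕ} {r s v t : Anti}

/-- All three rules are one: insert the type `v` of the missed prefix, and let the new letter be the
one that follows it in `w_{n+1}`. -/
theorem FactorRule.consecutiveTypes {a b₁ b₂ : Letter} {D : Word} {U : List Anti}
    (h : FactorRule [a, b₁, b₂] [r, s, t] D U) :
    ∃ v, ConsecutiveTypes r s v t ∧ s.letter (v.letter b₂) = b₁ ∧
      D = [a, b₁, b₂, t.letter (s.letter b₁)] ∧ U = [r, s, v, t] := by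
  cases h with
  | rule₁ _ _ _ i h =>
    refine ⟨R, Or.inl ⟨i, rfl, rfl, rfl, rfl⟩, h.symm, ?_, rfl⟩
    rw [letter_letter]
  | rule₂ _ _ _ i h => exact ⟨E i, Or.inr (Or.inl ⟨i, rfl, rfl, rfl, rfl⟩), h.symm, rfl, rfl⟩
  | rule₃ _ _ _ i j k hij hjk hik h =>
    refine ⟨E k, Or.inr (Or.inr ⟨k, i, j, hik.symm, hij, hjk.symm, rfl, rfl, rfl, rfl⟩), ?_, rfl,
      rfl⟩
    have key : ∀ i j k b₁ b₂ : Letter, i ≠ j → j ≠ k → i ≠ k →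
        (E i).letter b₁ = (E j).letter b₂ → (E j).letter ((E k).letter b₂) = b₁ := by decide
    exact key i j k b₁ b₂ hij hjk hik h

theorem MissForm.exists_factorRule {u : Word} {l : ℕ} {a b₁ b₂ : Letter}
    (h : MissForm u l a b₁ b₂ r s t) : ∃ D U, FactorRule [a, b₁, b₂] [r, s, t] D U := by
  rcases h with ⟨i, rfl, rfl, rfl, h, -⟩ | ⟨i, rfl, rfl, rfl, h, -⟩ | ⟨i, j, hij, rfl, rfl, rfl, h⟩
  · exact ⟨_, _, .rule₁ a b₁ b₂ i h⟩
  · exact ⟨_, _, .rule₂ a b₁ b₂ i h⟩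
  · obtain ⟨k, hjk, hik⟩ := exists_third hij
    exact ⟨_, _, .rule₃ a b₁ b₂ i j k hij hjk hik h⟩

theorem ConsecutiveTypes.left_ne (h : ConsecutiveTypes r s v t) : r ≠ s := by
  rcases h with ⟨i, rfl, rfl, -, -⟩ | ⟨i, rfl, rfl, -, -⟩ | ⟨i, j, k, hij, hjk, hik, rfl, rfl, -, -⟩
  · simp
  · simp
  · simpa using hjk

/-- In the first two forms a constant word is exactly the listed exception. In the third, `E i`
would fix the only letter, which `E j` then moves. -/
theorem MissForm.not_const (hn : NormalizedPrefix Δ Θ (m + 2))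
    (h : MissForm (w Δ Θ (m + 1)) (m + 1) (Δ m) (Δ (m + 1)) (Δ (m + 2)) (Θ m) (Θ (m + 1))
      (Θ (m + 2))) :
    ¬ (Δ (m + 2) = Δ (m + 1) ∧
      ∀ x < (w Δ Θ (m + 1)).length, letterAt (w Δ Θ (m + 3)) x = Δ (m + 1)) := by
  rintro ⟨h1, h2⟩
  have hg := generates hn
  have hpos := hg.lt m (by omega)
  have hlen : (w Δ Θ (m + 1)).length = m + 1 := by
    have h4 := hg.mono (show m + 1 < m + 2 by omega) (by omega)
    obtain ⟨h5, h6⟩ := hg.len_eq (p := (w Δ Θ (m + 1)).length) (by omega)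
      fun l hl => ⟨R, ConstOn.palAt h2 rfl hl⟩
    exact hg.inj (h6 _ le_rfl) (by omega) (by omega)
  have hrep := eq_replicate_of_const (w_prefix (show m + 1 ≤ m + 3 by omega)) h2
  rw [hlen] at hrep
  have ha : Δ m = Δ (m + 1) := by rw [← hg.letter m (by omega)]; exact h2 _ hpos
  have key : ∀ i b : Letter, b = (E i).letter b → b = i := by decide
  rcases h with ⟨i, -, -, -, h5, h6⟩ | ⟨i, -, -, -, h5, h6⟩ | ⟨i, j, hij, hi, -, -, h5⟩
  · rw [h1] at h5
    have e := key i _ h5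
    exact h6 ⟨ha.trans e, e, h1.trans e, by rw [hrep, e]⟩
  · rw [h1] at h5
    have e := key i _ h5
    exact h6 ⟨ha.trans e, e, h1.trans e, by rw [hrep, e]⟩
  · rw [h1] at h5
    have h7 := hg.pal m (by omega) 0 m (by omega)
    rw [h2 0 (by omega), h2 m (by omega), hi] at h7
    have key : ∀ i j b : Letter, i ≠ j → b = (E i).letter b →
        (E i).letter b ≠ (E j).letter b := by decide
    exact key i j _ hij h7 h5

theorem Generates.length_le_of_const {W : ℕ → Letter} {len : ℕ → ℕ} (h : Generates W Δ Θ len n)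
    {k : ℕ} (hk : k ≤ n) {i : Letter} (hW : ∀ x < len k, W x = i) (hi : Δ k = i)
    (ht : (Θ k).letter i = i) : len (k + 1) ≤ len k + 1 := by
  have hW' : ∀ x ≤ len k, W x = i := fun x hx => by
    rcases hx.eq_or_lt with rfl | hx
    · rw [h.letter k hk, hi]
    · exact hW x hx
  exact h.min k hk 0 fun x y _ _ _ => by rw [hW' x (by omega), hW' y (by omega), ht]

/-- The three forms do not occur with a constant word `w_{n-1}` unless a pseudopalindrome is
missed. -/
theorem Generates.not_const_of_lt {W : ℕ → Letter} {len : ℕ → ℕ}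
    (h : Generates W Δ Θ len (m + 2)) (hlt : len (m + 2) + 1 < len (m + 3)) {i : Letter}
    (h1 : (Θ (m + 1)).letter i = i) (h2 : (Θ (m + 2)).letter i = i) :
    ¬ (Δ (m + 1) = i ∧ Δ (m + 2) = i ∧ ∀ x < len (m + 1), W x = i) := by
  rintro ⟨h3, h4, h5⟩
  have h6 := h.length_le_of_const (k := m + 1) (by omega) h5 h3 h1
  have h7 := h.length_le_of_const (k := m + 2) le_rfl (i := i) (fun x hx => ?_) h4 h2
  · have : len (m + 2 + 1) = len (m + 3) := rfl
    have : len (m + 1 + 1) = len (m + 2) := rfl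
    omega
  · rcases (show x ≤ len (m + 1) by have : len (m + 1 + 1) = len (m + 2) := rfl
                                    omega).eq_or_lt with rfl | hx
    · rw [h.letter _ (by omega), h3]
    · exact h5 x hx

theorem mem_missed_iff {p : Word} :
    p ∈ missed Δ Θ n ↔ ∃ l, (w Δ Θ n).length < l ∧ l < (w Δ Θ (n + 1)).length ∧
      PseudopalAt (letterAt (w Δ Θ (n + 1))) l ∧ p = (w Δ Θ (n + 1)).take l := by
  constructor
  · rintro ⟨h1, h2, h3, h4⟩
    have e := List.prefix_iff_eq_take.1 h1
    exact ⟨p.length, h3, h4, (isPseudopal_take_iff h4.le).1 (e ▸ h2), e⟩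
  · rintro ⟨l, h1, h2, h3, rfl⟩
    refine ⟨List.take_prefix _ _, (isPseudopal_take_iff h2.le).2 h3, ?_, ?_⟩ <;>
      rwa [List.length_take, min_eq_left h2.le]

theorem missed_ncard_eq_one (hn : NormalizedPrefix Δ Θ (m + 2))
    (h : MissForm (w Δ Θ (m + 1)) (m + 1) (Δ m) (Δ (m + 1)) (Δ (m + 2)) (Θ m) (Θ (m + 1))
      (Θ (m + 2))) : (missed Δ Θ (m + 2)).ncard = 1 := by
  obtain ⟨D, U, hr⟩ := h.exists_factorRule
  obtain ⟨v, hf, hl, -, -⟩ := hr.consecutiveTypes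
  have hg := generates hn
  obtain ⟨c, hc, -, h2, h3, h4, -⟩ := hg.missed_of_form hf (hg.pal m (by omega)) hl (h.not_const hn)
  refine Set.ncard_eq_one.2 ⟨(w Δ Θ (m + 3)).take ((w Δ Θ (m + 2)).length + c), ?_⟩
  ext p
  rw [mem_missed_iff, Set.mem_singleton_iff]
  constructor
  · rintro ⟨l, h5, h6, h7, rfl⟩
    rw [h4 l h5 h6 h7]
  · rintro rfl
    exact ⟨_, by omega, by omega, ⟨v, h3⟩, rfl⟩

/-- The patterns are excluded for the canonical representative; the form is then found for a
modification of it at one position. -/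
theorem exists_missForm (hn : NormalizedPrefix Δ Θ n)
    (havoid : ∀ Θ', BlockEquiv Δ Θ Θ' →
      ¬ IsPrefixRuleLeftSide (pre Δ (n + 1)) (pre Θ' (n + 1)))
    (h1 : (missed Δ Θ n).ncard = 1) :
    ∃ m, n = m + 2 ∧ ∃ Θ', BlockEquiv Δ Θ Θ' ∧
      MissForm (w Δ Θ (m + 1)) (m + 1)
        (Δ m) (Δ (m + 1)) (Δ (m + 2)) (Θ' m) (Θ' (m + 1)) (Θ' (m + 2)) := by
  obtain ⟨q, hq⟩ := Set.ncard_eq_one.1 h1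
  obtain ⟨L, hL1, hL2, hL3, rfl⟩ := mem_missed_iff.1 (hq ▸ Set.mem_singleton q)
  have hb := blockEquiv_canonical (Δ := Δ) (Θ := Θ)
  have hg := generates (hb.normalizedPrefix hn)
  simp only [hb.w_eq] at hg
  have hu : ∀ l, (w Δ Θ n).length < l → l < (w Δ Θ (n + 1)).length →
      PseudopalAt (letterAt (w Δ Θ (n + 1))) l → l = L := by
    intro l h2 h3 h4
    have h5 : (w Δ Θ (n + 1)).take l ∈ missed Δ Θ n := mem_missed_iff.2 ⟨l, h2, h3, h4, rfl⟩
    rw [hq, Set.mem_singleton_iff] at h5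
    have := congrArg List.length h5
    rw [List.length_take, List.length_take] at this
    omega
  rcases hg.pattern_or_form canonical_spec hL1 hL2 hL3 hu with h | ⟨m, r, v, rfl, hr, hf, hl⟩
  · exact (havoid _ hb h).elim
  have hg' := generates hn
  have hpos := hg'.lt m (by omega)
  -- The type `r` found for `w_{n-1}` need not be the prescribed one. If it differs, `w_{n-1}` is a
  -- power of a letter and `r` is an admissible choice there.
  refine ⟨m, rfl, Function.update (canonical Δ Θ) m r, fun p => ?_, ?_⟩
  · by_cases hp : p = m
    · subst hp
      rw [Function.update_self]
      rcases hr.eq_or_const (hg'.pal p (by omega)) (by omega) with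
        e | ⟨i, hi, e, -⟩
      · exact Or.inl e
      · refine Or.inr ⟨i, ?_, e⟩
        have hmono := hg'.mono (show p + 1 < p + 2 by omega) (by omega)
        obtain ⟨h5, h6⟩ := hg'.len_eq (p := (w Δ Θ (p + 1)).length)
          (by omega) fun l hl => ⟨R, ConstOn.palAt hi rfl hl⟩
        have hlen : (w Δ Θ (p + 1)).length = p + 1 :=
          hg'.inj (h6 _ le_rfl) (by omega) (by omega)
        have := eq_replicate_of_const (w_prefix (show p + 1 ≤ p + 2 + 1 by omega)) hi
        rwa [hlen] at this
    · rw [Function.update_of_ne hp]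
      exact hb p
  · rw [Function.update_self, Function.update_of_ne (by omega), Function.update_of_ne (by omega)]
    -- In the exceptional cases the closure adds nothing to the appended letter, leaving no room for
    -- a missed prefix.
    have hex : ∀ i, (canonical Δ Θ (m + 1)).letter i = i → (canonical Δ Θ (m + 2)).letter i = i →
        ¬ (Δ m = i ∧ Δ (m + 1) = i ∧ Δ (m + 2) = i ∧
          w Δ Θ (m + 1) = List.replicate (m + 1) i) := by
      rintro i e1 e2 ⟨-, e3, e4, e5⟩
      refine hg.not_const_of_lt
        (show (w Δ Θ (m + 2)).length + 1 < (w Δ Θ (m + 2 + 1)).length by omega)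
        e1 e2 ⟨e3, e4, fun x hx => ?_⟩
      rw [letterAt_of_prefix (w_prefix (by omega)) hx, e5]
      rw [e5, List.length_replicate] at hx
      simp [letterAt, hx]
    rcases hf with ⟨i, rfl, hs, rfl, ht⟩ | ⟨i, rfl, hs, rfl, ht⟩ |
      ⟨i, j, k, hij, hjk, hik, rfl, hs, rfl, ht⟩
    · rw [hs] at hl
      exact Or.inl ⟨i, rfl, hs, ht, hl.symm, hex i (by rw [hs, letter_E_self])
        (by rw [ht, letter_E_self])⟩
    · rw [hs] at hl
      exact Or.inr (Or.inl ⟨i, rfl, hs, ht, hl.symm, hex i (by rw [hs]; rfl) (by rw [ht]; rfl)⟩)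
    · rw [hs] at hl
      refine Or.inr (Or.inr ⟨j, k, hjk, rfl, hs, ht, ?_⟩)
      have key : ∀ i j k b₁ b₂ : Letter, i ≠ j → j ≠ k → i ≠ k →
        (E k).letter ((E i).letter b₂) = b₁ → (E j).letter b₁ = (E k).letter b₂ := by decide
      exact key i j k _ _ hij hjk hik hl

section Replace

variable {α : Type} {f : ℕ → α} {a b c d : α}

theorem replaceFactor_of_lt {p : ℕ} {x : List α} (hp : p < m) : replaceFactor f m x p = f p :=
  if_pos hp

theorem replaceFactor_four :
    replaceFactor f m [a, b, c, d] m = a ∧ replaceFactor f m [a, b, c, d] (m + 1) = b ∧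
      replaceFactor f m [a, b, c, d] (m + 2) = c ∧ replaceFactor f m [a, b, c, d] (m + 3) = d ∧
      ∀ p, m + 3 ≤ p → replaceFactor f m [a, b, c, d] (p + 1) = f p := by
  refine ⟨by simp [replaceFactor], by simp [replaceFactor], by simp [replaceFactor],
    by simp [replaceFactor], fun p hp => ?_⟩
  rw [replaceFactor, if_neg (by omega), List.getElem?_eq_none (by simp; omega)]
  simp only [Option.getD_none, List.length_cons, List.length_nil]
  congr 1
  omega

end Replace

theorem replaceFactor_generates (hn : NormalizedPrefix Δ Θ (m + 2))
    (h : MissForm (w Δ Θ (m + 1)) (m + 1) (Δ m) (Δ (m + 1)) (Δ (m + 2)) (Θ m) (Θ (m + 1))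
      (Θ (m + 2))) {D : Word} {U : List Anti}
    (hr : FactorRule [Δ m, Δ (m + 1), Δ (m + 2)] [Θ m, Θ (m + 1), Θ (m + 2)] D U) :
    NormalizedPrefix (replaceFactor Δ m D) (replaceFactor Θ m U) (m + 4) ∧
      (Preprocessed Δ Θ (m + 2) →
        Preprocessed (replaceFactor Δ m D) (replaceFactor Θ m U) (m + 4)) ∧
      ∀ k, m + 3 ≤ k → w (replaceFactor Δ m D) (replaceFactor Θ m U) (k + 1) = w Δ Θ k := by
  obtain ⟨v, hf, hl, rfl, rfl⟩ := hr.consecutiveTypes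
  obtain ⟨dm, dm1, dm2, dm3, dm4⟩ := replaceFactor_four (f := Δ) (m := m) (a := Δ m)
    (b := Δ (m + 1)) (c := Δ (m + 2))
    (d := (Θ (m + 2)).letter ((Θ (m + 1)).letter (Δ (m + 1))))
  obtain ⟨tm, tm1, tm2, tm3, tm4⟩ := replaceFactor_four (f := Θ) (m := m) (a := Θ m)
    (b := Θ (m + 1)) (c := v) (d := Θ (m + 2))
  have dlt := fun p (hp : p < m) => replaceFactor_of_lt (f := Δ) (x := [Δ m, Δ (m + 1), Δ (m + 2),
    (Θ (m + 2)).letter ((Θ (m + 1)).letter (Δ (m + 1)))]) hp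
  have tlt := fun p (hp : p < m) => replaceFactor_of_lt (f := Θ)
    (x := [Θ m, Θ (m + 1), v, Θ (m + 2)]) hp
  generalize replaceFactor Δ m _ = Δ' at *
  generalize replaceFactor Θ m _ = Θ' at *
  have hg := generates hn
  obtain ⟨c, hc, hc1, h2, h3, h4, h5⟩ := hg.missed_of_form hf (hg.pal m (by omega)) hl
    (h.not_const hn)
  have hlow : ∀ k ≤ m + 2, w Δ' Θ' k = w Δ Θ k := fun k hk => w_congr fun p hp => by
    rcases Nat.lt_or_ge p m with hp' | hp'
    · exact ⟨dlt p hp', tlt p hp'⟩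
    · obtain rfl | rfl : p = m ∨ p = m + 1 := by omega
      · exact ⟨dm, tm⟩
      · exact ⟨dm1, tm1⟩
  set V := w Δ Θ (m + 3) with hV
  have hVl : V.length = (w Δ Θ (m + 2)).length + 2 * c := h2
  have hVpal : IsPal (Θ (m + 2)) V := (closure_spec _ _).1
  have hu : w Δ Θ (m + 2) ++ [Δ (m + 2)] <+: V := w_append_prefix (m + 2)
  have hQl : (V.take ((w Δ Θ (m + 2)).length + c)).length = (w Δ Θ (m + 2)).length + c := by
    rw [List.length_take]; omega
  -- A shorter `v`-palindrome would end `w_n` and its new letter in a longer `v`-palindromic suffix,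
  -- which reflects to a pseudopalindromic prefix strictly between `w_{n-1}` and `w_n`.
  have hQ : w Δ' Θ' (m + 3) = V.take ((w Δ Θ (m + 2)).length + c) := by
    rw [w, hlow (m + 2) le_rfl, dm2, tm2]
    have huQ : w Δ Θ (m + 2) ++ [Δ (m + 2)] <+: V.take ((w Δ Θ (m + 2)).length + c) :=
      List.prefix_of_prefix_length_le hu (List.take_prefix _ _)
        (by rw [hQl, List.length_append, List.length_singleton]; omega)
    refine closure_eq ((isPal_take_iff (by omega)).2 h3) huQ fun z hz huz => ?_
    by_contra! hlt
    have hzl := huz.length_le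
    rw [List.length_append, List.length_singleton] at hzl
    obtain ⟨a, ha⟩ := Nat.exists_eq_add_of_le hzl
    have hagree : ∀ x ≤ (w Δ Θ (m + 2)).length, letterAt V x = letterAt z x := fun x hx => by
      rw [letterAt_of_prefix hu (by simp; omega), letterAt_of_prefix huz (by simp; omega)]
    have hsuf : SuffixPal (letterAt V) v a (w Δ Θ (m + 2)).length := fun x y hx hy hxy => by
      rw [hagree x (by omega), hagree y (by omega)]
      exact isPal_iff.1 hz x y (by omega)
    obtain ⟨u, hu'⟩ := Anti.exists_conj (Θ (m + 1)) v
    have hp := (hg.pal (m + 1) (by omega)).conj_of_suffix hsuf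
      (l := (w Δ Θ (m + 2)).length - a - 1)
      (show (w Δ Θ (m + 2)).length - a - 1 + a + 1 = (w Δ Θ (m + 2)).length by omega) hu'
    exact hg.not_pseudopalAt_between (k := m + 1) le_rfl
      (show (w Δ Θ (m + 1)).length < (w Δ Θ (m + 2)).length - a - 1 by omega)
      (show (w Δ Θ (m + 2)).length - a - 1 < (w Δ Θ (m + 2)).length by omega) ⟨u, hp⟩
  -- The old word is already the shortest palindrome of its type extending `w_n` and its letter,
  -- hence also extending the longer inserted word.
  have hV' : w Δ' Θ' (m + 4) = V := by
    rw [w, hQ, dm3, tm3]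
    refine closure_eq hVpal ?_ fun z hz huz => ?_
    · rw [← h5]
      refine List.prefix_iff_eq_take.2 (ext_letterAt ?_ fun x hx => ?_)
      · simp only [List.length_append, List.length_take, List.length_singleton]
        omega
      · rw [List.length_append, hQl, List.length_singleton] at hx
        have hx' : x < (V.take ((V.take ((w Δ Θ (m + 2)).length + c) ++
            [letterAt V ((w Δ Θ (m + 2)).length + c)]).length)).length := by
          simp only [List.length_append, List.length_take, List.length_singleton]
          omega
        rw [← letterAt_of_prefix (List.take_prefix _ _) hx']
        rcases (Nat.le_of_lt_succ hx).eq_or_lt with rfl | hx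
        · rw [letterAt, letterAt, List.getD_append_right _ _ _ _ (by omega), hQl]
          simp
        · rw [letterAt_of_prefix (List.prefix_append (V.take ((w Δ Θ (m + 2)).length + c))
            [letterAt V ((w Δ Θ (m + 2)).length + c)]) (x := x) (by omega),
            letterAt_of_prefix (List.take_prefix ((w Δ Θ (m + 2)).length + c) V) (x := x)
              (by omega)]
    · refine closure_length_min hz (List.IsPrefix.trans ?_ huz)
      exact (List.prefix_of_prefix_length_le hu (List.take_prefix _ _)
        (by rw [hQl, List.length_append, List.length_singleton]; omega)).trans
        (List.prefix_append _ _)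
  have htail : ∀ k, m + 3 ≤ k → w Δ' Θ' (k + 1) = w Δ Θ k := by
    intro k hk
    induction k, hk using Nat.le_induction with
    | base => exact hV'
    | succ k hk ih =>
      rw [w, ih, dm4 k hk, tm4 k hk]
      rfl
  refine ⟨fun p hp hpp => ?_, fun hpre p hp i hi => ?_, htail⟩
  · rw [hV'] at hp
    have hpl := hp.length_le
    have hpe := List.prefix_iff_eq_take.1 hp
    have hpa : PseudopalAt (letterAt V) p.length := by
      rw [hpe] at hpp
      exact (isPseudopal_take_iff hpl).1 hpp
    rcases Nat.lt_or_ge (w Δ Θ (m + 2)).length p.length with h6 | h6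
    · rcases hpl.eq_or_lt with h7 | h7
      · exact ⟨m + 4, le_rfl, by rw [hV', hpe, h7, List.take_length]⟩
      · exact ⟨m + 3, by omega, by rw [hQ, ← h4 _ h6 h7 hpa, ← hpe]⟩
    · obtain ⟨k, hk, e⟩ := hn p
        (List.prefix_of_prefix_length_le hp (w_prefix (show m + 2 ≤ m + 3 by omega)) h6) hpp
      exact ⟨k, by omega, by rw [hlow k hk, e]⟩
  · rcases Nat.lt_or_ge p (m + 2) with hpm | hpm
    · have e : Θ' p = Θ p := by
        rcases Nat.lt_or_ge p m with hp' | hp'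
        · exact tlt p hp'
        · obtain rfl | rfl : p = m ∨ p = m + 1 := by omega
          · exact tm
          · exact tm1
      rw [e]
      exact hpre p hpm i (by rw [← hi, hlow _ (by omega)])
    · exfalso
      -- An initial block reaching the inserted position would contain `w_{n-1}` and `w_n`, and
      -- preprocessing would give them the same type, against `ConsecutiveTypes.left_ne`.
      have hshort : ∀ k ≤ m + 2, w Δ Θ k = List.replicate k i := by
        intro k hk
        have h6 := w_prefix (Δ := Δ') (Θ := Θ') (show k ≤ p + 1 by omega)
        have h7 := w_length_add (Δ := Δ') (Θ := Θ') 0 k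
        have h8 := w_length_add (Δ := Δ') (Θ := Θ') k (p + 1 - k)
        rw [show k + (p + 1 - k) = p + 1 by omega, hi, List.length_replicate] at h8
        rw [hi] at h6
        rw [Nat.zero_add] at h7
        have e := eq_replicate_of_prefix h6
        rwa [show (w Δ' Θ' k).length = k by omega, hlow k hk] at e
      exact hf.left_ne ((hpre m (by omega) i (hshort _ (by omega))).trans
        (hpre (m + 1) (by omega) i (hshort _ le_rfl)).symm)

end

end Pseudostandard

open Pseudostandard in
theorem theorem3 (Δ : ℕ → Letter) (Θ : ℕ → Anti) (n : ℕ)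
    (hnorm : NormalizedPrefix Δ Θ n)
    (havoid : ∀ Θ', BlockEquiv Δ Θ Θ' →
      ¬ IsPrefixRuleLeftSide (pre Δ (n + 1)) (pre Θ' (n + 1))) :
    ((missed Δ Θ n).ncard = 1 ↔
      ∃ m, n = m + 2 ∧ ∃ Θ', BlockEquiv Δ Θ Θ' ∧
        MissForm (w Δ Θ (m + 1)) (m + 1)
          (Δ m) (Δ (m + 1)) (Δ (m + 2)) (Θ' m) (Θ' (m + 1)) (Θ' (m + 2))) ∧
    (∀ m, n = m + 2 → ∀ Θ', BlockEquiv Δ Θ Θ' →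
      MissForm (w Δ Θ (m + 1)) (m + 1)
        (Δ m) (Δ (m + 1)) (Δ (m + 2)) (Θ' m) (Θ' (m + 1)) (Θ' (m + 2)) →
      ∀ D T, FactorRule [Δ m, Δ (m + 1), Δ (m + 2)] [Θ' m, Θ' (m + 1), Θ' (m + 2)] D T →
        NormalizedPrefix (replaceFactor Δ m D) (replaceFactor Θ' m T) (n + 2) ∧
        (Preprocessed Δ Θ' n →
          Preprocessed (replaceFactor Δ m D) (replaceFactor Θ' m T) (n + 2)) ∧
        (∀ k, n + 1 ≤ k →
          w (replaceFactor Δ m D) (replaceFactor Θ' m T) (k + 1) = w Δ Θ k)) := by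
  refine ⟨⟨exists_missForm hnorm havoid, ?_⟩, ?_⟩
  · rintro ⟨m, rfl, Θ', hb, h⟩
    have hm : missed Δ Θ' (m + 2) = missed Δ Θ (m + 2) := by simp only [missed, hb.w_eq]
    rw [← hm]
    rw [← hb.w_eq] at h
    exact missed_ncard_eq_one (hb.normalizedPrefix hnorm) h
  · rintro m rfl Θ' hb h D T hr
    rw [← hb.w_eq] at h
    obtain ⟨h1, h2, h3⟩ := replaceFactor_generates (hb.normalizedPrefix hnorm) h hr
    exact ⟨h1, h2, fun k hk => by rw [h3 k hk, hb.w_eq]⟩
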